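/- Fix $\delta\in(0,1/3)$, $\alpha\in[1,2)$ and $\mu\in(0,\frac1{4-\alpha})$. **Detection problem.** Let $\mathcal B_0(k)$ be the set of unit vectors of $\mathbf R^d$ with at most $k$ nonzero entries, and for $X_1,\dots,X_n\in\mathbf R^d$ put $\hat V_n(u)=\frac1n\sum_{i}(u^\top X_i)^2$. All laws below are centered with finite second moments. $\mathcal D_0$ is the set of laws $\mathbf P_0$ with variance $1$ in every unit direction such that for all unit $u$ and all $\nu\in(0,\frac12]$, $$\mathbf P_0^{\otimes n}\Big(|\hat V_n(u)-1|>4\sqrt{\tfrac{\log(1/\nu)}n}+4\tfrac{\log(1/\nu)}n\Big)\le\nu .$$ $\mathcal D_1^k(\theta)$ is the set of laws $\mathbf P_1$ for which some $v\in\mathcal B_0(k)$ has variance $\mathbf E[(v^\top X)^2]=1+\theta$ and, for all $\nu>0$, $$\mathbf P_1^{\otimes n}\Big(\hat V_n(v)-(1+\theta)<-2\sqrt{\tfrac{2\theta k\log(2/\nu)}n}-4\sqrt{\tfrac{\log(2/\nu)}n}\Big)\le\nu .$$ For a family of (randomized) tests $\psi=\{\psi_{d,n,k}\}$ let $$\mathrm{err}_\theta(\psi_{d,n,k})=\sup_{\mathbf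 P_0\in\mathcal D_0,\ \mathbf P_1\in\mathcal D_1^k(\theta)}\mathbf P_0^{\otimes n}(\psi_{d,n,k}=1)\vee\mathbf P_1^{\otimes n}(\psi_{d,n,k}=0).$$ Let $R_\mu$ be the set of triples of positive integers $(d,n,k)$ with $15\sqrt{k\log(6ed/\delta)/n}\le1$, $k\le d^{0.49}$, $k\ge n^\mu$ and $n<d$. **Randomized polynomial time.** A test is computed by a straight-line program that reads its real inputs and fair random bits and executes elementary operations on real numbers (constants, $+,-,\times,\div$, comparison); its running time is the number of operations, and it outputs $1$ iff the last number is positive. A family $\{\psi_{d,n,k}\}$ is in the class $\mathcal T$ of randomized polynomial time tests if each $\psi_{d,n,k}$ has such a program of running time at most a polynomial in $d+n+k$. A family $\{\xi_{m,\kappa}\}$ of tests on graphs with $m$ vertices (given by their adjacency matrices) is randomized polynomial time if each $\xi_{m,\kappa}$ has such a program of running time at most a polynomial in $m$. (The programs for different parameters need not be generated uniformly.) **Optimal rate.** For $R\subset R_\mu$, a function $\theta^\circ$ of $(d,n,k)$ is an optimal rate of detection over $\mathcal T$ on $R$ if (i) there are $\psi\in\mathcal T$ and $\bar c>0$ with $\mathrm{err}_\theta(\psi_{d,n,k})\le\delta$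 for all $(d,n,k)\in R$ and all $\theta>0$ with $\theta\ge\bar c\,\theta^\circ$; and (ii) for every $\phi\in\mathcal T$ there is $c_\phi>0$ with $\mathrm{err}_\theta(\phi_{d,n,k})\ge\delta$ for all $(d,n,k)\in R$ and all $0<\theta\le c_\phi\theta^\circ$. **Hypothesis $\mathsf{A_{PC}}$.** Let $\mathbf P_0^{(G)}$ be the law $\mathcal G(m,1/2)$ and $\mathbf P_1^{(G)}$ the law obtained by planting a clique on a uniformly random set of $\kappa$ vertices and joining all other pairs independently with probability $1/2$. For all $0<a<b<1$ and all randomized polynomial time $\xi=\{\xi_{m,\kappa}\}$ there is $\Gamma>0$ (depending on $\xi,a,b$) such that $$\mathbf P_0^{(G)}(\xi_{m,\kappa}=1)\vee\mathbf P_1^{(G)}(\xi_{m,\kappa}=0)\ge1.2\,\delta\qquad\text{whenever } 2<\kappa\le m,\ m^{a/2}<\Gamma\kappa<m^{b/2}.$$ **Statement.** Assume $\mathsf{A_{PC}}$. For $A,\varepsilon>0$ let $R_\mu^{A,\varepsilon}$ be the set of $(d,n,k)\in R_\mu$ with $d\le n^A$ and $\sqrt{k^\alpha/n}\le n^{-\varepsilon}$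 (if $\varepsilon\le\frac{2-\alpha}4$ the last condition holds whenever $k\le\sqrt n$). Then: 1. some $\psi\in\mathcal T$ satisfies (i) on $R_\mu$ with $\sqrt{k^2\log d/n}$ in place of $\theta^\circ$; 2. for all $A,\varepsilon>0$, every $\phi\in\mathcal T$ satisfies (ii) on $R_\mu^{A,\varepsilon}$ with $\sqrt{k^\alpha/n}$ in place of $\theta^\circ$; 3. consequently, up to constants, $\sqrt{k^\alpha/n}\le\theta^\circ\le\sqrt{k^2\log d/n}$: if $R\subset R_\mu$ and $\theta^\circ$ is an optimal rate of detection over $\mathcal T$ on $R$, there is $C>0$ with $\theta^\circ\le C\sqrt{k^2\log d/n}$ on $R$, and for all $A,\varepsilon>0$ there is $c>0$ with $c\sqrt{k^\alpha/n}\le\theta^\circ$ on $R\cap R_\mu^{A,\varepsilon}$. -/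

import Mathlib

open MeasureTheory
open scoped ENNReal

noncomputable section

namespace SparsePC

/-! ### Computational model: randomized real-arithmetic programs -/

/-- One elementary operation on real numbers. `ι` indexes the readable inputs. An operand `a : ℕ`
refers to the result of the instruction executed `a + 1` steps earlier. -/
inductive Instr (ι : Type) : Type
  | input (i : ι)
  | const (c : ℝ)
  | add (a b : ℕ)
  | sub (a b : ℕ)
  | mul (a b : ℕ)
  | div (a b : ℕ)
  | le (a b : ℕ)

open Classical in
/-- Result of one instruction. `mem` lists the earlier results, most recent first (a reference
beyond the start of the computation reads `0`, and division by `0` returns `0`). -/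
def Instr.eval {ι : Type} (x : ι → ℝ) (mem : List ℝ) : Instr ι → ℝ
  | .input i => x i
  | .const c => c
  | .add a b => mem.getD a 0 + mem.getD b 0
  | .sub a b => mem.getD a 0 - mem.getD b 0
  | .mul a b => mem.getD a 0 * mem.getD b 0
  | .div a b => mem.getD a 0 / mem.getD b 0
  | .le a b => if mem.getD a 0 ≤ mem.getD b 0 then 1 else 0

/-- Memory after executing the instructions of `p` in order. -/
def runCode {ι : Type} (x : ι → ℝ) (p : List (Instr ι)) : List ℝ :=
  p.foldl (fun mem s => s.eval x mem :: mem) []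

/-- A randomized program: besides the inputs indexed by `ι` it can read `coins` fair random bits. -/
structure RandProgram (ι : Type) : Type where
  coins : ℕ
  code : List (Instr (ι ⊕ Fin coins))

/-- Running time: the number of elementary operations (reading an input or a random bit is one). -/
def RandProgram.time {ι : Type} (p : RandProgram ι) : ℕ := p.code.length

/-- The `{0,1}`-valued output (`true` is `1`) on input `x` and random bits `ω`: it is `1` iff the
last computed number is positive. -/
def RandProgram.output {ι : Type} (p : RandProgram ι) (x : ι → ℝ) (ω : Fin p.coins → Bool) :
    Bool :=
  open Classical in
  decide (0 < (runCode (Sum.elim x fun j => if ω j then 1 else 0) p.code).headD 0)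

/-- The law of `r` independent fair bits. -/
def fairBits (r : ℕ) : PMF (Fin r → Bool) := PMF.uniformOfFintype _

/-! ### Sparse principal component detection -/

/-- Empirical variance of the sample `x` (of size `n`) along the direction `u`. -/
def empVar {d n : ℕ} (x : Fin n → Fin d → ℝ) (u : Fin d → ℝ) : ℝ :=
  (∑ i, (u ⬝ᵥ x i) ^ 2) / n

/-- The unit sphere of `ℝ^d`. -/
def unitSphere (d : ℕ) : Set (Fin d → ℝ) := {u | ∑ j, u j ^ 2 = 1}

/-- The unit vectors of `ℝ^d` with at most `k` nonzero coordinates. -/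
def sparseSphere (d k : ℕ) : Set (Fin d → ℝ) :=
  {v | v ∈ unitSphere d ∧ {j | v j ≠ 0}.ncard ≤ k}

/-- Centered probability measures on `ℝ^d` with finite second moments. -/
def IsCentered {d : ℕ} (P : Measure (Fin d → ℝ)) : Prop :=
  IsProbabilityMeasure P ∧ ∀ j, MemLp (fun x : Fin d → ℝ => x j) 2 P ∧ ∫ x, x j ∂P = 0

/-- Variance of a centered `P` along `u`. -/
def dirVar {d : ℕ} (P : Measure (Fin d → ℝ)) (u : Fin d → ℝ) : ℝ := ∫ x, (u ⬝ᵥ x) ^ 2 ∂P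

/-- The law of `n` independent observations from `P`. -/
def sampleLaw {d : ℕ} (n : ℕ) (P : Measure (Fin d → ℝ)) : Measure (Fin n → Fin d → ℝ) :=
  Measure.pi fun _ => P

/-- Null hypothesis: isotropic laws whose empirical variances concentrate. -/
def nullLaws (d n : ℕ) : Set (Measure (Fin d → ℝ)) :=
  {P | IsCentered P ∧ (∀ u ∈ unitSphere d, dirVar P u = 1) ∧
    ∀ u ∈ unitSphere d, ∀ ν : ℝ, 0 < ν → ν ≤ 1 / 2 →
      sampleLaw n P {x | 4 * √(Real.log (1 / ν) / n) + 4 * (Real.log (1 / ν) / n)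
        < |empVar x u - 1|} ≤ ENNReal.ofReal ν}

/-- Alternative: laws with variance `1 + θ` along some `k`-sparse direction `v`, such that the
empirical variance along `v` is not much smaller. -/
def altLaws (d n k : ℕ) (θ : ℝ) : Set (Measure (Fin d → ℝ)) :=
  {P | IsCentered P ∧ ∃ v ∈ sparseSphere d k, dirVar P v = 1 + θ ∧
    ∀ ν : ℝ, 0 < ν →
      sampleLaw n P {x | empVar x v - (1 + θ)
        < -2 * √(2 * θ * k * Real.log (2 / ν) / n) - 4 * √(Real.log (2 / ν) / n)}
        ≤ ENNReal.ofReal ν}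

/-- A family of randomized tests, one for each `(d, n, k)`. The program reads the `n × d` real
numbers `x i j`. Output `true` rejects the null hypothesis. -/
def SPCTest : Type := ∀ d n _k : ℕ, RandProgram (Fin n × Fin d)

/-- Computable in time polynomial in `(d, n, k)`. -/
def SPCTest.PolyTime (ψ : SPCTest) : Prop :=
  ∃ p : Polynomial ℕ, ∀ d n k, (ψ d n k).time ≤ p.eval (d + n + k)

/-- Probability that the test outputs `b` on `n` observations from `P`. -/
def SPCTest.prob (ψ : SPCTest) (d n k : ℕ) (P : Measure (Fin d → ℝ)) (b : Bool) : ℝ≥0∞ :=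
  ((sampleLaw n P).prod (fairBits (ψ d n k).coins).toMeasure)
    {z | (ψ d n k).output (fun ij => z.1 ij.1 ij.2) z.2 = b}

/-- Maximal test error. -/
def SPCTest.maxError (ψ : SPCTest) (d n k : ℕ) (θ : ℝ) : ℝ≥0∞ :=
  ⨆ P₀ ∈ nullLaws d n, ⨆ P₁ ∈ altLaws d n k θ,
    max (ψ.prob d n k P₀ true) (ψ.prob d n k P₁ false)

/-- On `R`, the test discriminates at rate `ρ`. -/
def Discriminates (δ : ℝ) (R : Set (ℕ × ℕ × ℕ)) (ψ : SPCTest) (ρ : ℕ → ℕ → ℕ → ℝ) : Prop :=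
  ∃ c : ℝ, 0 < c ∧ ∀ d n k, (d, n, k) ∈ R → ∀ θ : ℝ, 0 < θ → c * ρ d n k ≤ θ →
    ψ.maxError d n k θ ≤ ENNReal.ofReal δ

/-- On `R`, the test fails at every signal strength below a constant times `ρ`. -/
def FailsBelow (δ : ℝ) (R : Set (ℕ × ℕ × ℕ)) (φ : SPCTest) (ρ : ℕ → ℕ → ℕ → ℝ) : Prop :=
  ∃ c : ℝ, 0 < c ∧ ∀ d n k, (d, n, k) ∈ R → ∀ θ : ℝ, 0 < θ → θ ≤ c * ρ d n k →
    ENNReal.ofReal δ ≤ φ.maxError d n k θ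

/-- `ρ` is an optimal rate of detection on `R` over the class `T` of tests. -/
def IsOptimalRate (δ : ℝ) (R : Set (ℕ × ℕ × ℕ)) (T : Set SPCTest) (ρ : ℕ → ℕ → ℕ → ℝ) : Prop :=
  (∃ ψ ∈ T, Discriminates δ R ψ ρ) ∧ ∀ φ ∈ T, FailsBelow δ R φ ρ

/-- The sparse regime `R₀`. -/
def sparseRegime (δ : ℝ) : Set (ℕ × ℕ × ℕ) :=
  {t | match t with
    | (d, n, k) => 0 < d ∧ 0 < n ∧ 0 < k ∧
        15 * √(k * Real.log (6 * Real.exp 1 * d / δ) / n) ≤ 1 ∧ (k : ℝ) ≤ (d : ℝ) ^ (0.49 : ℝ)}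

/-- The regime `R_μ`. -/
def regime (δ μ : ℝ) : Set (ℕ × ℕ × ℕ) :=
  {t | match t with
    | (d, n, k) => (d, n, k) ∈ sparseRegime δ ∧ (n : ℝ) ^ μ ≤ k ∧ n < d}

/-- The level `√(k^α / n)`. -/
def thetaAlpha (α : ℝ) (_d n k : ℕ) : ℝ := √((k : ℝ) ^ α / n)

/-- The level `√(k² log d / n)`. -/
def thetaPoly (d n k : ℕ) : ℝ := √((k : ℝ) ^ 2 * Real.log d / n)

/-- Parameters of polynomial dimension, `d ≤ n^A`, at which `√(k^α / n)` is polynomially small. -/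
def polyParams (α A ε : ℝ) : Set (ℕ × ℕ × ℕ) :=
  {t | match t with
    | (d, n, k) => (d : ℝ) ≤ (n : ℝ) ^ A ∧ thetaAlpha α d n k ≤ (n : ℝ) ^ (-ε)}

/-! ### Planted clique -/

/-- The graph whose edges are the pairs selected by `e`. -/
def graphOf {m : ℕ} (e : Sym2 (Fin m) → Bool) : SimpleGraph (Fin m) :=
  SimpleGraph.fromEdgeSet {s | e s = true}

/-- The complete graph on the vertex set `S`. -/
def cliqueOn {m : ℕ} (S : Finset (Fin m)) : SimpleGraph (Fin m) :=
  SimpleGraph.fromRel fun i j => i ∈ S ∧ j ∈ S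

/-- `G(m, 1/2)`: every pair of vertices is joined independently with probability `1/2`. -/
def erdosRenyi (m : ℕ) : PMF (SimpleGraph (Fin m)) :=
  (PMF.uniformOfFintype (Sym2 (Fin m) → Bool)).map graphOf

/-- `G(m, 1/2, κ)`: a clique on a uniformly random set of `κ` vertices, all other pairs being
joined independently with probability `1/2`. -/
def plantedClique (m κ : ℕ) (h : κ ≤ m) : PMF (SimpleGraph (Fin m)) :=
  (PMF.uniformOfFinset (Finset.powersetCard κ Finset.univ)
      (Finset.powersetCard_nonempty.2 (by simpa using h))).bind fun S =>
    (erdosRenyi m).map fun G => G ⊔ cliqueOn S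

/-- A family of randomized tests for planted clique; the program reads the adjacency matrix. -/
def PCTest : Type := ∀ m _κ : ℕ, RandProgram (Fin m × Fin m)

/-- Computable in time polynomial in `m`. -/
def PCTest.PolyTime (ξ : PCTest) : Prop :=
  ∃ p : Polynomial ℕ, ∀ m κ, (ξ m κ).time ≤ p.eval m

open Classical in
/-- Adjacency matrix, as the input of a program. -/
def adjInput {m : ℕ} (G : SimpleGraph (Fin m)) (ij : Fin m × Fin m) : ℝ :=
  if G.Adj ij.1 ij.2 then 1 else 0

/-- Probability that the test outputs `b` on a graph with law `Q`. -/
def PCTest.prob (ξ : PCTest) (m κ : ℕ) (Q : PMF (SimpleGraph (Fin m))) (b : Bool) : ℝ≥0∞ :=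
  (Q.bind fun G => (fairBits (ξ m κ).coins).map fun ω => (ξ m κ).output (adjInput G) ω) b

/-- The planted clique hardness hypothesis at confidence level `δ`. -/
def PlantedCliqueHard (δ : ℝ) : Prop :=
  ∀ a b : ℝ, 0 < a → a < b → b < 1 → ∀ ξ : PCTest, ξ.PolyTime →
    ∃ Γ : ℝ, 0 < Γ ∧ ∀ (m κ : ℕ) (h : κ ≤ m), 2 < κ →
      (m : ℝ) ^ (a / 2) < Γ * κ → Γ * κ < (m : ℝ) ^ (b / 2) →
      ENNReal.ofReal (1.2 * δ) ≤
        max (ξ.prob m κ (erdosRenyi m) true) (ξ.prob m κ (plantedClique m κ h) false)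

end SparsePC

end

/-!
# Sparse principal component detection in polynomial time

*Upper bound* (`exists_polyTime_test`). Along `e_j` and `(e_j ± e_l) / √2` the empirical variances of
a null law are within `O(√(log d / n))` of `1`, hence by polarization so are the entries of the
empirical covariance of those of the identity. Conversely, if all entries are that close, the
empirical variance along a `k`-sparse unit vector `v` exceeds `1` by at most `k` times the same bound,
since `(∑ j, |v j|) ^ 2 ≤ k`. Thresholding the largest entry therefore detects every `θ` above a
multiple of `√(k² log d / n)`, and the threshold can be chosen so that the error is at most `δ / 2`.

*Lower bound* (`not_maxError_le`). A test for sparse components is turned into one for planted clique.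
In a graph on `m = C M` vertices take the `0`-`1` adjacencies between `M` column vertices and `n`
further row vertices, rescale them to signs, fill the columns beyond `M` with fair signs, and multiply
each row by a fair sign. A graph without clique yields uniform sign vectors, which are a null law
(`plantedLaw_mem_nullLaws`: a normalized Rademacher sum has squares with Gaussian moment generating
function bounds). If a clique meets the columns in `S` and the rows in `J`, the entries of every row in
`J` agree on `S`. When each row is planted independently with probability `p`, this is a sample of an
alternative law for *every* `θ ≤ p (k - 1)`, as soon as `S` has at least `k` elements
(`plantedLaw_mem_altLaws`): unit vectors supported on `k` points of `S` realize all intermediate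
variances, and the lower deviations only need second and fourth moments.

The rows of a planted clique are not independent: given `S`, the set `J` is the trace of a uniformly
random set of fixed size. It is replaced by a binomial set pointwise: each hypergeometric probability
exceeds the binomial one at most by a factor close to `1` (`choose_mul_sqrt_le`), because the `n` rows
are a small fraction of all vertices. So the error grows by a small factor plus the probabilities of
atypical traces (`sum_clique_le`, `pcError_le`), and error at most `1.05 δ` becomes error less than
`1.2 δ`. With `M` the larger of `n` and `k ^ (2 + γ)` and cliques of size `M ^ (1 / 2 - τ)`, all
requirements hold for small `γ` and `τ`, and the hardness of planted clique is contradicted, provided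
that `M` is large. For bounded `M`, hence bounded `n`, a small `θ` cannot be detected at all
(`not_maxError_le_of_small`).

*Optimal rates.* Both bounds come with room in the error, `δ / 2` and `1.05 δ` in place of `δ`. At a
`θ` that is simultaneously below a multiple of an optimal rate and above the upper bound, or the
reverse for the lower bound, the errors would therefore contradict each other, which compares the
rates.
-/


namespace SparsePC

/-! ### Straight-line programs: costs of real functions and substitution -/

theorem runCode_snoc {ι : Type} (x : ι → ℝ) (p : List (Instr ι)) (s : Instr ι) :
    runCode x (p ++ [s]) = s.eval x (runCode x p) :: runCode x p := by
  simp [runCode]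

theorem length_runCode {ι : Type} (x : ι → ℝ) (p : List (Instr ι)) :
    (runCode x p).length = p.length := by
  induction p using List.reverseRecOn with
  | nil => rfl
  | append_singleton p s ih => simp [runCode_snoc, ih]

theorem getD_runCode_of_le {ι : Type} (x : ι → ℝ) (p : List (Instr ι)) {a : ℕ}
    (ha : p.length ≤ a) : (runCode x p).getD a 0 = 0 :=
  List.getD_eq_default _ _ (by rwa [length_runCode])

/-- Some fixed memory cell holds `f x` after `p` has run on the input `x`. -/
def Evaluates {ι : Type} (p : List (Instr ι)) (f : (ι → ℝ) → ℝ) : Prop :=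
  ∃ a, ∀ x, (runCode x p).getD a 0 = f x

theorem Evaluates.append {ι : Type} {p : List (Instr ι)} {f : (ι → ℝ) → ℝ}
    (h : Evaluates p f) (q : List (Instr ι)) : Evaluates (p ++ q) f := by
  induction q using List.reverseRecOn with
  | nil => simpa using h
  | append_singleton q s ih =>
    obtain ⟨a, ha⟩ := ih
    refine ⟨a + 1, fun x => ?_⟩
    rw [← List.append_assoc, runCode_snoc, List.getD_cons_succ, ha]

theorem evaluates_snoc {ι : Type} {p : List (Instr ι)} {f : (ι → ℝ) → ℝ} (s : Instr ι)
    (h : ∀ x, s.eval x (runCode x p) = f x) : Evaluates (p ++ [s]) f :=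
  ⟨0, fun x => by rw [runCode_snoc, List.getD_cons_zero, h]⟩

/-- The function `f` can be evaluated by at most `t` further instructions, after any program. -/
def HasCost {ι : Type} (t : ℕ) (f : (ι → ℝ) → ℝ) : Prop :=
  ∀ p : List (Instr ι), ∃ q : List (Instr ι), q.length ≤ t ∧ Evaluates (p ++ q) f

theorem HasCost.mono {ι : Type} {t t' : ℕ} {f : (ι → ℝ) → ℝ} (h : HasCost t f) (ht : t ≤ t') :
    HasCost t' f := fun p => by
  obtain ⟨q, hq, hf⟩ := h p
  exact ⟨q, hq.trans ht, hf⟩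

theorem hasCost_input {ι : Type} (i : ι) : HasCost 1 (fun x : ι → ℝ => x i) := fun p =>
  ⟨[.input i], by simp, evaluates_snoc _ fun _ => rfl⟩

theorem hasCost_const {ι : Type} (c : ℝ) : HasCost 1 (fun _ : ι → ℝ => c) := fun p =>
  ⟨[.const c], by simp, evaluates_snoc _ fun _ => rfl⟩

theorem HasCost.binary {ι : Type} {s t : ℕ} {f g : (ι → ℝ) → ℝ} (hf : HasCost s f)
    (hg : HasCost t g) (op : ℕ → ℕ → Instr ι) (F : ℝ → ℝ → ℝ)
    (hop : ∀ a b x mem, (op a b).eval x mem = F (mem.getD a 0) (mem.getD b 0)) :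
    HasCost (s + t + 1) (fun x => F (f x) (g x)) := fun p => by
  obtain ⟨q, hq, hf⟩ := hf p
  obtain ⟨r, hr, hg⟩ := hg (p ++ q)
  obtain ⟨a, ha⟩ := hf.append r
  obtain ⟨b, hb⟩ := hg
  refine ⟨q ++ r ++ [op a b], by simp; omega, ?_⟩
  rw [← List.append_assoc, ← List.append_assoc]
  exact evaluates_snoc _ fun x => by rw [hop, ha, hb]

theorem HasCost.add {ι : Type} {s t : ℕ} {f g : (ι → ℝ) → ℝ} (hf : HasCost s f)
    (hg : HasCost t g) : HasCost (s + t + 1) (fun x => f x + g x) :=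
  hf.binary hg .add (fun a b => a + b) fun _ _ _ _ => rfl

theorem HasCost.sub {ι : Type} {s t : ℕ} {f g : (ι → ℝ) → ℝ} (hf : HasCost s f)
    (hg : HasCost t g) : HasCost (s + t + 1) (fun x => f x - g x) :=
  hf.binary hg .sub (fun a b => a - b) fun _ _ _ _ => rfl

theorem HasCost.mul {ι : Type} {s t : ℕ} {f g : (ι → ℝ) → ℝ} (hf : HasCost s f)
    (hg : HasCost t g) : HasCost (s + t + 1) (fun x => f x * g x) :=
  hf.binary hg .mul (fun a b => a * b) fun _ _ _ _ => rfl

open Classical in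
theorem HasCost.le {ι : Type} {s t : ℕ} {f g : (ι → ℝ) → ℝ} (hf : HasCost s f)
    (hg : HasCost t g) : HasCost (s + t + 1) (fun x => if f x ≤ g x then 1 else 0) :=
  hf.binary hg .le (fun a b => if a ≤ b then 1 else 0) fun _ _ _ _ => rfl

theorem HasCost.sum {ι κ : Type} {t : ℕ} (s : Finset κ) (f : κ → (ι → ℝ) → ℝ)
    (hf : ∀ i ∈ s, HasCost t (f i)) :
    HasCost (s.card * (t + 1) + 1) (fun x => ∑ i ∈ s, f i x) := by
  classical
  induction s using Finset.induction_on with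
  | empty => simpa using hasCost_const 0
  | insert a s ha ih =>
    simp only [Finset.sum_insert ha, Finset.card_insert_of_notMem ha]
    refine ((hf a (by simp)).add (ih fun i hi => hf i (by simp [hi]))).mono ?_
    ring_nf; omega

theorem exists_evaluates_list {ι σ : Type} {t : ℕ} {h : σ → (ι → ℝ) → ℝ}
    (hh : ∀ i, HasCost t (h i)) (l : List σ) :
    ∃ p : List (Instr ι), p.length ≤ l.length * t ∧ ∀ i ∈ l, Evaluates p (h i) := by
  induction l with
  | nil => exact ⟨[], by simp, by simp⟩
  | cons j l ih =>
    obtain ⟨p, hp, hl⟩ := ih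
    obtain ⟨q, hq, hj⟩ := hh j p
    refine ⟨p ++ q, by simp [add_mul]; omega, fun i hi => ?_⟩
    rcases List.mem_cons.1 hi with rfl | hi
    · exact hj
    · exact (hl i hi).append q

/-- The result of a program whose value is a function of cost `t`, as a program. -/
theorem HasCost.exists_code {ι : Type} {t : ℕ} {f : (ι → ℝ) → ℝ} (hf : HasCost t f) :
    ∃ p : List (Instr ι), p.length ≤ t + 1 ∧ ∀ x, (runCode x p).headD 0 = f x := by
  obtain ⟨q, hq, a, ha⟩ := hf []
  -- the second operand lies beyond the start of the computation and reads `0`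
  refine ⟨q ++ [.add a q.length], by simpa using hq, fun x => ?_⟩
  rw [runCode_snoc, List.headD_cons, Instr.eval, getD_runCode_of_le x q le_rfl, add_zero]
  simpa using ha x

/-- Readdressing: `code` can be executed on top of the memory left by `pre` when `pre` has evaluated
every input that `code` reads. References of `code` beyond its own start are sent beyond the start of
`pre`, so that they still read `0`. -/
theorem exists_simulation {ι σ : Type} {h : σ → (ι → ℝ) → ℝ} (pre : List (Instr ι))
    (code : List (Instr σ)) (hpre : ∀ i, Instr.input i ∈ code → Evaluates pre (h i)) :
    ∃ q : List (Instr ι), q.length = code.length ∧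
      ∀ x, runCode x (pre ++ q) = runCode (fun i => h i x) code ++ runCode x pre := by
  induction code using List.reverseRecOn with
  | nil => exact ⟨[], rfl, fun x => by simp [runCode]⟩
  | append_singleton code s ih =>
    obtain ⟨q, hq, hrun⟩ := ih fun i hi => hpre i (by simp [hi])
    set z := pre.length + code.length with hz
    let r : ℕ → ℕ := fun a => if a < code.length then a else z
    have hzero : ∀ x, (runCode x (pre ++ q)).getD z 0 = 0 := fun x =>
      getD_runCode_of_le x _ (by simp [hq, hz])
    have hr : ∀ x a, (runCode x (pre ++ q)).getD (r a) 0
        = (runCode (fun i => h i x) code).getD a 0 := by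
      intro x a
      by_cases ha : a < code.length
      · simp only [r, if_pos ha]
        rw [hrun, List.getD_append _ _ _ _ (by rwa [length_runCode])]
      · simp only [r, if_neg ha]
        rw [hzero, getD_runCode_of_le _ _ (not_lt.1 ha)]
    have key : ∃ s' : Instr ι, ∀ x, s'.eval x (runCode x (pre ++ q))
        = s.eval (fun i => h i x) (runCode (fun i => h i x) code) := by
      cases s with
      | input i =>
        obtain ⟨a, ha⟩ := (hpre i (by simp)).append q
        exact ⟨.add a z, fun x => by simp only [Instr.eval]; rw [ha, hzero, add_zero]⟩
      | const c => exact ⟨.const c, fun x => rfl⟩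
      | add a b => exact ⟨.add (r a) (r b), fun x => by simp only [Instr.eval, hr]⟩
      | sub a b => exact ⟨.sub (r a) (r b), fun x => by simp only [Instr.eval, hr]⟩
      | mul a b => exact ⟨.mul (r a) (r b), fun x => by simp only [Instr.eval, hr]⟩
      | div a b => exact ⟨.div (r a) (r b), fun x => by simp only [Instr.eval, hr]⟩
      | le a b => exact ⟨.le (r a) (r b), fun x => by simp only [Instr.eval, hr]⟩
    obtain ⟨s', hs'⟩ := key
    refine ⟨q ++ [s'], by simp [hq], fun x => ?_⟩
    rw [← List.append_assoc, runCode_snoc, runCode_snoc, hs', hrun]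
    rfl

/-- Substituting functions of cost `t` for the inputs of a program multiplies its running time by at
most `t + 1`, up to one operation. -/
theorem exists_substitution {ι σ : Type} {t : ℕ} {h : σ → (ι → ℝ) → ℝ}
    (hh : ∀ i, HasCost t (h i)) (code : List (Instr σ)) :
    ∃ p : List (Instr ι), p.length ≤ code.length * (t + 1) + 1 ∧
      ∀ x, (runCode x p).headD 0 = (runCode (fun i => h i x) code).headD 0 := by
  rcases List.eq_nil_or_concat code with rfl | ⟨c, s, hc⟩
  · exact ⟨[], by simp, fun x => rfl⟩
  let l := code.filterMap fun s => match s with | .input i => some i | _ => none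
  have hl : l.length ≤ code.length := List.length_filterMap_le _ _
  obtain ⟨pre, hpre, hev⟩ := exists_evaluates_list hh l
  obtain ⟨q, hq, hrun⟩ := exists_simulation pre code fun i hi =>
    hev i (List.mem_filterMap.2 ⟨_, hi, rfl⟩)
  refine ⟨pre ++ q, ?_, fun x => ?_⟩
  · have := Nat.mul_le_mul_right t hl
    simp only [List.length_append, hq, mul_add]
    omega
  · rw [hrun, hc, List.concat_eq_append, runCode_snoc]
    rfl

/-! ### Finitely supported laws -/

/-- The law of `g a` when `a` is drawn from the finite set `Ω` with probabilities `w a`. -/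
noncomputable def finLaw {Ω E : Type*} [Fintype Ω] [MeasurableSpace E] (w : Ω → ℝ) (g : Ω → E) :
    Measure E :=
  ∑ a, ENNReal.ofReal (w a) • Measure.dirac (g a)

section finLaw

variable {Ω Ω' E E' : Type*} [Fintype Ω] [Fintype Ω'] [MeasurableSpace E] [MeasurableSpace E']

open Classical in
theorem finLaw_apply [MeasurableSingletonClass E] {w : Ω → ℝ} (hw : ∀ a, 0 ≤ w a) (g : Ω → E)
    (s : Set E) : finLaw w g s = ENNReal.ofReal (∑ a, if g a ∈ s then w a else 0) := by
  rw [ENNReal.ofReal_sum_of_nonneg fun a _ => by split_ifs <;> simp [hw]]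
  simp only [finLaw, Measure.coe_finsetSum, Finset.sum_apply, Measure.smul_apply, smul_eq_mul,
    Measure.dirac_apply, Set.indicator_apply]
  refine Finset.sum_congr rfl fun a _ => ?_
  split_ifs <;> simp

theorem isProbabilityMeasure_finLaw [MeasurableSingletonClass E] {w : Ω → ℝ} (hw : ∀ a, 0 ≤ w a)
    (hw1 : ∑ a, w a = 1) (g : Ω → E) : IsProbabilityMeasure (finLaw w g) :=
  ⟨by simp [finLaw_apply hw, hw1]⟩

instance isFiniteMeasure_finLaw (w : Ω → ℝ) (g : Ω → E) : IsFiniteMeasure (finLaw w g) :=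
  ⟨by simp [finLaw]⟩

theorem integrable_finLaw [MeasurableSingletonClass E] (w : Ω → ℝ) (g : Ω → E) (f : E → ℝ) :
    Integrable f (finLaw w g) := by
  refine integrable_finsetSum_measure.2 fun a _ => ?_
  exact (integrable_dirac (by simp)).smul_measure ENNReal.ofReal_ne_top

theorem integral_finLaw [MeasurableSingletonClass E] {w : Ω → ℝ} (hw : ∀ a, 0 ≤ w a) (g : Ω → E)
    (f : E → ℝ) : ∫ x, f x ∂(finLaw w g) = ∑ a, w a * f (g a) := by
  rw [finLaw, integral_finsetSum_measure fun a _ =>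
    (integrable_dirac (by simp)).smul_measure ENNReal.ofReal_ne_top]
  simp [integral_smul_measure, hw]

theorem pi_finLaw [MeasurableSingletonClass E] (n : ℕ) {w : Ω → ℝ} (hw : ∀ a, 0 ≤ w a)
    (g : Ω → E) : Measure.pi (fun _ : Fin n => finLaw w g)
      = finLaw (fun a : Fin n → Ω => ∏ i, w (a i)) (fun a i => g (a i)) := by
  classical
  refine Measure.pi_eq fun s hs => ?_
  rw [finLaw_apply (fun a => Finset.prod_nonneg fun i _ => hw _)]
  simp only [finLaw_apply hw]
  rw [← ENNReal.ofReal_prod_of_nonneg fun i _ => Finset.sum_nonneg fun a _ => by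
    split_ifs <;> simp [hw]]
  congr 1
  rw [Finset.prod_univ_sum, Fintype.piFinset_univ]
  refine Finset.sum_congr rfl fun a _ => ?_
  by_cases h : ∀ i, g (a i) ∈ s i
  · simp [h, Set.mem_pi]
  · rw [if_neg (by simpa [Set.mem_pi] using h)]
    obtain ⟨i, hi⟩ := not_forall.1 h
    exact (Finset.prod_eq_zero (Finset.mem_univ i) (by simp [hi])).symm

theorem prod_finLaw [MeasurableSingletonClass E] [MeasurableSingletonClass E'] {w : Ω → ℝ}
    {w' : Ω' → ℝ} (hw : ∀ a, 0 ≤ w a) (hw' : ∀ a, 0 ≤ w' a) (g : Ω → E) (g' : Ω' → E') :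
    (finLaw w g).prod (finLaw w' g')
      = finLaw (fun a : Ω × Ω' => w a.1 * w' a.2) (fun a => (g a.1, g' a.2)) := by
  classical
  refine Measure.prod_eq fun s t hs ht => ?_
  rw [finLaw_apply (fun a => mul_nonneg (hw _) (hw' _)), finLaw_apply hw, finLaw_apply hw',
    ← ENNReal.ofReal_mul (Finset.sum_nonneg fun a _ => by split_ifs <;> simp [hw]),
    Finset.sum_mul_sum, Fintype.sum_prod_type]
  congr 1
  refine Finset.sum_congr rfl fun a _ => Finset.sum_congr rfl fun b _ => ?_
  by_cases h : g a ∈ s <;> by_cases h' : g' b ∈ t <;> simp [h, h']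

end finLaw

theorem fairBits_toMeasure (r : ℕ) :
    (fairBits r).toMeasure = finLaw (fun _ : Fin r → Bool => (1 / 2 : ℝ) ^ r) id := by
  classical
  refine Measure.ext fun s hs => ?_
  rw [finLaw_apply (fun _ => by positivity), PMF.toMeasure_apply_fintype,
    ENNReal.ofReal_sum_of_nonneg fun a _ => by split_ifs <;> positivity]
  refine Finset.sum_congr rfl fun a _ => ?_
  by_cases h : a ∈ s
  · simp only [Set.indicator_of_mem h, fairBits, PMF.uniformOfFintype_apply, id, if_pos h]
    rw [one_div, inv_pow, ENNReal.ofReal_inv_of_pos (by positivity)]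
    simp [ENNReal.ofReal_pow]
  · simp [h]

open Classical in
/-- The probability that a test outputs `b` on independent observations of a finitely supported law,
as a finite sum. -/
theorem prob_finLaw (ψ : SPCTest) (d n k : ℕ) {Ω : Type*} [Fintype Ω] {w : Ω → ℝ}
    (hw : ∀ a, 0 ≤ w a) (g : Ω → Fin d → ℝ) (b : Bool) :
    ψ.prob d n k (finLaw w g) b = ENNReal.ofReal (∑ a : Fin n → Ω,
      ∑ ω : Fin (ψ d n k).coins → Bool,
        if (ψ d n k).output (fun ij => g (a ij.1) ij.2) ω = b
          then (∏ i, w (a i)) * (1 / 2) ^ (ψ d n k).coins else 0) := by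
  have hw' : ∀ a : Fin n → Ω, 0 ≤ ∏ i, w (a i) := fun a => Finset.prod_nonneg fun i _ => hw _
  rw [SPCTest.prob, sampleLaw, pi_finLaw n hw, fairBits_toMeasure,
    prod_finLaw hw' (fun _ => by positivity),
    finLaw_apply (fun a => mul_nonneg (hw' _) (by positivity)), Fintype.sum_prod_type]
  simp

open Classical in
/-- Chernoff's bound for independent draws from a finite set. -/
theorem chernoff_finite {Ω : Type*} [Fintype Ω] {w : Ω → ℝ} (hw : ∀ a, 0 ≤ w a) (n : ℕ)
    (Y : Ω → ℝ) {l : ℝ} (hl : 0 ≤ l) (c : ℝ) :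
    (∑ a : Fin n → Ω, if c ≤ ∑ i, Y (a i) then ∏ i, w (a i) else 0)
      ≤ Real.exp (-(l * c)) * (∑ a, w a * Real.exp (l * Y a)) ^ n := by
  rw [Fintype.sum_pow, Finset.mul_sum]
  refine Finset.sum_le_sum fun a _ => ?_
  have h0 : 0 ≤ ∏ i, w (a i) := Finset.prod_nonneg fun i _ => hw _
  rw [Finset.prod_mul_distrib, ← Real.exp_sum, ← Finset.mul_sum, mul_left_comm, ← Real.exp_add]
  split_ifs with h
  · refine le_mul_of_one_le_right h0 (Real.one_le_exp ?_)
    nlinarith [mul_le_mul_of_nonneg_left h hl]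
  · positivity

/-! ### Moments of Rademacher sums -/

/-- The sign encoded by a bit. -/
def sgn (b : Bool) : ℝ := if b then 1 else -1

@[simp] theorem sgn_true : sgn true = 1 := rfl

@[simp] theorem sgn_false : sgn false = -1 := rfl

theorem sgn_mul_self (b : Bool) : sgn b * sgn b = 1 := by cases b <;> simp

theorem sgn_sq (b : Bool) : sgn b ^ 2 = 1 := by cases b <;> simp

theorem sum_pi_bool_succ {M : Type*} [AddCommMonoid M] (d : ℕ) (F : (Fin (d + 1) → Bool) → M) :
    ∑ y, F y = ∑ y : Fin d → Bool, (F (Fin.cons true y) + F (Fin.cons false y)) := by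
  rw [← (Fin.consEquiv fun _ : Fin (d + 1) => Bool).sum_comp, Fintype.sum_prod_type_right]
  simp [Fin.consEquiv]

theorem sum_half_pow (d : ℕ) : ∑ _y : Fin d → Bool, (1 / 2 : ℝ) ^ d = 1 := by
  simp

theorem rademacher_second_moment {d : ℕ} (u : Fin d → ℝ) :
    ∑ y : Fin d → Bool, (1 / 2 : ℝ) ^ d * (∑ j, u j * sgn (y j)) ^ 2 = ∑ j, u j ^ 2 := by
  induction d with
  | zero => simp
  | succ d ih =>
    have key : ∑ y : Fin (d + 1) → Bool, (1 / 2 : ℝ) ^ (d + 1) * (∑ j, u j * sgn (y j)) ^ 2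
        = u 0 ^ 2 * (∑ _y : Fin d → Bool, (1 / 2 : ℝ) ^ d)
          + ∑ y : Fin d → Bool, (1 / 2 : ℝ) ^ d * (∑ j, u j.succ * sgn (y j)) ^ 2 := by
      rw [sum_pi_bool_succ, Finset.mul_sum, ← Finset.sum_add_distrib]
      refine Finset.sum_congr rfl fun y _ => ?_
      simp only [Fin.sum_univ_succ, Fin.cons_zero, Fin.cons_succ, sgn_true, sgn_false]
      ring
    rw [key, ih, sum_half_pow, mul_one, Fin.sum_univ_succ]

theorem rademacher_fourth_moment_le {d : ℕ} (u : Fin d → ℝ) :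
    ∑ y : Fin d → Bool, (1 / 2 : ℝ) ^ d * (∑ j, u j * sgn (y j)) ^ 4
      ≤ 3 * (∑ j, u j ^ 2) ^ 2 := by
  induction d with
  | zero => simp
  | succ d ih =>
    have h2 := rademacher_second_moment (fun j => u j.succ)
    have h4 := ih (fun j => u j.succ)
    have key : ∑ y : Fin (d + 1) → Bool, (1 / 2 : ℝ) ^ (d + 1) * (∑ j, u j * sgn (y j)) ^ 4
        = (∑ y : Fin d → Bool, (1 / 2 : ℝ) ^ d * (∑ j, u j.succ * sgn (y j)) ^ 4)
          + 6 * u 0 ^ 2 * (∑ y : Fin d → Bool, (1 / 2 : ℝ) ^ d * (∑ j, u j.succ * sgn (y j)) ^ 2)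
          + u 0 ^ 4 * ∑ _y : Fin d → Bool, (1 / 2 : ℝ) ^ d := by
      rw [sum_pi_bool_succ, Finset.mul_sum, Finset.mul_sum, ← Finset.sum_add_distrib,
        ← Finset.sum_add_distrib]
      refine Finset.sum_congr rfl fun y _ => ?_
      simp only [Fin.sum_univ_succ, Fin.cons_zero, Fin.cons_succ, sgn_true, sgn_false]
      ring
    rw [key, h2, sum_half_pow, Fin.sum_univ_succ]
    nlinarith [sq_nonneg (u 0 ^ 2)]

theorem rademacher_exp_le {d : ℕ} (u : Fin d → ℝ) (t : ℝ) :
    ∑ y : Fin d → Bool, (1 / 2 : ℝ) ^ d * Real.exp (t * ∑ j, u j * sgn (y j))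
      ≤ Real.exp (t ^ 2 / 2 * ∑ j, u j ^ 2) := by
  induction d with
  | zero => simp
  | succ d ih =>
    have key : ∑ y : Fin (d + 1) → Bool, (1 / 2 : ℝ) ^ (d + 1)
          * Real.exp (t * ∑ j, u j * sgn (y j))
        = Real.cosh (t * u 0) * ∑ y : Fin d → Bool, (1 / 2 : ℝ) ^ d
          * Real.exp (t * ∑ j, u j.succ * sgn (y j)) := by
      rw [sum_pi_bool_succ, Finset.mul_sum]
      refine Finset.sum_congr rfl fun y _ => ?_
      simp only [Fin.sum_univ_succ, Fin.cons_zero, Fin.cons_succ, sgn_true, sgn_false,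
        Real.cosh_eq, mul_add, Real.exp_add]
      ring_nf
    rw [key, Fin.sum_univ_succ, mul_add, Real.exp_add]
    refine mul_le_mul ?_ (ih _) (by positivity) (by positivity)
    refine (Real.cosh_le_exp_half_sq _).trans (le_of_eq ?_)
    ring_nf

/-- The moment generating function of the square of a normalized Rademacher sum is at most that of
the square of a standard Gaussian. With `g` Gaussian of variance `2 s`, independent of the signs,
`exp (s z ^ 2)` is the mean of `exp (z g)`; exchanging the two averages reduces the claim to
`rademacher_exp_le`. -/
theorem rademacher_exp_sq_le {d : ℕ} {u : Fin d → ℝ} (hu : ∑ j, u j ^ 2 = 1) {s : ℝ} (hs : 0 < s)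
    (hs' : s < 1 / 2) :
    ∑ y : Fin d → Bool, (1 / 2 : ℝ) ^ d * Real.exp (s * (∑ j, u j * sgn (y j)) ^ 2)
      ≤ (√(1 - 2 * s))⁻¹ := by
  obtain ⟨v, hv⟩ : ∃ v : NNReal, (v : ℝ) = 2 * s := ⟨⟨2 * s, by linarith⟩, rfl⟩
  have hv0 : v ≠ 0 := by
    intro h
    rw [h, NNReal.coe_zero] at hv
    linarith
  let γ := ProbabilityTheory.gaussianReal 0 v
  have hmgf : ∀ z : ℝ, Real.exp (s * z ^ 2) = ∫ x, Real.exp (z * x) ∂γ := by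
    intro z
    have h := congrFun (ProbabilityTheory.mgf_id_gaussianReal (μ := 0) (v := v)) z
    simp only [ProbabilityTheory.mgf, id] at h
    rw [h, hv]
    congr 1
    ring
  have hint : ∀ z : ℝ, Integrable (fun x => Real.exp (z * x)) γ := fun z =>
    ProbabilityTheory.integrable_exp_mul_gaussianReal z
  have hb : 0 < (1 / (4 * s) - 1 / 2 : ℝ) := by
    rw [sub_pos, div_lt_div_iff₀ (by norm_num) (by linarith)]
    linarith
  have hpdf : ∀ x : ℝ, ProbabilityTheory.gaussianPDFReal 0 v x * Real.exp (x ^ 2 / 2)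
      = (√(2 * Real.pi * (2 * s)))⁻¹ * Real.exp (-(1 / (4 * s) - 1 / 2) * x ^ 2) := by
    intro x
    rw [ProbabilityTheory.gaussianPDFReal]
    rw [hv, mul_assoc, ← Real.exp_add]
    congr 2
    field_simp
    ring
  have hgi : Integrable (fun x : ℝ => Real.exp (x ^ 2 / 2)) γ := by
    simp only [γ]
    rw [ProbabilityTheory.gaussianReal_of_var_ne_zero 0 hv0,
      integrable_withDensity_iff_integrable_smul' (ProbabilityTheory.measurable_gaussianPDF _ _)
        (by simp [ProbabilityTheory.gaussianPDF])]
    simp only [ProbabilityTheory.toReal_gaussianPDF, smul_eq_mul, hpdf]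
    exact (integrable_exp_neg_mul_sq hb).const_mul _
  have hval : ∫ x, Real.exp (x ^ 2 / 2) ∂γ = (√(1 - 2 * s))⁻¹ := by
    simp only [γ]
    rw [ProbabilityTheory.integral_gaussianReal_eq_integral_smul hv0]
    simp only [smul_eq_mul, hpdf]
    rw [integral_const_mul, integral_gaussian, ← Real.sqrt_inv, ← Real.sqrt_inv,
      ← Real.sqrt_mul (by positivity)]
    congr 1
    have : (1 - 2 * s) ≠ 0 := by linarith
    have h4 : (1 / (4 * s) - 1 / 2 : ℝ) = (1 - 2 * s) / (4 * s) := by field_simp; ring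
    rw [h4]
    field_simp
    ring
  calc ∑ y : Fin d → Bool, (1 / 2 : ℝ) ^ d * Real.exp (s * (∑ j, u j * sgn (y j)) ^ 2)
      = ∫ x, ∑ y : Fin d → Bool, (1 / 2 : ℝ) ^ d * Real.exp ((∑ j, u j * sgn (y j)) * x) ∂γ := by
        rw [integral_finsetSum _ fun y _ => (hint _).const_mul _]
        simp only [hmgf, integral_const_mul]
    _ ≤ ∫ x, Real.exp (x ^ 2 / 2) ∂γ := by
        refine integral_mono (integrable_finsetSum _ fun y _ => (hint _).const_mul _) hgi
          fun x => ?_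
        have := rademacher_exp_le u x
        rw [hu, mul_one] at this
        simpa only [mul_comm] using this
    _ = _ := hval

/-! ### Tail bounds -/

theorem exp_neg_le_quadratic {z : ℝ} (hz : 0 ≤ z) : Real.exp (-z) ≤ 1 - z + z ^ 2 / 2 := by
  rw [Real.exp_neg]
  have h := Real.quadratic_le_exp_of_nonneg hz
  have h0 : 0 < 1 + z + z ^ 2 / 2 := by positivity
  refine (inv_anti₀ h0 h).trans ?_
  rw [inv_le_iff_one_le_mul₀ h0]
  nlinarith [sq_nonneg (z ^ 2)]

open Classical in
/-- Sums of nonnegative variables have subgaussian lower tails. -/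
theorem lower_tail_finite {Ω : Type*} [Fintype Ω] {w : Ω → ℝ} (hw : ∀ a, 0 ≤ w a)
    (hw1 : ∑ a, w a = 1) (n : ℕ) {Y : Ω → ℝ} (hY : ∀ a, 0 ≤ Y a) {m₁ m₂ t : ℝ}
    (h₁ : ∑ a, w a * Y a = m₁) (h₂ : ∑ a, w a * Y a ^ 2 ≤ m₂) (hm₂ : 0 < m₂) (ht : 0 ≤ t) :
    (∑ a : Fin n → Ω, if ∑ i, Y (a i) ≤ n * (m₁ - t) then ∏ i, w (a i) else 0)
      ≤ Real.exp (-(n * (t ^ 2 / (2 * m₂)))) := by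
  set l := t / m₂ with hl
  have hl0 : 0 ≤ l := by positivity
  have hch := chernoff_finite hw n (fun a => -Y a) hl0 (-(n * (m₁ - t)))
  simp only [Finset.sum_neg_distrib, neg_le_neg_iff] at hch
  refine hch.trans ?_
  have hE : ∑ a, w a * Real.exp (l * -Y a) ≤ Real.exp (-(l * m₁) + l ^ 2 * m₂ / 2) := by
    calc ∑ a, w a * Real.exp (l * -Y a)
        ≤ ∑ a, (w a - l * (w a * Y a) + l ^ 2 / 2 * (w a * Y a ^ 2)) := by
          refine Finset.sum_le_sum fun a _ => ?_
          have h := exp_neg_le_quadratic (mul_nonneg hl0 (hY a))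
          rw [mul_neg]
          nlinarith [mul_le_mul_of_nonneg_left h (hw a)]
      _ = 1 - l * m₁ + l ^ 2 / 2 * ∑ a, w a * Y a ^ 2 := by
          rw [Finset.sum_add_distrib, Finset.sum_sub_distrib, ← Finset.mul_sum, ← Finset.mul_sum,
            hw1, h₁]
      _ ≤ -(l * m₁) + l ^ 2 * m₂ / 2 + 1 := by
          nlinarith [mul_le_mul_of_nonneg_left h₂ (by positivity : 0 ≤ l ^ 2 / 2)]
      _ ≤ _ := Real.add_one_le_exp _
  calc _ ≤ Real.exp (-(l * -(n * (m₁ - t)))) * Real.exp (-(l * m₁) + l ^ 2 * m₂ / 2) ^ n := by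
        gcongr
        exact Finset.sum_nonneg fun a _ => mul_nonneg (hw a) (Real.exp_pos _).le
    _ = Real.exp (-(n * (t ^ 2 / (2 * m₂)))) := by
        rw [← Real.exp_nat_mul, ← Real.exp_add, hl]
        congr 1
        field_simp
        ring

/-- The exponent in the Laurent--Massart bound: with `s = √x / (1 + 2√x)` one has
`1 - 2s = 1 / (1 + 2√x)`, and `log (1 / r) ≤ (1 / r - r) / 2` does the rest. -/
theorem laurent_massart_exponent {x : ℝ} (hx : 0 < x) :
    Real.exp (-(√x / (1 + 2 * √x) * (1 + (2 * √x + 2 * x)))) *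
      (√(1 - 2 * (√x / (1 + 2 * √x))))⁻¹ ≤ Real.exp (-x) := by
  set q := √x with hq
  have hq0 : 0 < q := Real.sqrt_pos.2 hx
  have hxq : x = q ^ 2 := (Real.sq_sqrt hx.le).symm
  have hr : 1 - 2 * (q / (1 + 2 * q)) = (1 + 2 * q)⁻¹ := by field_simp; ring
  have hlog : Real.log (1 + 2 * q) ≤ ((1 + 2 * q) - (1 + 2 * q)⁻¹) / 2 := by
    have h := Real.self_le_sinh_iff.2 (Real.log_nonneg (by linarith : (1 : ℝ) ≤ 1 + 2 * q))
    rwa [Real.sinh_eq, Real.exp_neg, Real.exp_log (by positivity)] at h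
  rw [hr, Real.sqrt_inv, inv_inv, Real.sqrt_eq_rpow, Real.rpow_def_of_pos (by positivity),
    ← Real.exp_add]
  refine Real.exp_le_exp.2 ?_
  have : q / (1 + 2 * q) * (1 + (2 * q + 2 * x)) - x
      = (((1 + 2 * q) - (1 + 2 * q)⁻¹) / 2) * (1 / 2) := by
    rw [hxq]
    field_simp
    ring
  linarith

open Classical in
theorem rademacher_upper_tail {Ω : Type*} [Fintype Ω] {w : Ω → ℝ} (hw : ∀ a, 0 ≤ w a)
    (n : ℕ) {Y : Ω → ℝ} {x : ℝ} (hx : 0 < x)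
    (hexp : ∀ s : ℝ, 0 < s → s < 1 / 2 → ∑ a, w a * Real.exp (s * Y a) ≤ (√(1 - 2 * s))⁻¹) :
    (∑ a : Fin n → Ω, if n * (1 + (2 * √x + 2 * x)) ≤ ∑ i, Y (a i) then ∏ i, w (a i) else 0)
      ≤ Real.exp (-(n * x)) := by
  have hq0 : 0 < √x := Real.sqrt_pos.2 hx
  set s := √x / (1 + 2 * √x) with hs
  have hs0 : 0 < s := by positivity
  have hs1 : s < 1 / 2 := by rw [hs, div_lt_div_iff₀ (by positivity) (by norm_num)]; linarith
  refine (chernoff_finite hw n Y hs0.le _).trans ?_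
  calc _ ≤ Real.exp (-(s * (n * (1 + (2 * √x + 2 * x))))) * ((√(1 - 2 * s))⁻¹) ^ n := by
        gcongr
        · exact Finset.sum_nonneg fun a _ => mul_nonneg (hw a) (Real.exp_pos _).le
        · exact hexp s hs0 hs1
    _ = (Real.exp (-(s * (1 + (2 * √x + 2 * x)))) * (√(1 - 2 * s))⁻¹) ^ n := by
        rw [mul_pow, ← Real.exp_nat_mul]
        congr 2
        ring
    _ ≤ (Real.exp (-x)) ^ n := by
        gcongr
        exact laurent_massart_exponent hx
    _ = _ := by
        rw [← Real.exp_nat_mul]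
        congr 1
        ring

/-! ### The planted sign laws and the two hypotheses -/

/-- The randomness behind one observation of `plantedLaw`: whether the observation is planted, a
global sign, and one sign for each coordinate. -/
abbrev Obs (d : ℕ) : Type := Bool × Bool × (Fin d → Bool)

/-- The probability of a value of `Obs d` when an observation is planted with probability `p`. -/
noncomputable def obsWeight (d : ℕ) (p : ℝ) (a : Obs d) : ℝ :=
  (if a.1 then p else 1 - p) * (1 / 2) ^ (d + 1)

/-- A random sign vector. If it is planted, its coordinates in `S` agree. -/
noncomputable def plantedRow {d : ℕ} (S : Finset (Fin d)) (a : Obs d) (j : Fin d) : ℝ :=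
  sgn a.2.1 * (if a.1 = true ∧ j ∈ S then 1 else sgn (a.2.2 j))

/-- The law of a sign vector that is uniform on the cube, except that with probability `p` its
coordinates in `S` are made to agree. -/
noncomputable def plantedLaw {d : ℕ} (S : Finset (Fin d)) (p : ℝ) : Measure (Fin d → ℝ) :=
  finLaw (obsWeight d p) (plantedRow S)

theorem obsWeight_nonneg {d : ℕ} {p : ℝ} (hp0 : 0 ≤ p) (hp1 : p ≤ 1) (a : Obs d) :
    0 ≤ obsWeight d p a := by
  unfold obsWeight
  split_ifs
  · positivity
  · have : 0 ≤ 1 - p := by linarith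
    positivity

/-- Functions of the squared projection `(u ⬝ᵥ x) ^ 2` do not see the global sign. -/
theorem sum_obsWeight_sq {d : ℕ} (S : Finset (Fin d)) (p : ℝ) (u : Fin d → ℝ) (Q : ℝ → ℝ) :
    ∑ a, obsWeight d p a * Q ((u ⬝ᵥ plantedRow S a) ^ 2)
      = p * (∑ y : Fin d → Bool, (1 / 2 : ℝ) ^ d
          * Q ((∑ j, u j * (if j ∈ S then 1 else sgn (y j))) ^ 2))
        + (1 - p) * ∑ y : Fin d → Bool, (1 / 2 : ℝ) ^ d * Q ((∑ j, u j * sgn (y j)) ^ 2) := by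
  have hdot : ∀ b η y, (u ⬝ᵥ plantedRow S (b, η, y)) ^ 2
      = (∑ j, u j * (if b = true ∧ j ∈ S then 1 else sgn (y j))) ^ 2 := by
    intro b η y
    have : u ⬝ᵥ plantedRow S (b, η, y)
        = sgn η * ∑ j, u j * (if b = true ∧ j ∈ S then 1 else sgn (y j)) := by
      rw [dotProduct, Finset.mul_sum]
      refine Finset.sum_congr rfl fun j _ => ?_
      simp only [plantedRow]
      ring
    rw [this, mul_pow, sgn_sq, one_mul]
  simp only [Fintype.sum_prod_type, Fintype.sum_bool, hdot, obsWeight]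
  simp only [if_true, true_and, Bool.false_eq_true, false_and, if_false, Finset.mul_sum,
    ← Finset.sum_add_distrib]
  refine Finset.sum_congr rfl fun y _ => ?_
  ring

theorem sum_obsWeight (d : ℕ) (p : ℝ) : ∑ a, obsWeight d p a = 1 := by
  have h := sum_obsWeight_sq (∅ : Finset (Fin d)) p 0 (fun _ => 1)
  simp only [mul_one, sum_half_pow] at h
  rw [h]
  ring

theorem sum_obsWeight_sq_of_support {d : ℕ} {S : Finset (Fin d)} (p : ℝ) {u : Fin d → ℝ}
    (hu : ∀ j, j ∉ S → u j = 0) (Q : ℝ → ℝ) :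
    ∑ a, obsWeight d p a * Q ((u ⬝ᵥ plantedRow S a) ^ 2)
      = p * Q ((∑ j, u j) ^ 2)
        + (1 - p) * ∑ y : Fin d → Bool, (1 / 2 : ℝ) ^ d * Q ((∑ j, u j * sgn (y j)) ^ 2) := by
  have hone : ∀ y : Fin d → Bool, ∑ j, u j * (if j ∈ S then 1 else sgn (y j)) = ∑ j, u j := by
    refine fun y => Finset.sum_congr rfl fun j _ => ?_
    by_cases hj : j ∈ S
    · simp [hj]
    · simp [hu j hj]
  rw [sum_obsWeight_sq]
  simp only [hone]
  rw [← Finset.sum_mul, sum_half_pow, one_mul]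

theorem isCentered_plantedLaw {d : ℕ} (S : Finset (Fin d)) {p : ℝ} (hp0 : 0 ≤ p) (hp1 : p ≤ 1) :
    IsCentered (plantedLaw S p) := by
  refine ⟨isProbabilityMeasure_finLaw (obsWeight_nonneg hp0 hp1) (sum_obsWeight d p) _,
    fun j => ⟨?_, ?_⟩⟩
  · rw [memLp_two_iff_integrable_sq (measurable_pi_apply j).aestronglyMeasurable]
    exact integrable_finLaw _ _ _
  · rw [plantedLaw, integral_finLaw (obsWeight_nonneg hp0 hp1)]
    simp only [Fintype.sum_prod_type, Fintype.sum_bool, obsWeight, plantedRow, sgn_true, sgn_false,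
      ← Finset.sum_add_distrib]
    refine Finset.sum_eq_zero fun y _ => ?_
    ring

theorem dirVar_plantedLaw {d : ℕ} (S : Finset (Fin d)) {p : ℝ} (hp0 : 0 ≤ p) (hp1 : p ≤ 1)
    (u : Fin d → ℝ) :
    dirVar (plantedLaw S p) u = ∑ a, obsWeight d p a * (u ⬝ᵥ plantedRow S a) ^ 2 := by
  rw [dirVar, plantedLaw, integral_finLaw (obsWeight_nonneg hp0 hp1)]

open Classical in
theorem sampleLaw_plantedLaw_apply {d : ℕ} (n : ℕ) (S : Finset (Fin d)) {p : ℝ} (hp0 : 0 ≤ p)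
    (hp1 : p ≤ 1) (s : Set (Fin n → Fin d → ℝ)) :
    sampleLaw n (plantedLaw S p) s = ENNReal.ofReal (∑ a : Fin n → Obs d,
      if (fun i => plantedRow S (a i)) ∈ s then ∏ i, obsWeight d p (a i) else 0) := by
  rw [sampleLaw, plantedLaw, pi_finLaw n (obsWeight_nonneg hp0 hp1), finLaw_apply]
  exact fun a => Finset.prod_nonneg fun i _ => obsWeight_nonneg hp0 hp1 _

/-- The uniform law on the sign vectors belongs to the null hypothesis. -/
theorem plantedLaw_mem_nullLaws {d n : ℕ} (hn : 0 < n) :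
    plantedLaw (∅ : Finset (Fin d)) 0 ∈ nullLaws d n := by
  classical
  have hw := obsWeight_nonneg (d := d) (le_refl (0 : ℝ)) zero_le_one
  have hn' : (0 : ℝ) < n := by exact_mod_cast hn
  refine ⟨isCentered_plantedLaw _ le_rfl zero_le_one, fun u hu => ?_, fun u hu ν hν hν2 => ?_⟩
  · rw [dirVar_plantedLaw _ le_rfl zero_le_one, sum_obsWeight_sq ∅ 0 u (fun z => z)]
    rw [rademacher_second_moment, hu.out]
    ring
  have hu1 : ∑ j, u j ^ 2 = 1 := hu
  set Y : Obs d → ℝ := fun a => (u ⬝ᵥ plantedRow ∅ a) ^ 2 with hYdef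
  have hY0 : ∀ a, 0 ≤ Y a := fun a => sq_nonneg _
  have hm1 : ∑ a, obsWeight d 0 a * Y a = 1 := by
    rw [sum_obsWeight_sq ∅ 0 u (fun z => z)]
    rw [rademacher_second_moment, hu1]
    ring
  have hm2 : ∑ a, obsWeight d 0 a * Y a ^ 2 ≤ 3 := by
    rw [sum_obsWeight_sq ∅ 0 u (fun z => z ^ 2)]
    have := rademacher_fourth_moment_le u
    simp only [zero_mul, sub_zero, one_mul, zero_add, ← pow_mul, Nat.reduceMul]
    simpa [hu1] using this
  have hexp : ∀ s : ℝ, 0 < s → s < 1 / 2 →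
      ∑ a, obsWeight d 0 a * Real.exp (s * Y a) ≤ (√(1 - 2 * s))⁻¹ := by
    intro s hs hs'
    rw [sum_obsWeight_sq ∅ 0 u (fun z => Real.exp (s * z))]
    simp only [zero_mul, sub_zero, one_mul, zero_add]
    exact rademacher_exp_sq_le hu1 hs hs'
  set L := Real.log (1 / ν) with hL
  have hlog2 : 0 < Real.log 2 := Real.log_pos one_lt_two
  have hL2 : Real.log 2 ≤ L := Real.log_le_log two_pos (by
    rw [le_div_iff₀ hν]; linarith)
  -- each of the two tails is to have probability at most `ν / 2`
  have hL0 : 0 < L := hlog2.trans_le hL2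
  set x := (Real.log 2 + L) / n with hx
  have hx0 : 0 < x := by positivity
  have hnx : Real.exp (-(n * x)) = ν / 2 := by
    rw [hx, mul_div_cancel₀ _ hn'.ne', neg_add, Real.exp_add, Real.exp_neg, Real.exp_neg,
      Real.exp_log two_pos, hL, Real.exp_log (by positivity)]
    field_simp
  have hxL : x ≤ 2 * (L / n) := by
    rw [hx, ← mul_div_assoc]
    gcongr
    linarith
  have hLn : 0 ≤ L / n := by positivity
  set q := √(L / n) with hq
  have hq0 : 0 ≤ q := Real.sqrt_nonneg _
  have hqq : q ^ 2 = L / n := Real.sq_sqrt hLn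
  have hsx : √x ≤ 2 * q := by
    rw [Real.sqrt_le_left (by positivity), mul_pow, hqq]
    linarith
  have hup := rademacher_upper_tail hw n hx0 hexp
  have hlo := lower_tail_finite hw (sum_obsWeight d 0) n hY0 hm1 hm2 (by norm_num)
    (t := 4 * q + 4 * (L / n)) (by positivity)
  have hlo' : Real.exp (-(n * ((4 * q + 4 * (L / n)) ^ 2 / (2 * 3)))) ≤ ν / 2 := by
    rw [← hnx]
    refine Real.exp_le_exp.2 (neg_le_neg (mul_le_mul_of_nonneg_left ?_ hn'.le))
    nlinarith [mul_nonneg hq0 hLn]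
  rw [sampleLaw_plantedLaw_apply _ _ le_rfl zero_le_one]
  refine ENNReal.ofReal_le_ofReal ?_
  refine le_trans ?_ ((add_le_add (hup.trans hnx.le) (hlo.trans hlo')).trans (by linarith))
  rw [← Finset.sum_add_distrib]
  refine Finset.sum_le_sum fun a _ => ?_
  have hP : 0 ≤ ∏ i, obsWeight d 0 (a i) := Finset.prod_nonneg fun i _ => hw _
  simp only [Set.mem_ofPred_eq]
  have hsum : empVar (fun i => plantedRow ∅ (a i)) u = (∑ i, Y (a i)) / n := rfl
  by_cases h : 4 * q + 4 * (L / n) < |empVar (fun i => plantedRow ∅ (a i)) u - 1|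
  · rw [if_pos h]
    rw [hsum] at h
    rcases lt_abs.1 h with h' | h'
    · rw [if_pos]
      · split_ifs <;> linarith
      · have h1 : 1 + (2 * √x + 2 * x) ≤ (∑ i, Y (a i)) / n := by linarith
        rw [le_div_iff₀ hn'] at h1
        linarith
    · have h1 : (∑ i, Y (a i)) / n ≤ 1 - (4 * q + 4 * (L / n)) := by linarith
      rw [div_le_iff₀ hn'] at h1
      rw [if_pos (by linarith : ∑ i, Y (a i) ≤ n * (1 - (4 * q + 4 * (L / n))))]
      split_ifs <;> linarith
  · rw [if_neg h]
    split_ifs <;> simp [hP]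

/-- Unit vectors supported on `k` points of `S` realize every value of `(∑ j, v j) ^ 2` between `1`
and `k`, by continuity: the sum moves from `1` at a coordinate vector to `√k` at the normalized
indicator of a `k`-set. -/
theorem exists_sparse_vector {d k : ℕ} {S : Finset (Fin d)} (hk : 0 < k) (hS : k ≤ S.card) {r : ℝ}
    (hr1 : 1 ≤ r) (hrk : r ≤ k) :
    ∃ v ∈ sparseSphere d k, (∀ j, j ∉ S → v j = 0) ∧ (∑ j, v j) ^ 2 = r := by
  classical
  obtain ⟨T, hTS, hT⟩ := Finset.exists_subset_card_eq hS
  obtain ⟨j₀, hj₀⟩ : T.Nonempty := Finset.card_pos.1 (by omega)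
  have hk0 : (0 : ℝ) < k := by exact_mod_cast hk
  have hk1 : (1 : ℝ) ≤ k := by exact_mod_cast hk
  have hcard : (((T.erase j₀).card : ℕ) : ℝ) = k - 1 := by
    rw [Finset.card_erase_of_mem hj₀, hT, Nat.cast_sub hk, Nat.cast_one]
  have hsk : 0 < √(k : ℝ) := Real.sqrt_pos.2 hk0
  have hsk2 : √(k : ℝ) ^ 2 = k := Real.sq_sqrt hk0.le
  let f : ℝ → ℝ := fun y => √(1 - (k - 1) * y ^ 2) + (k - 1) * y
  have hf : ContinuousOn f (Set.Icc 0 (1 / √k)) := by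
    apply Continuous.continuousOn
    fun_prop
  have hf0 : f 0 = 1 := by simp [f]
  have hf1 : f (1 / √k) = √k := by
    have : (1 : ℝ) - (k - 1) * (1 / √k) ^ 2 = (1 / √k) ^ 2 := by
      rw [div_pow, hsk2]; field_simp; ring
    simp only [f]
    rw [this, Real.sqrt_sq (by positivity)]
    field_simp
    rw [hsk2]; ring
  obtain ⟨y, ⟨hy0, hy1⟩, hy⟩ : √r ∈ f '' Set.Icc 0 (1 / √k) := by
    refine intermediate_value_Icc (by positivity) hf ⟨?_, ?_⟩
    · rw [hf0]; exact Real.one_le_sqrt.2 hr1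
    · rw [hf1]; exact Real.sqrt_le_sqrt hrk
  have hy2 : 0 ≤ 1 - (k - 1) * y ^ 2 := by
    have h1 : y ^ 2 ≤ (1 / √k) ^ 2 := by gcongr
    rw [div_pow, hsk2, one_pow, le_div_iff₀ hk0] at h1
    nlinarith [sq_nonneg y]
  let v : Fin d → ℝ := fun j => if j = j₀ then √(1 - (k - 1) * y ^ 2) else if j ∈ T then y else 0
  have hv0 : ∀ j, j ∉ T → v j = 0 := by
    intro j hj
    have : j ≠ j₀ := by rintro rfl; exact hj hj₀
    simp [v, hj, this]
  have hsum : ∀ g : ℝ → ℝ, g 0 = 0 →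
      ∑ j, g (v j) = g (√(1 - (k - 1) * y ^ 2)) + (k - 1) * g y := by
    intro g hg
    rw [← Finset.sum_subset (Finset.subset_univ T) fun j _ hj => by rw [hv0 j hj, hg],
      ← Finset.add_sum_erase T _ hj₀]
    congr 1
    · simp [v]
    · rw [← hcard, ← nsmul_eq_mul, ← Finset.sum_const]
      refine Finset.sum_congr rfl fun j hj => ?_
      simp [v, Finset.ne_of_mem_erase hj, Finset.mem_of_mem_erase hj]
  refine ⟨v, ⟨?_, ?_⟩, fun j hj => hv0 j fun h => hj (hTS h), ?_⟩
  · have := hsum (fun z => z ^ 2) (by norm_num)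
    simp only [Real.sq_sqrt hy2] at this
    change ∑ j, v j ^ 2 = 1
    rw [this]; ring
  · rw [← hT, ← Set.ncard_coe_finset T]
    exact Set.ncard_le_ncard (fun j hj => by_contra fun h => hj (hv0 j h)) (Finset.finite_toSet T)
  · have := hsum (fun z => z) rfl
    rw [this]
    change f y ^ 2 = r
    rw [hy, Real.sq_sqrt (by linarith)]

/-- Planting with probability `p` on a set of at least `k` coordinates gives a law of the alternative
for every signal strength up to `p (k - 1)`. -/
theorem plantedLaw_mem_altLaws {d n k : ℕ} (hn : 0 < n) (hk : 0 < k) {S : Finset (Fin d)}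
    (hS : k ≤ S.card) {p θ : ℝ} (hp0 : 0 ≤ p) (hp1 : p ≤ 1) (hθ0 : 0 < θ)
    (hθ : θ ≤ p * (k - 1)) : plantedLaw S p ∈ altLaws d n k θ := by
  classical
  have hn' : (0 : ℝ) < n := by exact_mod_cast hn
  have hk1 : (1 : ℝ) ≤ k := by exact_mod_cast hk
  have hp : 0 < p := by
    rcases hp0.eq_or_lt with rfl | h
    · linarith
    · exact h
  have hw := obsWeight_nonneg (d := d) hp0 hp1
  obtain ⟨v, hv, hvS, hvr⟩ := exists_sparse_vector (r := 1 + θ / p) hk hS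
    (by have : 0 < θ / p := by positivity
        linarith)
    (by have : θ / p ≤ k - 1 := by rw [div_le_iff₀ hp]; linarith
        linarith)
  have hv1 : ∑ j, v j ^ 2 = 1 := hv.1
  set Y : Obs d → ℝ := fun a => (v ⬝ᵥ plantedRow S a) ^ 2 with hYdef
  have hY0 : ∀ a, 0 ≤ Y a := fun a => sq_nonneg _
  have hm1 : ∑ a, obsWeight d p a * Y a = 1 + θ := by
    rw [sum_obsWeight_sq_of_support p hvS (fun z => z), rademacher_second_moment, hv1, hvr]
    field_simp
    ring
  have hm2 : ∑ a, obsWeight d p a * Y a ^ 2 ≤ 3 + θ * (k + 1) := by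
    rw [sum_obsWeight_sq_of_support p hvS (fun z => z ^ 2), hvr]
    have h4 := rademacher_fourth_moment_le v
    simp only [← pow_mul, Nat.reduceMul]
    rw [hv1] at h4
    have h5 := mul_le_mul_of_nonneg_left h4 (by linarith : 0 ≤ 1 - p)
    have h6 : p * (1 + θ / p) ^ 2 = p + θ * (2 + θ / p) := by field_simp; ring
    have h7 : θ / p ≤ k - 1 := by rw [div_le_iff₀ hp]; linarith
    nlinarith [mul_le_mul_of_nonneg_left h7 hθ0.le]
  refine ⟨isCentered_plantedLaw _ hp0 hp1, v, hv, ?_, fun ν hν => ?_⟩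
  · rw [dirVar_plantedLaw _ hp0 hp1, hm1]
  rw [sampleLaw_plantedLaw_apply _ _ hp0 hp1]
  refine ENNReal.ofReal_le_ofReal ?_
  rcases le_or_gt 1 ν with h1 | h1
  · calc _ ≤ ∑ a : Fin n → Obs d, ∏ i, obsWeight d p (a i) := by
          refine Finset.sum_le_sum fun a _ => ?_
          have : 0 ≤ ∏ i, obsWeight d p (a i) := Finset.prod_nonneg fun i _ => hw _
          split_ifs <;> simp [this]
      _ = 1 := by rw [← Fintype.sum_pow, sum_obsWeight, one_pow]
      _ ≤ ν := h1
  set ℓ := Real.log (2 / ν) with hℓ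
  have hℓ0 : 0 < ℓ := Real.log_pos (by rw [lt_div_iff₀ hν]; linarith)
  set a₁ := √(2 * θ * k * ℓ / n) with ha₁
  set a₂ := √(ℓ / n) with ha₂
  have h1' : a₁ ^ 2 = 2 * θ * k * ℓ / n := Real.sq_sqrt (by positivity)
  have h2' : a₂ ^ 2 = ℓ / n := Real.sq_sqrt (by positivity)
  have ha₁0 : 0 ≤ a₁ := Real.sqrt_nonneg _
  have ha₂0 : 0 ≤ a₂ := Real.sqrt_nonneg _
  have hlo := lower_tail_finite hw (sum_obsWeight d p) n hY0 hm1 hm2 (by positivity)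
    (t := 2 * a₁ + 4 * a₂) (by positivity)
  have hexp : Real.exp (-(n * ((2 * a₁ + 4 * a₂) ^ 2 / (2 * (3 + θ * (k + 1)))))) ≤ ν := by
    have h2ν : Real.exp (-ℓ) ≤ ν := by
      rw [Real.exp_neg, hℓ, Real.exp_log (by positivity), inv_div]
      linarith
    refine le_trans (Real.exp_le_exp.2 (neg_le_neg ?_)) h2ν
    rw [← mul_div_assoc, le_div_iff₀ (by positivity)]
    have h3 : n * a₁ ^ 2 = 2 * θ * k * ℓ := by rw [h1']; field_simp
    have h4 : n * a₂ ^ 2 = ℓ := by rw [h2']; field_simp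
    have h5 : n * (2 * a₁ + 4 * a₂) ^ 2 = 4 * (2 * θ * k * ℓ) + 16 * ℓ + 16 * (n * (a₁ * a₂)) := by
      linear_combination 4 * h3 + 16 * h4
    rw [h5]
    have h6 : θ * ℓ ≤ θ * ℓ * k := le_mul_of_one_le_right (by positivity) hk1
    have h7 : 0 ≤ n * (a₁ * a₂) := by positivity
    nlinarith
  refine le_trans ?_ (hlo.trans hexp)
  refine Finset.sum_le_sum fun a _ => ?_
  have hP : 0 ≤ ∏ i, obsWeight d p (a i) := Finset.prod_nonneg fun i _ => hw _
  simp only [Set.mem_ofPred_eq]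
  have hsum : empVar (fun i => plantedRow S (a i)) v = (∑ i, Y (a i)) / n := rfl
  by_cases h : empVar (fun i => plantedRow S (a i)) v - (1 + θ) < -2 * a₁ - 4 * a₂
  · rw [if_pos h, if_pos]
    rw [hsum] at h
    have h8 : (∑ i, Y (a i)) / n ≤ 1 + θ - (2 * a₁ + 4 * a₂) := by linarith
    rw [div_le_iff₀ hn'] at h8
    linarith
  · rw [if_neg h]
    split_ifs <;> simp [hP]

/-! ### Entrywise thresholding of the empirical covariance -/

/-- The `(j, l)` entry of `n` times the difference of the empirical covariance and the identity. -/
noncomputable def gramDefect {d n : ℕ} (x : Fin n → Fin d → ℝ) (j l : Fin d) : ℝ :=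
  ∑ i, x i j * x i l - if j = l then (n : ℝ) else 0

/-- The test that thresholds the entries of the empirical covariance at level `τ` is a program with
`O(d² n)` operations. -/
theorem exists_thresholdProgram (d n : ℕ) (τ : ℝ) :
    ∃ P : RandProgram (Fin n × Fin d), P.time ≤ d * d * (8 * n + 16) + 2 ∧
      ∀ (x : Fin n → Fin d → ℝ) (ω : Fin P.coins → Bool),
        P.output (fun ij => x ij.1 ij.2) ω = true ↔ ∃ j l, τ < |gramDefect x j l| := by
  classical
  let g : Fin d → Fin d → ((Fin n × Fin d) ⊕ Fin 0 → ℝ) → ℝ := fun j l x =>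
    ∑ i, x (.inl (i, j)) * x (.inl (i, l)) - if j = l then (n : ℝ) else 0
  have hg : ∀ j l, HasCost (4 * n + 3) (g j l) := fun j l => by
    refine ((HasCost.sum Finset.univ _ fun i _ =>
      (hasCost_input (Sum.inl (i, j))).mul (hasCost_input (Sum.inl (i, l)))).sub
        (hasCost_const (if j = l then (n : ℝ) else 0))).mono ?_
    simp; omega
  let f : Fin d × Fin d → ((Fin n × Fin d) ⊕ Fin 0 → ℝ) → ℝ := fun a x =>
    (1 - if g a.1 a.2 x ≤ τ then 1 else 0) + (1 - if -τ ≤ g a.1 a.2 x then 1 else 0)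
  have hf : ∀ a, HasCost (8 * n + 15) (f a) := fun a => by
    refine (((hasCost_const 1).sub ((hg a.1 a.2).le (hasCost_const τ))).add
      ((hasCost_const 1).sub ((hasCost_const (-τ)).le (hg a.1 a.2)))).mono ?_
    omega
  have hsum := HasCost.sum Finset.univ f fun a _ => hf a
  obtain ⟨p, hp, hrun⟩ := hsum.exists_code
  refine ⟨⟨0, p⟩, by simpa [RandProgram.time] using hp, fun x ω => ?_⟩
  have hnn : ∀ a y, 0 ≤ f a y := fun a y => by
    simp only [f]; split_ifs <;> norm_num
  rw [RandProgram.output, decide_eq_true_iff]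
  simp only [hrun]
  rw [Finset.sum_pos_iff_of_nonneg fun a _ => hnn a _]
  simp only [Finset.mem_univ, true_and, Prod.exists]
  refine exists_congr fun j => exists_congr fun l => ?_
  simp only [f]
  change 0 < (1 - if gramDefect x j l ≤ τ then (1 : ℝ) else 0)
    + (1 - if -τ ≤ gramDefect x j l then (1 : ℝ) else 0) ↔ _
  rw [lt_abs, lt_neg, lt_iff_not_ge (a := τ), lt_iff_not_ge (b := -τ)]
  by_cases h1 : gramDefect x j l ≤ τ <;> by_cases h2 : -τ ≤ gramDefect x j l <;>
    simp [h1, h2]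

/-- The directions `e_j` (if `j = l`) and `(e_j ± e_l) / √2`: by polarization they determine the
empirical covariance. -/
noncomputable def polarVec {d : ℕ} (a : Fin d × Fin d × Bool) : Fin d → ℝ :=
  if a.1 = a.2.1 then Pi.single a.1 1
    else (√2)⁻¹ • (Pi.single a.1 1 + Pi.single a.2.1 (sgn a.2.2))

theorem polarVec_mem_unitSphere {d : ℕ} (a : Fin d × Fin d × Bool) :
    polarVec a ∈ unitSphere d := by
  obtain ⟨j, l, b⟩ := a
  change ∑ i, polarVec (j, l, b) i ^ 2 = 1
  have hdot : ∀ v : Fin d → ℝ, ∑ i, v i ^ 2 = v ⬝ᵥ v := fun v => by simp [dotProduct, sq]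
  rw [hdot, polarVec]
  by_cases h : j = l
  · simp [h]
  · have h2 : (√2)⁻¹ * (√2)⁻¹ = (1 / 2 : ℝ) := by
      rw [← mul_inv, Real.mul_self_sqrt (by norm_num)]; norm_num
    rw [if_neg h, smul_dotProduct, dotProduct_smul, smul_eq_mul, smul_eq_mul, ← mul_assoc, h2]
    simp only [add_dotProduct, single_dotProduct, Pi.add_apply, Pi.single_eq_same,
      Pi.single_eq_of_ne h, Pi.single_eq_of_ne (Ne.symm h)]
    have := sgn_mul_self b
    linarith

/-- Polarization bounds the entries of the empirical covariance. -/
theorem abs_gramDefect_le {d n : ℕ} (hn : 0 < n) (x : Fin n → Fin d → ℝ) (j l : Fin d) {t : ℝ}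
    (h : ∀ b, |empVar x (polarVec (j, l, b)) - 1| ≤ t) : |gramDefect x j l| ≤ n * t := by
  have hn' : (0 : ℝ) < n := by exact_mod_cast hn
  by_cases hjl : j = l
  · subst hjl
    have h0 := h true
    have : gramDefect x j j = n * (empVar x (polarVec (j, j, true)) - 1) := by
      simp only [gramDefect, empVar, polarVec, if_true, single_dotProduct, one_mul, sq]
      field_simp
    rw [this, abs_mul, abs_of_pos hn']
    gcongr
  · have h2 : (√2)⁻¹ ^ 2 = (1 / 2 : ℝ) := by
      rw [inv_pow, Real.sq_sqrt (by norm_num)]; norm_num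
    have key : gramDefect x j l = n * ((empVar x (polarVec (j, l, true))
        - empVar x (polarVec (j, l, false))) / 2) := by
      simp only [gramDefect, empVar, polarVec, if_neg hjl, smul_dotProduct, add_dotProduct,
        single_dotProduct, one_mul, smul_eq_mul, mul_pow, h2, sgn_true, sgn_false, sub_zero]
      rw [← sub_div, ← Finset.sum_sub_distrib]
      field_simp
      rw [Finset.sum_mul]
      refine Finset.sum_congr rfl fun i _ => ?_
      ring
    rw [key, abs_mul, abs_of_pos hn']
    gcongr
    have h1 := abs_le.1 (h true)
    have h2 := abs_le.1 (h false)
    rw [abs_le]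
    constructor <;> linarith

/-- Along a `k`-sparse direction the empirical variance exceeds `1` by at most `k` times the largest
defect. -/
theorem empVar_sub_one_le {d n k : ℕ} (hn : 0 < n) (x : Fin n → Fin d → ℝ) {v : Fin d → ℝ}
    (hv : v ∈ sparseSphere d k) {t : ℝ} (ht : 0 ≤ t) (h : ∀ j l, |gramDefect x j l| ≤ n * t) :
    empVar x v - 1 ≤ k * t := by
  classical
  have hn' : (0 : ℝ) < n := by exact_mod_cast hn
  obtain ⟨hv1, hvk⟩ := hv
  have hv1 : ∑ j, v j ^ 2 = 1 := hv1
  have key : n * (empVar x v - 1) = ∑ j, ∑ l, v j * v l * gramDefect x j l := by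
    have h1 : ∀ i, (v ⬝ᵥ x i) ^ 2 = ∑ j, ∑ l, v j * v l * (x i j * x i l) := fun i => by
      rw [sq, dotProduct, Finset.sum_mul_sum]
      refine Finset.sum_congr rfl fun j _ => Finset.sum_congr rfl fun l _ => ?_
      ring
    have h2 : ∑ j, ∑ l, v j * v l * (if j = l then (n : ℝ) else 0) = n := by
      simp only [mul_ite, mul_zero, Finset.sum_ite_eq, Finset.mem_univ, if_true]
      rw [← Finset.sum_mul]
      simp only [← sq, hv1, one_mul]
    simp only [gramDefect, mul_sub, Finset.sum_sub_distrib, h2, empVar, Finset.mul_sum]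
    rw [mul_div_cancel₀ _ hn'.ne', mul_one]
    simp only [h1]
    rw [Finset.sum_comm]
    congr 1
    refine Finset.sum_congr rfl fun j _ => Finset.sum_comm
  have hl1 : (∑ j, |v j|) ^ 2 ≤ k := by
    set T : Finset (Fin d) := Finset.univ.filter fun j => v j ≠ 0 with hT
    have hTk : T.card ≤ k := by
      rw [← Set.ncard_coe_finset]
      simpa [hT] using hvk
    have hs : ∑ j, |v j| = ∑ j ∈ T, |v j| := by
      rw [hT, Finset.sum_filter]
      refine Finset.sum_congr rfl fun j _ => ?_
      by_cases hj : v j = 0 <;> simp [hj]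
    rw [hs]
    refine (sq_sum_le_card_mul_sum_sq (s := T) (f := fun j => |v j|)).trans ?_
    have : ∑ j ∈ T, |v j| ^ 2 ≤ 1 := by
      simp only [sq_abs]
      rw [← hv1]
      exact Finset.sum_le_sum_of_subset_of_nonneg (Finset.subset_univ _) fun j _ _ => sq_nonneg _
    calc (T.card : ℝ) * ∑ j ∈ T, |v j| ^ 2 ≤ T.card * 1 := by gcongr
      _ ≤ k := by rw [mul_one]; exact_mod_cast hTk
  have hle : n * (empVar x v - 1) ≤ n * (k * t) := by
    rw [key]
    calc ∑ j, ∑ l, v j * v l * gramDefect x j l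
        ≤ ∑ j, ∑ l, |v j| * |v l| * (n * t) := by
          refine Finset.sum_le_sum fun j _ => Finset.sum_le_sum fun l _ => ?_
          refine (le_abs_self _).trans ?_
          rw [abs_mul, abs_mul]
          gcongr
          exact h j l
      _ = (∑ j, |v j|) ^ 2 * (n * t) := by
          rw [sq, Finset.sum_mul_sum, Finset.sum_mul]
          refine Finset.sum_congr rfl fun j _ => ?_
          rw [Finset.sum_mul]
      _ ≤ k * (n * t) := by gcongr
      _ = n * (k * t) := by ring
  exact le_of_mul_le_mul_left hle hn'

theorem prob_le_of_subset (ψ : SPCTest) (d n k : ℕ) {P : Measure (Fin d → ℝ)}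
    (hP : IsProbabilityMeasure P) (b : Bool) {s : Set (Fin n → Fin d → ℝ)}
    (h : ∀ x ω, (ψ d n k).output (fun ij => x ij.1 ij.2) ω = b → x ∈ s) :
    ψ.prob d n k P b ≤ sampleLaw n P s := by
  have : IsProbabilityMeasure (sampleLaw n P) := by
    unfold sampleLaw; infer_instance
  calc ψ.prob d n k P b
      ≤ ((sampleLaw n P).prod (fairBits (ψ d n k).coins).toMeasure) (s ×ˢ Set.univ) :=
        measure_mono fun z hz => ⟨h _ _ hz, trivial⟩
    _ = sampleLaw n P s := by
        rw [Measure.prod_prod, measure_univ, mul_one]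

/-- The threshold: below it, all `2 d ^ 2` empirical variances in the directions `polarVec` deviate
from `1` by less than `thresholdLevel` with probability at least `1 - δ / 2`. -/
noncomputable def thresholdLevel (δ : ℝ) (d n : ℕ) : ℝ :=
  4 * √(Real.log (4 * d ^ 2 / δ) / n) + 4 * (Real.log (4 * d ^ 2 / δ) / n)

/-- A union bound over the directions `polarVec`. -/
theorem prob_threshold_null {δ : ℝ} (hδ0 : 0 < δ) (hδ1 : δ < 1 / 3) {d n k : ℕ} (hd : 0 < d)
    (hn : 0 < n) (ψ : SPCTest)
    (hψ : ∀ x ω, (ψ d n k).output (fun ij => x ij.1 ij.2) ω = true ↔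
      ∃ j l, n * thresholdLevel δ d n < |gramDefect x j l|)
    {P : Measure (Fin d → ℝ)} (hP : P ∈ nullLaws d n) :
    ψ.prob d n k P true ≤ ENNReal.ofReal (δ / 2) := by
  obtain ⟨⟨hprob, -⟩, -, hconc⟩ := hP
  have hd' : (1 : ℝ) ≤ d := by exact_mod_cast hd
  set ν : ℝ := δ / (4 * d ^ 2) with hν
  have hν0 : 0 < ν := by positivity
  have hν1 : ν ≤ 1 / 2 := by
    rw [hν, div_le_div_iff₀ (by positivity) (by norm_num)]
    nlinarith
  have hL : Real.log (1 / ν) = Real.log (4 * d ^ 2 / δ) := by rw [hν, one_div_div]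
  let B : Fin d × Fin d × Bool → Set (Fin n → Fin d → ℝ) := fun a =>
    {x | thresholdLevel δ d n < |empVar x (polarVec a) - 1|}
  have hB : ∀ a, sampleLaw n P (B a) ≤ ENNReal.ofReal ν := fun a => by
    have := hconc _ (polarVec_mem_unitSphere a) ν hν0 hν1
    rwa [hL] at this
  calc ψ.prob d n k P true ≤ sampleLaw n P (⋃ a, B a) := by
        refine prob_le_of_subset ψ d n k hprob true fun x ω h => ?_
        obtain ⟨j, l, hjl⟩ := (hψ x ω).1 h
        by_contra hx
        simp only [B, Set.mem_iUnion, not_exists, Set.mem_ofPred_eq, not_lt] at hx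
        exact absurd (abs_gramDefect_le hn x j l fun b => hx (j, l, b)) (not_le.2 hjl)
    _ ≤ ∑ a, sampleLaw n P (B a) := measure_iUnion_fintype_le _ _
    _ ≤ ∑ _a : Fin d × Fin d × Bool, ENNReal.ofReal ν := Finset.sum_le_sum fun a _ => hB a
    _ = ENNReal.ofReal (δ / 2) := by
        rw [← ENNReal.ofReal_sum_of_nonneg fun _ _ => hν0.le]
        congr 1
        rw [Finset.sum_const, Finset.card_univ]
        simp [hν]
        field_simp
        norm_num

/-- If the test accepts, no sparse direction has large empirical variance, which is improbable under
the alternative. -/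
theorem prob_threshold_alt {δ : ℝ} (hδ0 : 0 < δ) (hδ1 : δ < 1 / 3) {d n k : ℕ}
    (hR : (d, n, k) ∈ sparseRegime δ) (ψ : SPCTest)
    (hψ : ∀ x ω, (ψ d n k).output (fun ij => x ij.1 ij.2) ω = true ↔
      ∃ j l, n * thresholdLevel δ d n < |gramDefect x j l|)
    {θ : ℝ} (hθ0 : 0 < θ) (hθ : 50 * k * √(Real.log (6 * Real.exp 1 * d / δ) / n) ≤ θ)
    {P : Measure (Fin d → ℝ)} (hP : P ∈ altLaws d n k θ) :
    ψ.prob d n k P false ≤ ENNReal.ofReal (δ / 2) := by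
  obtain ⟨hd, hn, hk, hreg, -⟩ := hR
  obtain ⟨⟨hprob, -⟩, v, hv, -, hconc⟩ := hP
  refine (prob_le_of_subset ψ d n k hprob false fun x ω h => ?_).trans
    (hconc (δ / 2) (by linarith))
  have hd1 : (1 : ℝ) ≤ d := by exact_mod_cast hd
  have hn1 : (1 : ℝ) ≤ n := by exact_mod_cast hn
  have hk1 : (1 : ℝ) ≤ k := by exact_mod_cast hk
  have he : 1 ≤ Real.exp 1 := Real.one_le_exp zero_le_one
  have hall : ∀ j l, |gramDefect x j l| ≤ n * thresholdLevel δ d n := by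
    by_contra hcon
    push Not at hcon
    rw [(hψ x ω).2 hcon] at h
    exact absurd h (by simp)
  set Λ := Real.log (6 * Real.exp 1 * d / δ) with hΛ
  set q := √(Λ / n) with hq
  have hΛarg : 4 / δ ≤ 6 * Real.exp 1 * d / δ := by gcongr; nlinarith
  have h4δ : 12 < 4 / δ := by rw [lt_div_iff₀ hδ0]; linarith
  have hΛ0 : 0 < Λ := Real.log_pos (by linarith)
  have hq0 : 0 ≤ q := Real.sqrt_nonneg _
  have hqq : q ^ 2 = Λ / n := Real.sq_sqrt (by positivity)
  have hkq : 15 * (√k * q) ≤ 1 := by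
    rw [hq, ← Real.sqrt_mul (by positivity), ← mul_div_assoc]
    exact hreg
  have hsk : 1 ≤ √(k : ℝ) := Real.one_le_sqrt.2 hk1
  have hkqq : k * q ^ 2 ≤ q * k / 15 := by
    have : √(k : ℝ) * √k = k := Real.mul_self_sqrt (by positivity)
    have h15 : √(k : ℝ) * q ≤ 1 / 15 := by linarith
    calc k * q ^ 2 = (√k * q) * (√k * q) := by rw [mul_mul_mul_comm, this, sq]
      _ ≤ 1 / 15 * (√k * q) := by gcongr
      _ ≤ 1 / 15 * (√k * √k * q) := by gcongr; nlinarith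
      _ = q * k / 15 := by rw [this]; ring
  have hL : Real.log (4 * d ^ 2 / δ) ≤ 2 * Λ := by
    have h2Λ : 2 * Λ = Real.log ((6 * Real.exp 1 * d / δ) ^ 2) := by
      rw [Real.log_pow, hΛ, Nat.cast_two]
    rw [h2Λ]
    refine Real.log_le_log (by positivity) ?_
    rw [div_pow, div_le_div_iff₀ hδ0 (by positivity)]
    have h1 : (6 : ℝ) ≤ 6 * Real.exp 1 := by linarith
    calc 4 * (d : ℝ) ^ 2 * δ ^ 2 = 4 * δ * ((d : ℝ) ^ 2 * δ) := by ring
      _ ≤ 36 * ((d : ℝ) ^ 2 * δ) := by gcongr; linarith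
      _ = (6 * d) ^ 2 * δ := by ring
      _ ≤ (6 * Real.exp 1 * d) ^ 2 * δ := by gcongr
  have hLn : Real.log (4 * d ^ 2 / δ) / n ≤ 2 * q ^ 2 := by
    rw [hqq, ← mul_div_assoc]; gcongr
  have ht : k * thresholdLevel δ d n ≤ 8 * (k * q) := by
    have h1 : √(Real.log (4 * d ^ 2 / δ) / n) ≤ 3 / 2 * q := by
      rw [Real.sqrt_le_left (by positivity)]
      nlinarith [sq_nonneg q]
    have h2 : thresholdLevel δ d n ≤ 6 * q + 8 * q ^ 2 := by
      unfold thresholdLevel; linarith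
    calc k * thresholdLevel δ d n ≤ k * (6 * q + 8 * q ^ 2) := by gcongr
      _ = 6 * (k * q) + 8 * (k * q ^ 2) := by ring
      _ ≤ 8 * (k * q) := by nlinarith [mul_nonneg hq0 (by positivity : (0 : ℝ) ≤ k)]
  have hV := empVar_sub_one_le hn x hv (by
    have : 0 ≤ Real.log (4 * d ^ 2 / δ) := Real.log_nonneg (by
      rw [le_div_iff₀ hδ0]; nlinarith)
    unfold thresholdLevel; positivity) hall
  set ℓ := Real.log (2 / (δ / 2)) with hℓ
  have hℓΛ : ℓ ≤ Λ := by
    refine Real.log_le_log (by positivity) (le_trans (le_of_eq ?_) hΛarg)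
    field_simp; norm_num
  have hℓ0 : 0 ≤ ℓ := Real.log_nonneg (by
    rw [le_div_iff₀ (by positivity)]; linarith)
  have hℓn : ℓ / n ≤ q ^ 2 := by rw [hqq]; gcongr
  have hs2 : √(ℓ / n) ≤ k * q := by
    refine (Real.sqrt_le_left hq0 |>.2 hℓn).trans ?_
    exact le_mul_of_one_le_left hq0 hk1
  -- arithmetic and geometric means: `2 √(θ y) ≤ θ / 2 + 2 y` with `y = 2 k ℓ / n`
  have hs1 : 2 * √(2 * θ * k * ℓ / n) ≤ θ / 2 + 4 * (k * q ^ 2) := by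
    have h1 : √(2 * θ * k * ℓ / n) ≤ (θ / 2 + 4 * (k * q ^ 2)) / 2 := by
      rw [Real.sqrt_le_left (by positivity)]
      have h2 : 2 * θ * k * ℓ / n ≤ 2 * θ * (k * q ^ 2) := by
        rw [mul_div_assoc, mul_assoc]; gcongr
      nlinarith [sq_nonneg (θ / 2 - 4 * (k * q ^ 2))]
    linarith
  have hkq0 : 0 < k * q := by
    have : 0 < q := Real.sqrt_pos.2 (by positivity)
    positivity
  change empVar x v - (1 + θ) < -2 * √(2 * θ * k * ℓ / n) - 4 * √(ℓ / n)
  nlinarith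

/-- A polynomial-time test has error at most `δ / 2` as soon as `θ` is a large enough multiple of
`√(k² log d / n)`. -/
theorem exists_polyTime_test {δ : ℝ} (hδ0 : 0 < δ) (hδ1 : δ < 1 / 3) :
    ∃ ψ : SPCTest, ψ.PolyTime ∧ ∃ c : ℝ, 0 < c ∧ ∀ d n k, (d, n, k) ∈ sparseRegime δ → n < d →
      ∀ θ : ℝ, 0 < θ → c * thetaPoly d n k ≤ θ → ψ.maxError d n k θ ≤ ENNReal.ofReal (δ / 2) := by
  choose P hPt hPo using fun d n => exists_thresholdProgram d n (n * thresholdLevel δ d n)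
  let ψ : SPCTest := fun d n _ => P d n
  have he : 1 ≤ Real.exp 1 := Real.one_le_exp zero_le_one
  set K := Real.log (6 * Real.exp 1 / δ) with hK
  have hK0 : 0 ≤ K := Real.log_nonneg (by rw [le_div_iff₀ hδ0]; linarith)
  have hlog2 : 0 < Real.log 2 := Real.log_pos one_lt_two
  refine ⟨ψ, ⟨Polynomial.X ^ 2 * (8 * Polynomial.X + 16) + 2, fun d n k => ?_⟩,
    50 * √(K / Real.log 2 + 1), by positivity, fun d n k hR hnd θ hθ0 hθ => ?_⟩
  · refine (hPt d n).trans ?_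
    simp only [Polynomial.eval_add, Polynomial.eval_mul, Polynomial.eval_X,
      Polynomial.eval_ofNat, sq]
    gcongr <;> omega
  obtain ⟨hd, hn, hk, -, -⟩ := id hR
  have hd2 : (2 : ℝ) ≤ d := by exact_mod_cast (by omega : 2 ≤ d)
  refine iSup₂_le fun P₀ h₀ => iSup₂_le fun P₁ h₁ => max_le ?_ ?_
  · exact prob_threshold_null hδ0 hδ1 hd hn ψ (hPo d n) h₀
  · refine prob_threshold_alt hδ0 hδ1 hR ψ (hPo d n) hθ0 (le_trans ?_ hθ) h₁
    have hΛ : Real.log (6 * Real.exp 1 * d / δ) ≤ (K / Real.log 2 + 1) * Real.log d := by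
      have h1 : Real.log (6 * Real.exp 1 * d / δ) = K + Real.log d := by
        rw [hK, ← Real.log_mul (by positivity) (by positivity)]
        congr 1; ring
      have h2 : Real.log 2 ≤ Real.log d := Real.log_le_log two_pos hd2
      rw [h1, add_mul, one_mul, div_mul_eq_mul_div]
      gcongr
      rw [le_div_iff₀ hlog2]
      gcongr
    have h3 : ∀ z : ℝ, k * √z = √((k : ℝ) ^ 2 * z) := fun z => by
      rw [Real.sqrt_mul (by positivity), Real.sqrt_sq (by positivity)]
    rw [mul_assoc 50 (k : ℝ), h3, mul_assoc 50 (√_), thetaPoly, ← Real.sqrt_mul (by positivity)]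
    gcongr 50 * √?_
    rw [← mul_div_assoc, ← mul_div_assoc]
    gcongr ?_ / _
    calc (k : ℝ) ^ 2 * Real.log (6 * Real.exp 1 * d / δ)
        ≤ (k : ℝ) ^ 2 * ((K / Real.log 2 + 1) * Real.log d) := by gcongr
      _ = _ := by ring

/-! ### Hypergeometric and binomial probabilities -/

/-- `log b` is at most the increment of `x log x - x` over `[b - 1, b]` plus half the increment of
`log`: the trapezoidal rule for the concave function `log`. -/
theorem log_le_trapezoid {b : ℝ} (hb : 1 < b) :
    Real.log b ≤ (b * Real.log b - b) - ((b - 1) * Real.log (b - 1) - (b - 1))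
      + (Real.log b - Real.log (b - 1)) / 2 := by
  have ha : 0 < b - 1 := by linarith
  have h := Real.le_log_one_add_of_nonneg (x := 1 / (b - 1)) (by positivity)
  have h1 : 1 + 1 / (b - 1) = b / (b - 1) := by field_simp; ring
  have h2 : 2 * (1 / (b - 1)) / (1 / (b - 1) + 2) = 1 / (b - 1 / 2) := by
    have : 2 * b - 1 ≠ 0 := by linarith
    have : b - 1 / 2 ≠ 0 := by linarith
    have : 1 / (b - 1) + 2 ≠ 0 := by positivity
    field_simp
    ring
  rw [h1, h2, Real.log_div (by linarith) ha.ne', div_le_iff₀ (by linarith)] at h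
  linarith

theorem le_log_of_one_le {b : ℝ} (hb : 1 ≤ b) :
    (b * Real.log b - b) - ((b - 1) * Real.log (b - 1) - (b - 1)) ≤ Real.log b := by
  rcases hb.eq_or_lt with rfl | hb
  · simp
  have ha : 0 < b - 1 := by linarith
  have h := Real.log_le_sub_one_of_pos (x := b / (b - 1)) (by positivity)
  rw [Real.log_div (by linarith) ha.ne'] at h
  have h1 := mul_le_mul_of_nonneg_left h ha.le
  have h2 : (b - 1) * (b / (b - 1) - 1) = 1 := by field_simp; ring
  rw [h2] at h1
  linarith

theorem log_descFactorial_le {K j : ℕ} (hj : j < K) :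
    Real.log (K.descFactorial j) ≤ (K * Real.log K - K)
      - (((K - j : ℝ)) * Real.log (K - j) - (K - j)) + (Real.log K - Real.log (K - j)) / 2 := by
  induction j with
  | zero => simp
  | succ j ih =>
    have hj' : j < K := by omega
    have hb : (1 : ℝ) < K - j := by
      have : ((j + 1 : ℕ) : ℝ) < K := by exact_mod_cast hj
      push_cast at this; linarith
    rw [Nat.descFactorial_succ, Nat.cast_mul, Nat.cast_sub hj'.le, Real.log_mul (by linarith)
      (by exact_mod_cast (Nat.descFactorial_pos.2 hj'.le).ne')]
    have := log_le_trapezoid hb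
    have := ih hj'
    push_cast
    rw [← sub_sub]
    linarith

theorem le_log_descFactorial {N n : ℕ} (hn : n ≤ N) :
    (N * Real.log N - N) - (((N - n : ℝ)) * Real.log (N - n) - (N - n))
      ≤ Real.log (N.descFactorial n) := by
  induction n with
  | zero => simp
  | succ n ih =>
    have hn' : n ≤ N := by omega
    have hb : (1 : ℝ) ≤ N - n := by
      have : ((n + 1 : ℕ) : ℝ) ≤ N := by exact_mod_cast hn
      push_cast at this; linarith
    rw [Nat.descFactorial_succ, Nat.cast_mul, Nat.cast_sub hn', Real.log_mul (by linarith)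
      (by exact_mod_cast (Nat.descFactorial_pos.2 hn').ne')]
    have := le_log_of_one_le hb
    have := ih hn'
    push_cast
    rw [← sub_sub]
    linarith

/-- The log-sum inequality for two terms. -/
theorem log_sum_le {a₁ a₂ b₁ b₂ : ℝ} (ha₁ : 0 < a₁) (ha₂ : 0 < a₂) (hb₁ : 0 < b₁) (hb₂ : 0 < b₂) :
    a₁ * Real.log b₁ + a₂ * Real.log b₂ - (a₁ + a₂) * Real.log (b₁ + b₂)
      ≤ a₁ * Real.log a₁ + a₂ * Real.log a₂ - (a₁ + a₂) * Real.log (a₁ + a₂) := by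
  have key : ∀ a b : ℝ, 0 < a → 0 < b →
      a * (Real.log b - Real.log (b₁ + b₂) - Real.log a + Real.log (a₁ + a₂))
        ≤ b * (a₁ + a₂) / (b₁ + b₂) - a := by
    intro a b ha hb
    have h := Real.log_le_sub_one_of_pos (x := b * (a₁ + a₂) / ((b₁ + b₂) * a)) (by positivity)
    rw [Real.log_div (by positivity) (by positivity), Real.log_mul (by positivity) (by positivity),
      Real.log_mul (by positivity) (by positivity)] at h
    have h1 := mul_le_mul_of_nonneg_left h ha.le
    have h2 : a * (b * (a₁ + a₂) / ((b₁ + b₂) * a) - 1) = b * (a₁ + a₂) / (b₁ + b₂) - a := by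
      field_simp
    rw [h2] at h1
    refine le_trans (le_of_eq ?_) h1
    ring
  have h1 := key a₁ b₁ ha₁ hb₁
  have h2 := key a₂ b₂ ha₂ hb₂
  have h3 : b₁ * (a₁ + a₂) / (b₁ + b₂) + b₂ * (a₁ + a₂) / (b₁ + b₂) = a₁ + a₂ := by
    field_simp
  linarith

/-- The hypergeometric probability of any one outcome of `j + l` draws exceeds the binomial one by at
most the factor `((1 - j / K) (1 - l / L)) ^ (-1 / 2)`, which is close to `1` when few draws are made.
Logarithms of falling factorials are compared with the increments of `x log x - x`, and the main terms
by the log-sum inequality. -/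
theorem choose_mul_sqrt_le {K L j l : ℕ} (hj : j < K) (hl : l < L) :
    ((K + L - (j + l)).choose (K - j) : ℝ) * √((1 - j / K) * (1 - l / L))
      ≤ (K + L).choose K * ((K / (K + L) : ℝ) ^ j * (L / (K + L) : ℝ) ^ l) := by
  have hK : (0 : ℝ) < K := by exact_mod_cast (by omega : 0 < K)
  have hL : (0 : ℝ) < L := by exact_mod_cast (by omega : 0 < L)
  have hKj : (0 : ℝ) < K - j := by rw [sub_pos]; exact_mod_cast hj
  have hLl : (0 : ℝ) < L - l := by rw [sub_pos]; exact_mod_cast hl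
  have hdK : (0 : ℝ) < K.descFactorial j := by exact_mod_cast Nat.descFactorial_pos.2 hj.le
  have hdL : (0 : ℝ) < L.descFactorial l := by exact_mod_cast Nat.descFactorial_pos.2 hl.le
  have hdN : (0 : ℝ) < (K + L).descFactorial (j + l) := by
    exact_mod_cast Nat.descFactorial_pos.2 (by omega : j + l ≤ K + L)
  have hratio : ((K + L - (j + l)).choose (K - j) : ℝ) * (K + L).descFactorial (j + l)
      = (K + L).choose K * (K.descFactorial j * L.descFactorial l) := by
    have h1 : (K - j).factorial * K.descFactorial j = K.factorial :=
      Nat.factorial_mul_descFactorial hj.le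
    have h2 : (L - l).factorial * L.descFactorial l = L.factorial :=
      Nat.factorial_mul_descFactorial hl.le
    have h3 : (K + L - (j + l)).factorial * (K + L).descFactorial (j + l) = (K + L).factorial :=
      Nat.factorial_mul_descFactorial (by omega)
    have h4 : (K + L).choose K * K.factorial * L.factorial = (K + L).factorial := by
      have := Nat.choose_mul_factorial_mul_factorial (Nat.le_add_right K L)
      rwa [Nat.add_sub_cancel_left] at this
    have h5 : (K + L - (j + l)).choose (K - j) * (K - j).factorial * (L - l).factorial
        = (K + L - (j + l)).factorial := by
      have := Nat.choose_mul_factorial_mul_factorial (by omega : K - j ≤ K + L - (j + l))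
      rwa [(by omega : K + L - (j + l) - (K - j) = L - l)] at this
    have h6 : 0 < (K - j).factorial * (L - l).factorial :=
      Nat.mul_pos (Nat.factorial_pos _) (Nat.factorial_pos _)
    have : (K + L - (j + l)).choose (K - j) * (K + L).descFactorial (j + l)
        = (K + L).choose K * (K.descFactorial j * L.descFactorial l) := by
      refine Nat.eq_of_mul_eq_mul_left h6 ?_
      calc _ = (K + L - (j + l)).choose (K - j) * (K - j).factorial * (L - l).factorial
            * (K + L).descFactorial (j + l) := by ring
        _ = (K + L).choose K * ((K - j).factorial * K.descFactorial j)
            * ((L - l).factorial * L.descFactorial l) := by rw [h5, h3, h1, h2, h4]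
        _ = _ := by ring
    exact_mod_cast this
  have hx : (0 : ℝ) < 1 - j / K := by rw [sub_pos, div_lt_one hK]; exact_mod_cast hj
  have hy : (0 : ℝ) < 1 - l / L := by rw [sub_pos, div_lt_one hL]; exact_mod_cast hl
  have hlog : Real.log (K.descFactorial j * L.descFactorial l * √((1 - j / K) * (1 - l / L)))
      ≤ Real.log ((K + L).descFactorial (j + l)
          * ((K / (K + L) : ℝ) ^ j * (L / (K + L) : ℝ) ^ l)) := by
    rw [Real.log_mul (by positivity) (Real.sqrt_pos.2 (by positivity)).ne',
      Real.log_mul hdK.ne' hdL.ne', Real.log_sqrt (by positivity), Real.log_mul hx.ne' hy.ne',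
      Real.log_mul hdN.ne' (by positivity), Real.log_mul (by positivity) (by positivity),
      Real.log_pow, Real.log_pow, Real.log_div hK.ne' (by positivity),
      Real.log_div hL.ne' (by positivity), one_sub_div hK.ne', one_sub_div hL.ne',
      Real.log_div hKj.ne' hK.ne', Real.log_div hLl.ne' hL.ne']
    have h1 := log_descFactorial_le hj
    have h2 := log_descFactorial_le hl
    have h3 := le_log_descFactorial (by omega : j + l ≤ K + L)
    have h4 := log_sum_le hKj hLl hK hL
    have h5 : ((K + L : ℕ) : ℝ) - (j + l : ℕ) = (K - j) + (L - l) := by push_cast; ring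
    rw [h5] at h3
    push_cast at h3
    linarith
  have hmain := (Real.log_le_log_iff (mul_pos (mul_pos hdK hdL) (Real.sqrt_pos.2 (by positivity)))
    (by positivity)).1 hlog
  refine le_of_mul_le_mul_right ?_ hdN
  calc _ = ((K + L - (j + l)).choose (K - j) : ℝ) * (K + L).descFactorial (j + l)
        * √((1 - j / K) * (1 - l / L)) := by ring
    _ = (K + L).choose K * (K.descFactorial j * L.descFactorial l
        * √((1 - j / K) * (1 - l / L))) := by rw [hratio]; ring
    _ ≤ (K + L).choose K * ((K + L).descFactorial (j + l)
          * ((K / (K + L) : ℝ) ^ j * (L / (K + L) : ℝ) ^ l)) := by gcongr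
    _ = _ := by ring

/-! ### Uniformly random sets of fixed size -/

section Sets

variable {α : Type*} [Fintype α] [DecidableEq α]

open Finset in
theorem card_filter_inter_eq (A T : Finset α) (hT : T ⊆ A) {κ : ℕ} (hκ : T.card ≤ κ) :
    ((powersetCard κ (univ : Finset α)).filter fun C => C ∩ A = T).card
      = (Fintype.card α - A.card).choose (κ - T.card) := by
  rw [← card_compl, ← card_powersetCard]
  refine card_nbij' (fun C => C \ A) (fun D => D ∪ T) ?_ ?_ ?_ ?_
  · intro C hC
    simp only [coe_filter, mem_powersetCard, Set.mem_ofPred_eq] at hC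
    simp only [mem_coe, mem_powersetCard]
    refine ⟨fun x hx => by simp at hx ⊢; exact hx.2, ?_⟩
    have := card_sdiff_add_card_inter C A
    rw [hC.2, hC.1.2] at this
    omega
  · intro D hD
    simp only [mem_coe, mem_powersetCard] at hD
    have hdis : Disjoint D A := disjoint_left.2 fun x hx hxA => by
      simpa [hxA] using hD.1 hx
    simp only [coe_filter, mem_powersetCard, Set.mem_ofPred_eq]
    refine ⟨⟨subset_univ _, ?_⟩, ?_⟩
    · rw [card_union_of_disjoint (disjoint_of_subset_right hT hdis), hD.2]
      omega
    · rw [union_inter_distrib_right, disjoint_iff_inter_eq_empty.1 hdis, empty_union,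
        inter_eq_left.2 hT]
  · intro C hC
    simp only [coe_filter, mem_powersetCard, Set.mem_ofPred_eq] at hC
    change C \ A ∪ T = C
    rw [← hC.2, sdiff_union_inter]
  · intro D hD
    simp only [mem_coe, mem_powersetCard] at hD
    have hdis : Disjoint D A := disjoint_left.2 fun x hx hxA => by
      simpa [hxA] using hD.1 hx
    change (D ∪ T) \ A = D
    rw [union_sdiff_distrib, sdiff_eq_empty_iff_subset.2 hT, union_empty,
      sdiff_eq_self_of_disjoint hdis]

open Finset in
theorem sum_card_inter (A : Finset α) {κ : ℕ} (hκ : 0 < κ) :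
    Fintype.card α * ∑ C ∈ powersetCard κ (univ : Finset α), (C ∩ A).card
      = A.card * κ * (Fintype.card α).choose κ := by
  have h1 : ∑ C ∈ powersetCard κ (univ : Finset α), (C ∩ A).card
      = A.card * (Fintype.card α - 1).choose (κ - 1) := by
    simp_rw [inter_comm _ A, card_eq_sum_ones, ← filter_mem_eq_inter, sum_filter]
    rw [sum_comm, sum_mul]
    refine sum_congr rfl fun a _ => ?_
    have := card_filter_inter_eq {a} {a} (subset_refl _) (κ := κ)
      (by rw [card_singleton]; exact hκ)
    rw [card_singleton] at this
    rw [one_mul, ← this, card_filter]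
    refine sum_congr rfl fun C _ => ?_
    by_cases h : a ∈ C <;> simp [h, inter_singleton_of_mem, inter_singleton_of_notMem]
  rw [h1]
  rcases Nat.eq_zero_or_pos (Fintype.card α) with h0 | h0
  · rw [h0, Nat.choose_eq_zero_of_lt hκ]; simp
  · obtain ⟨m, hm⟩ := Nat.exists_eq_succ_of_ne_zero h0.ne'
    obtain ⟨t, rfl⟩ := Nat.exists_eq_succ_of_ne_zero hκ.ne'
    rw [hm]
    have := Nat.add_one_mul_choose_eq m t
    simp only [Nat.succ_eq_add_one, Nat.add_sub_cancel]
    linear_combination A.card * this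

open Finset in
theorem sum_card_inter_sq_le (A : Finset α) {κ : ℕ} (hκ : 2 ≤ κ) (hα : 2 ≤ Fintype.card α) :
    (∑ C ∈ powersetCard κ (univ : Finset α), ((C ∩ A).card : ℝ) ^ 2)
      ≤ (κ * A.card / Fintype.card α + (κ * A.card / Fintype.card α) ^ 2)
        * (Fintype.card α).choose κ := by
  set m := Fintype.card α with hm
  have hAm : A.card ≤ m := card_le_univ A
  have hpair : ∑ C ∈ powersetCard κ (univ : Finset α), ((C ∩ A).card : ℝ) ^ 2
      = (∑ C ∈ powersetCard κ (univ : Finset α), ((C ∩ A).card : ℝ))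
        + ∑ C ∈ powersetCard κ (univ : Finset α), (((C ∩ A).offDiag).card : ℝ) := by
    rw [← sum_add_distrib]
    refine sum_congr rfl fun C _ => ?_
    rw [offDiag_card, Nat.cast_sub (Nat.le_mul_self _)]
    push_cast; ring
  have hfirst : (∑ C ∈ powersetCard κ (univ : Finset α), ((C ∩ A).card : ℝ))
      = κ * A.card / m * m.choose κ := by
    have h := sum_card_inter A (by omega : 0 < κ)
    have h' : (m : ℝ) * ∑ C ∈ powersetCard κ (univ : Finset α), ((C ∩ A).card : ℝ)
        = A.card * κ * m.choose κ := by exact_mod_cast h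
    have hm0 : (m : ℝ) ≠ 0 := by exact_mod_cast (by omega : m ≠ 0)
    field_simp
    linarith
  have hsecond : ∑ C ∈ powersetCard κ (univ : Finset α), (((C ∩ A).offDiag).card : ℝ)
      ≤ (κ * A.card / m) ^ 2 * m.choose κ := by
    have hcount : ∑ C ∈ powersetCard κ (univ : Finset α), ((C ∩ A).offDiag).card
        ≤ A.offDiag.card * (m - 2).choose (κ - 2) := by
      have h1 : ∀ C : Finset α, (C ∩ A).offDiag
          = A.offDiag.filter fun ab => ab.1 ∈ C ∧ ab.2 ∈ C := by
        intro C; ext ⟨a, b⟩; simp; tauto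
      simp_rw [h1, card_filter]
      rw [sum_comm, ← smul_eq_mul, ← sum_const]
      refine sum_le_sum fun ab hab => ?_
      obtain ⟨-, -, hne⟩ := mem_offDiag.1 hab
      rw [← card_filter]
      have := card_filter_inter_eq {ab.1, ab.2} {ab.1, ab.2} (subset_refl _) (κ := κ)
        (by rwa [card_pair hne])
      rw [card_pair hne] at this
      rw [← this]
      refine card_le_card fun C hC => ?_
      simp only [mem_filter] at hC ⊢
      refine ⟨hC.1, inter_eq_right.2 ?_⟩
      intro x hx; simp at hx; rcases hx with rfl | rfl <;> tauto
    have hcount' : ∑ C ∈ powersetCard κ (univ : Finset α), (((C ∩ A).offDiag).card : ℝ)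
        ≤ A.offDiag.card * (m - 2).choose (κ - 2) := by exact_mod_cast hcount
    refine hcount'.trans ?_
    obtain ⟨s, rfl⟩ : ∃ s, κ = s + 2 := ⟨κ - 2, by omega⟩
    obtain ⟨r, hr⟩ : ∃ r, m = r + 2 := ⟨m - 2, by omega⟩
    have hchoose : ((s : ℝ) + 2) * (s + 1) * (m.choose (s + 2) : ℝ)
        = (r + 2) * (r + 1) * (r.choose s : ℝ) := by
      have e1 : (((r + 1 + 1) * (r + 1).choose (s + 1) : ℕ) : ℝ)
          = ((r + 1 + 1).choose (s + 1 + 1) * (s + 1 + 1) : ℕ) := by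
        rw [Nat.add_one_mul_choose_eq]
      have e2 : (((r + 1) * r.choose s : ℕ) : ℝ) = ((r + 1).choose (s + 1) * (s + 1) : ℕ) := by
        rw [Nat.add_one_mul_choose_eq]
      push_cast at e1 e2
      rw [hr]
      linear_combination (-(s : ℝ) - 1) * e1 - ((r : ℝ) + 2) * e2
    have hval : (r.choose s : ℝ)
        = ((s : ℝ) + 2) * (s + 1) / ((r + 2) * (r + 1)) * m.choose (s + 2) := by
      field_simp
      linarith
    have hoff : (A.offDiag.card : ℝ) = A.card * (A.card - 1) := by
      rw [offDiag_card, Nat.cast_sub (Nat.le_mul_self _)]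
      push_cast; ring
    have hA : (A.card : ℝ) ≤ r + 2 := by
      have : (A.card : ℝ) ≤ m := by exact_mod_cast hAm
      rw [hr] at this; push_cast at this; exact this
    have hA0 : (0 : ℝ) ≤ A.card := by positivity
    have hr0 : (0 : ℝ) ≤ r := by positivity
    have hs0 : (0 : ℝ) ≤ s := by positivity
    rw [hoff, hr, Nat.add_sub_cancel, Nat.add_sub_cancel, hval, ← mul_assoc, ← hr]
    gcongr
    rw [hr]
    push_cast
    rw [← mul_div_assoc, div_pow, div_le_div_iff₀ (by positivity) (by positivity)]
    have h1 : ((A.card : ℝ) - 1) * (r + 2) ≤ A.card * (r + 1) := by linarith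
    have h2 : ((A.card : ℝ) - 1) * (r + 2) * (s + 1) ≤ A.card * (r + 1) * (s + 2) :=
      mul_le_mul h1 (by linarith) (by linarith) (by positivity)
    calc (A.card : ℝ) * (A.card - 1) * ((s + 2) * (s + 1)) * (r + 2) ^ 2
        = A.card * (s + 2) * (r + 2) * ((A.card - 1) * (r + 2) * (s + 1)) := by ring
      _ ≤ A.card * (s + 2) * (r + 2) * (A.card * (r + 1) * (s + 2)) := by gcongr
      _ = _ := by ring
  rw [hpair, hfirst, add_mul]
  gcongr

open Finset in
/-- Markov's inequality for the size of the trace of a uniformly random `κ`-set. -/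
theorem card_filter_lt_card_inter_le (A : Finset α) {κ : ℕ} (hκ : 0 < κ)
    (hα : 0 < Fintype.card α) {t : ℝ} (ht : 0 < t) :
    (((powersetCard κ (univ : Finset α)).filter fun C => t < (C ∩ A).card).card : ℝ)
      ≤ κ * A.card / Fintype.card α / t * (Fintype.card α).choose κ := by
  have h := sum_card_inter A hκ
  have h' : (Fintype.card α : ℝ) * ∑ C ∈ powersetCard κ (univ : Finset α), ((C ∩ A).card : ℝ)
      = A.card * κ * (Fintype.card α).choose κ := by exact_mod_cast h
  have hm0 : (0 : ℝ) < Fintype.card α := by exact_mod_cast hα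
  have h1 : (((powersetCard κ (univ : Finset α)).filter fun C => t < (C ∩ A).card).card : ℝ) * t
      ≤ ∑ C ∈ powersetCard κ (univ : Finset α), ((C ∩ A).card : ℝ) := by
    rw [← nsmul_eq_mul, ← sum_const]
    refine (sum_le_sum fun C hC => (mem_filter.1 hC).2.le).trans ?_
    exact sum_le_sum_of_subset_of_nonneg (filter_subset _ _) fun _ _ _ => by positivity
  have h2 : ∑ C ∈ powersetCard κ (univ : Finset α), ((C ∩ A).card : ℝ)
      = κ * A.card / Fintype.card α * (Fintype.card α).choose κ := by
    field_simp
    linarith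
  rw [div_mul_eq_mul_div, le_div_iff₀ ht, ← h2]
  exact h1

open Finset in
/-- Chebyshev's inequality for the size of the trace of a uniformly random `κ`-set. -/
theorem card_filter_card_inter_lt_le (A : Finset α) {κ k : ℕ} (hκ : 2 ≤ κ)
    (hα : 2 ≤ Fintype.card α) (hk : 0 < k) (hl : 2 * (k : ℝ) ≤ κ * A.card / Fintype.card α) :
    (((powersetCard κ (univ : Finset α)).filter fun C => (C ∩ A).card < k).card : ℝ)
      ≤ 4 / (κ * A.card / Fintype.card α) * (Fintype.card α).choose κ := by
  have hm0 : (0 : ℝ) < Fintype.card α := by exact_mod_cast (by omega : 0 < Fintype.card α)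
  have h := sum_card_inter A (by omega : 0 < κ)
  have h' : (Fintype.card α : ℝ) * ∑ C ∈ powersetCard κ (univ : Finset α), ((C ∩ A).card : ℝ)
      = A.card * κ * (Fintype.card α).choose κ := by exact_mod_cast h
  have h2 : ∑ C ∈ powersetCard κ (univ : Finset α), ((C ∩ A).card : ℝ)
      = κ * A.card / Fintype.card α * (Fintype.card α).choose κ := by
    field_simp
    linarith
  have hsq := sum_card_inter_sq_le A hκ hα
  set l : ℝ := κ * A.card / Fintype.card α with hldef
  set W : ℝ := ((Fintype.card α).choose κ : ℝ) with hW
  have hk0 : (0 : ℝ) < k := by exact_mod_cast hk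
  have hl0 : 0 < l := by linarith
  have hcard : ∑ _C ∈ powersetCard κ (univ : Finset α), (1 : ℝ) = W := by
    simp [hW]
  have hvar : ∑ C ∈ powersetCard κ (univ : Finset α), (((C ∩ A).card : ℝ) - l) ^ 2 ≤ l * W := by
    have : ∀ C : Finset α, (((C ∩ A).card : ℝ) - l) ^ 2
        = ((C ∩ A).card : ℝ) ^ 2 - 2 * l * (C ∩ A).card + l ^ 2 * 1 := fun C => by ring
    simp_rw [this]
    rw [sum_add_distrib, sum_sub_distrib, ← mul_sum, ← mul_sum, h2, hcard]
    linarith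
  have hche : (((powersetCard κ (univ : Finset α)).filter fun C => (C ∩ A).card < k).card : ℝ)
      * (l / 2) ^ 2 ≤ ∑ C ∈ powersetCard κ (univ : Finset α), (((C ∩ A).card : ℝ) - l) ^ 2 := by
    rw [← nsmul_eq_mul, ← sum_const]
    refine (sum_le_sum fun C hC => ?_).trans
      (sum_le_sum_of_subset_of_nonneg (filter_subset _ _) fun _ _ _ => sq_nonneg _)
    have hC : ((C ∩ A).card : ℝ) < k := by exact_mod_cast (mem_filter.1 hC).2
    nlinarith
  have := hche.trans hvar
  rw [div_mul_eq_mul_div, le_div_iff₀ hl0]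
  refine le_of_mul_le_mul_right ?_ (by positivity : 0 < l / 4)
  linarith

open Finset in
/-- The number of `κ`-sets with prescribed traces on `A` and `B`, relative to the number of those with
the given trace on `A` alone. -/
theorem card_traces_le {A B S J : Finset α} (hAB : Disjoint A B) {κ : ℕ} {η : ℝ} (hη0 : 0 < η)
    (hη1 : η < 1) (hgap : (0 : ℝ) < Fintype.card α - A.card - κ)
    (hBη : (B.card : ℝ) ≤ η * (Fintype.card α - A.card - κ : ℝ)) (hκ0 : (0 : ℝ) < κ)
    (hS : S ⊆ A) (hJ : J ⊆ B) (hSκ2 : 2 * S.card ≤ κ)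
    (hJη : (J.card : ℝ) ≤ η * κ / 2) :
    (((powersetCard κ (univ : Finset α)).filter fun C => (C ∩ A, C ∩ B) = (S, J)).card : ℝ)
      ≤ (Fintype.card α - A.card).choose (κ - S.card) / (1 - η)
        * (((κ - S.card : ℝ) / (Fintype.card α - A.card)) ^ J.card
          * (1 - (κ - S.card : ℝ) / (Fintype.card α - A.card)) ^ (B.card - J.card)) := by
  set m := Fintype.card α with hm
  set 𝒞 := powersetCard κ (univ : Finset α) with h𝒞
  set p : ℝ := (κ - S.card : ℝ) / (m - A.card)
  have hgapN : A.card + κ ≤ m := by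
    have : ((A.card + κ : ℕ) : ℝ) ≤ m := by push_cast; linarith
    exact_mod_cast this
  have hSc : (2 : ℝ) * S.card ≤ κ := by exact_mod_cast hSκ2
  have hSκ : S.card ≤ κ := by omega
  have hmA : ((m - A.card : ℕ) : ℝ) = m - A.card := Nat.cast_sub (by omega)
  have hκS : ((κ - S.card : ℕ) : ℝ) = κ - S.card := Nat.cast_sub hSκ
  have hNK : m - A.card = (κ - S.card) + (m - A.card - (κ - S.card)) := by omega
  set K := κ - S.card with hK
  set L := m - A.card - K with hL
  have hKL : (K : ℝ) + L = m - A.card := by rw [← hmA]; exact_mod_cast hNK.symm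
  have hK0 : (κ : ℝ) / 2 ≤ K := by rw [hκS]; linarith
  have hKpos : (0 : ℝ) < K := by linarith
  have hLm : (m : ℝ) - A.card - κ ≤ L := by
    linarith [(Nat.cast_nonneg S.card : (0 : ℝ) ≤ S.card)]
  have hLpos : (0 : ℝ) < L := by linarith [hgap]
  have hpS : p = K / (K + L) := by rw [hKL, hκS]
  have hqS : 1 - p = L / (K + L) := by
    rw [hpS, one_sub_div (by linarith), add_sub_cancel_left]
  have hJB : J.card ≤ B.card := card_le_card hJ
  have hJK : (J.card : ℝ) ≤ η * K := by
    refine hJη.trans ?_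
    rw [mul_div_assoc]
    gcongr
  have hlL : ((B.card - J.card : ℕ) : ℝ) ≤ η * L := by
    refine (Nat.cast_le.2 (Nat.sub_le _ _)).trans (hBη.trans ?_)
    gcongr
  have hj : J.card < K := by
    have : (J.card : ℝ) < K := hJK.trans_lt (mul_lt_of_lt_one_left hKpos hη1)
    exact_mod_cast this
  have hlt : B.card - J.card < L := by
    have : ((B.card - J.card : ℕ) : ℝ) < L :=
      hlL.trans_lt (mul_lt_of_lt_one_left hLpos hη1)
    exact_mod_cast this
  have hcount : (𝒞.filter fun C => (C ∩ A, C ∩ B) = (S, J)).card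
      = (m - A.card - B.card).choose (K - J.card) := by
    have hST : S ∪ J ⊆ A ∪ B := union_subset_union hS hJ
    have hdis : Disjoint S J := disjoint_of_subset_left hS (disjoint_of_subset_right hJ hAB)
    have hc := card_filter_inter_eq (A ∪ B) (S ∪ J) hST (κ := κ) (by
      rw [card_union_of_disjoint hdis]; omega)
    rw [card_union_of_disjoint hdis, card_union_of_disjoint hAB, ← hm, ← Nat.sub_sub,
      ← Nat.sub_sub] at hc
    rw [← hc]
    congr 1
    refine filter_congr fun C _ => ?_
    rw [Prod.mk.injEq, inter_union_distrib_left]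
    constructor
    · rintro ⟨rfl, rfl⟩; rfl
    · intro h
      constructor
      · have := congrArg (· ∩ A) h
        simp only [union_inter_distrib_right] at this
        rwa [inter_assoc, inter_self, inter_assoc, inter_comm B A,
          disjoint_iff_inter_eq_empty.1 hAB, inter_empty, union_empty, inter_eq_left.2 hS,
          disjoint_iff_inter_eq_empty.1 (disjoint_of_subset_left hJ hAB.symm),
          union_empty] at this
      · have := congrArg (· ∩ B) h
        simp only [union_inter_distrib_right] at this
        rwa [inter_assoc, disjoint_iff_inter_eq_empty.1 hAB, inter_empty, empty_union,
          inter_assoc, inter_self, inter_eq_left.2 hJ,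
          disjoint_iff_inter_eq_empty.1 (disjoint_of_subset_left hS hAB),
          empty_union] at this
  have hch := choose_mul_sqrt_le hj hlt
  rw [Nat.add_sub_cancel' hJB, ← hNK] at hch
  have hsq : 1 - η ≤ √((1 - J.card / K) * (1 - (B.card - J.card : ℕ) / L)) := by
    refine Real.le_sqrt_of_sq_le ?_
    rw [sq]
    have h1 : 1 - η ≤ 1 - J.card / K := by
      have : (J.card : ℝ) / K ≤ η := (div_le_iff₀ hKpos).2 hJK
      linarith
    have h2 : 1 - η ≤ 1 - (B.card - J.card : ℕ) / L := by
      have : ((B.card - J.card : ℕ) : ℝ) / L ≤ η := (div_le_iff₀ hLpos).2 hlL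
      linarith
    exact mul_le_mul h1 h2 (by linarith) (by linarith)
  rw [hcount, div_mul_eq_mul_div, le_div_iff₀ (by linarith), hqS, hpS]
  refine le_trans ?_ hch
  gcongr

open Finset in
/-- Let `C` be a uniformly random `κ`-set, and `A`, `B` disjoint sets. If `B` is small, then given the
trace `S = C ∩ A` the set `C ∩ B` is nearly distributed as a binomial random subset of `B`. Hence an
average of `g (C ∩ A) (C ∩ B)` is controlled by averages over binomial subsets, up to the
probabilities of atypical sizes of the two traces. -/
theorem sum_clique_le {A B : Finset α} (hAB : Disjoint A B) {κ k : ℕ} (hκ : 2 ≤ κ) (hk : 0 < k)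
    (hl : 2 * (k : ℝ) ≤ κ * A.card / Fintype.card α) {η e : ℝ} (hη0 : 0 < η) (hη1 : η < 1)
    (he : 0 ≤ e) (hB : 0 < B.card)
    (hBη : (B.card : ℝ) ≤ η * (Fintype.card α - A.card - κ : ℝ))
    (g : Finset α → Finset α → ℝ) (hg0 : ∀ S J, 0 ≤ g S J) (hg1 : ∀ S J, g S J ≤ 1)
    (hg : ∀ S ⊆ A, k ≤ S.card → 2 * S.card ≤ κ →
      ∑ J ∈ B.powerset,
        ((κ - S.card : ℝ) / (Fintype.card α - A.card)) ^ J.card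
          * (1 - (κ - S.card : ℝ) / (Fintype.card α - A.card)) ^ (B.card - J.card) * g S J ≤ e) :
    ∑ C ∈ powersetCard κ (univ : Finset α), g (C ∩ A) (C ∩ B)
      ≤ (e / (1 - η) + 2 * A.card / Fintype.card α + 2 * B.card / (η * Fintype.card α)
          + 4 / (κ * A.card / Fintype.card α)) * (Fintype.card α).choose κ := by
  set m := Fintype.card α with hm
  have hκ0 : (0 : ℝ) < κ := by exact_mod_cast (by omega : 0 < κ)
  have hB0 : (0 : ℝ) < B.card := by exact_mod_cast hB
  have hgap : (0 : ℝ) < m - A.card - κ := by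
    by_contra hcon
    have := mul_nonpos_of_nonneg_of_nonpos hη0.le (not_lt.1 hcon)
    linarith
  have hA0 : (0 : ℝ) ≤ A.card := by positivity
  have hgapN : A.card + κ < m := by
    have : ((A.card + κ : ℕ) : ℝ) < m := by push_cast; linarith
    exact_mod_cast this
  have hm2 : 2 ≤ m := by omega
  have hABm : A.card + B.card ≤ m := by
    rw [← card_union_of_disjoint hAB]; exact card_le_univ _
  set 𝒞 := powersetCard κ (univ : Finset α) with h𝒞
  set good : Finset α → Prop := fun C =>
    k ≤ (C ∩ A).card ∧ 2 * (C ∩ A).card ≤ κ ∧ ((C ∩ B).card : ℝ) ≤ η * κ / 2 with hgood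
  -- atypical sets
  have hbad : ∀ C, (if good C then (0 : ℝ) else 1) ≤ (if (C ∩ A).card < k then 1 else 0)
      + (if (κ / 2 : ℝ) < (C ∩ A).card then 1 else 0)
      + (if η * κ / 2 < (C ∩ B).card then 1 else 0) := by
    intro C
    by_cases h1 : (C ∩ A).card < k
    · rw [if_pos h1]; split_ifs <;> norm_num
    by_cases h2 : (κ / 2 : ℝ) < (C ∩ A).card
    · rw [if_pos h2]; split_ifs <;> norm_num
    by_cases h3 : η * κ / 2 < (C ∩ B).card
    · rw [if_pos h3]; split_ifs <;> norm_num
    have : good C := by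
      refine ⟨not_lt.1 h1, ?_, not_lt.1 h3⟩
      have : 2 * ((C ∩ A).card : ℝ) ≤ κ := by linarith [not_lt.1 h2]
      exact_mod_cast this
    rw [if_pos this]; split_ifs; norm_num
  have hbadsum : ∑ C ∈ 𝒞, (if good C then (0 : ℝ) else 1)
      ≤ (2 * A.card / m + 2 * B.card / (η * m) + 4 / (κ * A.card / m)) * m.choose κ := by
    have b1 := card_filter_card_inter_lt_le A hκ hm2 hk hl
    have b2 := card_filter_lt_card_inter_le A (by omega : 0 < κ) (by omega : 0 < Fintype.card α)
      (t := κ / 2) (by positivity)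
    have b3 := card_filter_lt_card_inter_le B (by omega : 0 < κ) (by omega : 0 < Fintype.card α)
      (t := η * κ / 2) (by positivity)
    rw [card_filter, Nat.cast_sum] at b1 b2 b3
    simp only [Nat.cast_ite, Nat.cast_one, Nat.cast_zero] at b1 b2 b3
    refine (sum_le_sum fun C _ => hbad C).trans ?_
    rw [sum_add_distrib, sum_add_distrib]
    refine (add_le_add (add_le_add b1 b2) b3).trans (le_of_eq ?_)
    have hm0 : (0 : ℝ) < m := by exact_mod_cast (by omega : 0 < m)
    rw [← hm, add_mul, add_mul]
    have e1 : κ * (A.card : ℝ) / m / (κ / 2) = 2 * A.card / m := by field_simp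
    have e2 : κ * (B.card : ℝ) / m / (η * κ / 2) = 2 * B.card / (η * m) := by field_simp
    rw [e1, e2]; ring
  -- typical sets, grouped according to their traces
  have hmain : ∑ C ∈ 𝒞, (if good C then g (C ∩ A) (C ∩ B) else 0)
      ≤ e / (1 - η) * m.choose κ := by
    let f : Finset α × Finset α → ℝ := fun SJ =>
      if k ≤ SJ.1.card ∧ 2 * SJ.1.card ≤ κ ∧ (SJ.2.card : ℝ) ≤ η * κ / 2 then g SJ.1 SJ.2 else 0
    have hmaps : ∀ C ∈ 𝒞, (C ∩ A, C ∩ B) ∈ A.powerset ×ˢ B.powerset := fun C _ => by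
      simp [inter_subset_right]
    have hfib : ∀ SJ : Finset α × Finset α,
        ∑ C ∈ 𝒞 with (C ∩ A, C ∩ B) = SJ, f (C ∩ A, C ∩ B)
          = (𝒞.filter fun C => (C ∩ A, C ∩ B) = SJ).card * f SJ := fun SJ => by
      rw [← nsmul_eq_mul, ← sum_const]
      exact sum_congr rfl fun C hC => by rw [(mem_filter.1 hC).2]
    let p : Finset α → ℝ := fun S => (κ - S.card : ℝ) / (m - A.card)
    have hterm : ∀ S ⊆ A, ∀ J ⊆ B, (𝒞.filter fun C => (C ∩ A, C ∩ B) = (S, J)).card * f (S, J)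
        ≤ if k ≤ S.card ∧ 2 * S.card ≤ κ then (m - A.card).choose (κ - S.card) / (1 - η)
            * (p S ^ J.card * (1 - p S) ^ (B.card - J.card) * g S J) else 0 := by
      intro S hS J hJ
      by_cases hgS : k ≤ S.card ∧ 2 * S.card ≤ κ
      swap
      · have : f (S, J) = 0 := if_neg fun h => hgS ⟨h.1, h.2.1⟩
        rw [this, mul_zero, if_neg hgS]
      rw [if_pos hgS]
      have hSc : (2 : ℝ) * S.card ≤ κ := by exact_mod_cast hgS.2
      have hSκ : S.card ≤ κ := by omega
      have hden : (0 : ℝ) < m - A.card := by linarith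
      have hp0 : 0 ≤ p S := div_nonneg (by linarith) hden.le
      have hp1 : 0 ≤ 1 - p S := by
        have : (0 : ℝ) ≤ S.card := by positivity
        rw [sub_nonneg, div_le_one hden]
        linarith
      have hnn : 0 ≤ ((m - A.card).choose (κ - S.card) : ℝ) / (1 - η)
          * (p S ^ J.card * (1 - p S) ^ (B.card - J.card) * g S J) := by
        have : 0 ≤ 1 - η := by linarith
        have := hg0 S J
        positivity
      by_cases hJη : (J.card : ℝ) ≤ η * κ / 2
      swap
      · have : f (S, J) = 0 := if_neg fun h => hJη h.2.2
        rw [this, mul_zero]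
        exact hnn
      have h := card_traces_le hAB hη0 hη1 hgap hBη hκ0 hS hJ hgS.2 hJη
      rw [show f (S, J) = g S J from if_pos ⟨hgS.1, hgS.2, hJη⟩, ← mul_assoc]
      exact mul_le_mul_of_nonneg_right h (hg0 S J)
    have hpow : ∑ S ∈ A.powerset, (if k ≤ S.card ∧ 2 * S.card ≤ κ
        then (((m - A.card).choose (κ - S.card) : ℕ) : ℝ) else 0) ≤ m.choose κ := by
      have h1 : m.choose κ = ∑ S ∈ A.powerset, (𝒞.filter fun C => C ∩ A = S).card := by
        rw [← card_eq_sum_card_fiberwise fun C _ => by simp, h𝒞,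
          card_powersetCard, card_univ]
      rw [h1]
      push_cast
      refine sum_le_sum fun S hS => ?_
      split_ifs with h
      · rw [card_filter_inter_eq A S (mem_powerset.1 hS) (by omega : S.card ≤ κ)]
      · positivity
    calc ∑ C ∈ 𝒞, (if good C then g (C ∩ A) (C ∩ B) else 0)
        = ∑ C ∈ 𝒞, f (C ∩ A, C ∩ B) := rfl
      _ = ∑ S ∈ A.powerset, ∑ J ∈ B.powerset,
            (𝒞.filter fun C => (C ∩ A, C ∩ B) = (S, J)).card * f (S, J) := by
          rw [← sum_fiberwise_of_maps_to hmaps, sum_product]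
          simp only [hfib]
      _ ≤ ∑ S ∈ A.powerset, ∑ J ∈ B.powerset,
            (if k ≤ S.card ∧ 2 * S.card ≤ κ then (m - A.card).choose (κ - S.card) / (1 - η)
              * (p S ^ J.card * (1 - p S) ^ (B.card - J.card) * g S J) else 0) :=
          sum_le_sum fun S hS => sum_le_sum fun J hJ =>
            hterm S (mem_powerset.1 hS) J (mem_powerset.1 hJ)
      _ ≤ ∑ S ∈ A.powerset, (if k ≤ S.card ∧ 2 * S.card ≤ κ
            then (((m - A.card).choose (κ - S.card) : ℕ) : ℝ) else 0) * (e / (1 - η)) := by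
          refine sum_le_sum fun S hS => ?_
          split_ifs with h
          · rw [← mul_sum, div_mul_eq_mul_div, mul_div_assoc']
            have : 0 < 1 - η := by linarith
            gcongr
            exact hg S (mem_powerset.1 hS) h.1 h.2
          · simp
      _ ≤ m.choose κ * (e / (1 - η)) := by
          rw [← sum_mul]
          have : 0 < 1 - η := by linarith
          gcongr
      _ = _ := mul_comm _ _
  calc ∑ C ∈ 𝒞, g (C ∩ A) (C ∩ B)
      ≤ ∑ C ∈ 𝒞, ((if good C then g (C ∩ A) (C ∩ B) else 0) + (if good C then (0 : ℝ) else 1)) := by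
        refine sum_le_sum fun C _ => ?_
        split_ifs
        · simp
        · simpa using hg1 _ _
    _ ≤ e / (1 - η) * m.choose κ
        + (2 * A.card / m + 2 * B.card / (η * m) + 4 / (κ * A.card / m)) * m.choose κ := by
        rw [sum_add_distrib]; exact add_le_add hmain hbadsum
    _ = _ := by ring

end Sets

/-! ### Uniform probabilities on finite sets -/

open Classical in
/-- The probability of an event under the uniform law on a finite type. -/
noncomputable def unifProb {Ω : Type*} [Fintype Ω] (A : Ω → Prop) : ℝ :=
  (∑ a, if A a then 1 else 0) / Fintype.card Ω

theorem unifProb_nonneg {Ω : Type*} [Fintype Ω] (A : Ω → Prop) : 0 ≤ unifProb A := by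
  unfold unifProb
  refine div_nonneg (Finset.sum_nonneg fun a _ => ?_) (Nat.cast_nonneg _)
  split_ifs <;> norm_num

theorem unifProb_le_one {Ω : Type*} [Fintype Ω] (A : Ω → Prop) : unifProb A ≤ 1 := by
  classical
  unfold unifProb
  refine div_le_one_of_le₀ ?_ (Nat.cast_nonneg _)
  calc (∑ a, if A a then (1 : ℝ) else 0) ≤ ∑ _a : Ω, (1 : ℝ) :=
        Finset.sum_le_sum fun a _ => by split_ifs <;> norm_num
    _ = _ := by simp

theorem unifProb_equiv {Ω Ω' : Type*} [Fintype Ω] [Fintype Ω'] (e : Ω ≃ Ω') (A : Ω' → Prop) :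
    unifProb (fun a => A (e a)) = unifProb A := by
  classical
  unfold unifProb
  rw [Fintype.card_congr e, ← e.sum_comp]

theorem unifProb_eq_true_add_false {Ω : Type*} [Fintype Ω] [Nonempty Ω] (f : Ω → Bool) :
    unifProb (fun a => f a = true) + unifProb (fun a => f a = false) = 1 := by
  classical
  unfold unifProb
  rw [← add_div, ← Finset.sum_add_distrib, div_eq_one_iff_eq (by simp)]
  rw [← Finset.card_univ, ← nsmul_one, ← Finset.sum_const]
  refine Finset.sum_congr rfl fun a _ => ?_
  rcases Bool.eq_false_or_eq_true (f a) with h | h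
  · rw [if_pos h, if_neg (by simp [h]), add_zero]
  · rw [if_neg (by simp [h]), if_pos h, zero_add]

theorem unifProb_fst {Ω Ω' : Type*} [Fintype Ω] [Fintype Ω'] [Nonempty Ω'] (A : Ω → Prop) :
    unifProb (fun a : Ω × Ω' => A a.1) = unifProb A := by
  classical
  unfold unifProb
  rw [Fintype.sum_prod_type, Fintype.card_prod]
  change (∑ a : Ω, ∑ _c : Ω', if A a then (1 : ℝ) else 0) / _ = _
  simp only [Finset.sum_const, Finset.card_univ, nsmul_eq_mul]
  rw [← Finset.mul_sum]
  push_cast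
  have : (Fintype.card Ω' : ℝ) ≠ 0 := by simp
  field_simp

/-- Distinct bits of a uniformly random bit string are again uniformly random. -/
theorem unifProb_comp_injective {I I' : Type*} [Fintype I] [Fintype I'] [DecidableEq I]
    [DecidableEq I'] {f : I → I'} (hf : Function.Injective f) (A : (I → Bool) → Prop) :
    unifProb (fun z : I' → Bool => A (z ∘ f)) = unifProb A := by
  classical
  let e : (I' → Bool) ≃ (I → Bool) × ({x // ¬ x ∈ Set.range f} → Bool) :=
    (Equiv.piEquivPiSubtypeProd (fun x => x ∈ Set.range f) fun _ => Bool).trans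
      (Equiv.prodCongr (Equiv.arrowCongr (Equiv.ofInjective f hf).symm (Equiv.refl Bool))
        (Equiv.refl _))
  have he : ∀ z, (e z).1 = z ∘ f := fun z => by
    funext i
    simp [e, Equiv.piEquivPiSubtypeProd, Equiv.arrowCongr]
  simp only [← he]
  rw [unifProb_equiv e (fun a => A a.1), unifProb_fst]

theorem map_uniform_apply {Ω : Type*} [Fintype Ω] [Nonempty Ω] {β : Type*} (f : Ω → β) (b : β) :
    ((PMF.uniformOfFintype Ω).map f) b = ENNReal.ofReal (unifProb fun a => f a = b) := by
  classical
  rw [PMF.map_apply, tsum_fintype, unifProb,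
    ENNReal.ofReal_div_of_pos (by exact_mod_cast Fintype.card_pos),
    ENNReal.ofReal_sum_of_nonneg fun a _ => by split_ifs <;> norm_num, div_eq_mul_inv,
    Finset.sum_mul]
  refine Finset.sum_congr rfl fun a _ => ?_
  by_cases h : f a = b
  · simp [h]
  · simp [h, Ne.symm h]

theorem bind_map_uniform_apply {Ω Ω' : Type*} [Fintype Ω] [Nonempty Ω] [Fintype Ω'] [Nonempty Ω']
    {β : Type*} (f : Ω → Ω' → β) (b : β) :
    ((PMF.uniformOfFintype Ω).bind fun a => (PMF.uniformOfFintype Ω').map (f a)) b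
      = ENNReal.ofReal (unifProb fun a : Ω × Ω' => f a.1 a.2 = b) := by
  classical
  have hpos : (0 : ℝ) < Fintype.card Ω := by exact_mod_cast Fintype.card_pos
  have hsplit : unifProb (fun a : Ω × Ω' => f a.1 a.2 = b)
      = ∑ a, (Fintype.card Ω : ℝ)⁻¹ * unifProb fun c => f a c = b := by
    unfold unifProb
    rw [Fintype.sum_prod_type, Fintype.card_prod, ← Finset.mul_sum, ← Finset.sum_div]
    push_cast
    field_simp
  rw [hsplit, ENNReal.ofReal_sum_of_nonneg fun a _ => mul_nonneg (by positivity)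
    (unifProb_nonneg _), PMF.bind_apply, tsum_fintype]
  refine Finset.sum_congr rfl fun a _ => ?_
  rw [map_uniform_apply, ENNReal.ofReal_mul (by positivity), ENNReal.ofReal_inv_of_pos hpos]
  simp

/-! ### The reduction from planted clique -/

/-- The bits consumed by a test run on a planted sample: one sign for each observation, one for each
entry, and `c` coins of the test. -/
abbrev SampleBits (d n c : ℕ) : Type := Fin n ⊕ (Fin n × Fin d) ⊕ Fin c

/-- The sample in which the observations in `J` are planted on the coordinates in `S`. -/
noncomputable def plantedSample {d n c : ℕ} (J : Finset (Fin n)) (S : Finset (Fin d))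
    (z : SampleBits d n c → Bool) (ij : Fin n × Fin d) : ℝ :=
  sgn (z (.inl ij.1)) * (if ij.1 ∈ J ∧ ij.2 ∈ S then 1 else sgn (z (.inr (.inl ij))))

/-- The probability that the program `Q` outputs `b` when the observations in `J` are planted on the
coordinates in `S`. -/
noncomputable def outputProb {d n : ℕ} (Q : RandProgram (Fin n × Fin d)) (b : Bool)
    (J : Finset (Fin n)) (S : Finset (Fin d)) : ℝ :=
  unifProb fun z : SampleBits d n Q.coins → Bool =>
    Q.output (plantedSample J S z) (fun l => z (.inr (.inr l))) = b

theorem outputProb_nonneg {d n : ℕ} (Q : RandProgram (Fin n × Fin d)) (b : Bool)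
    (J : Finset (Fin n)) (S : Finset (Fin d)) : 0 ≤ outputProb Q b J S := unifProb_nonneg _

theorem outputProb_le_one {d n : ℕ} (Q : RandProgram (Fin n × Fin d)) (b : Bool)
    (J : Finset (Fin n)) (S : Finset (Fin d)) : outputProb Q b J S ≤ 1 := unifProb_le_one _

theorem outputProb_true_add_false {d n : ℕ} (Q : RandProgram (Fin n × Fin d))
    (J : Finset (Fin n)) (S : Finset (Fin d)) :
    outputProb Q true J S + outputProb Q false J S = 1 :=
  unifProb_eq_true_add_false _

/-- The randomness of independent observations and of the test, split into the indicators of the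
planted observations and the remaining bits. -/
def obsEquiv (d n c : ℕ) :
    (Fin n → Obs d) × (Fin c → Bool) ≃ (Fin n → Bool) × (SampleBits d n c → Bool) where
  toFun a := (fun i => (a.1 i).1,
    Sum.elim (fun i => (a.1 i).2.1) (Sum.elim (fun ij => (a.1 ij.1).2.2 ij.2) a.2))
  invFun z := (fun i => (z.1 i, z.2 (.inl i), fun j => z.2 (.inr (.inl (i, j)))),
    fun l => z.2 (.inr (.inr l)))
  left_inv a := rfl
  right_inv z := by
    refine Prod.ext rfl (funext fun x => ?_)
    rcases x with i | ij | l <;> rfl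

theorem obsEquiv_symm_fst {d n c : ℕ} (β : Fin n → Bool) (z : SampleBits d n c → Bool) (i : Fin n) :
    ((obsEquiv d n c).symm (β, z)).1 i
      = (β i, z (.inl i), fun j => z (.inr (.inl (i, j)))) := rfl

/-- The test on a planted law, conditioned on the set `J` of planted observations. -/
theorem prob_plantedLaw (ψ : SPCTest) (d n k : ℕ) (S : Finset (Fin d)) {p : ℝ} (hp0 : 0 ≤ p)
    (hp1 : p ≤ 1) (b : Bool) :
    ψ.prob d n k (plantedLaw S p) b = ENNReal.ofReal (∑ J : Finset (Fin n),
      p ^ J.card * (1 - p) ^ (n - J.card) * outputProb (ψ d n k) b J S) := by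
  classical
  rw [plantedLaw, prob_finLaw ψ d n k (obsWeight_nonneg hp0 hp1)]
  congr 1
  set Q := ψ d n k
  rw [← Fintype.sum_prod_type', ← (obsEquiv d n Q.coins).symm.sum_comp, Fintype.sum_prod_type]
  refine Finset.sum_nbij' (fun β => Finset.univ.filter fun i => β i = true)
    (fun J i => decide (i ∈ J)) (by simp) (by simp) (fun β _ => by ext i; simp)
    (fun J _ => by ext i; simp) fun β _ => ?_
  set J := Finset.univ.filter fun i => β i = true with hJ
  have hprod : ∀ z : SampleBits d n Q.coins → Bool,
      ∏ i, obsWeight d p (((obsEquiv d n Q.coins).symm (β, z)).1 i)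
        = p ^ J.card * (1 - p) ^ (n - J.card) * ((1 / 2) ^ (d + 1)) ^ n := by
    intro z
    simp only [obsEquiv_symm_fst, obsWeight, Finset.prod_mul_distrib,
      Finset.prod_const, Finset.card_univ, Fintype.card_fin]
    congr 1
    change (∏ i, if β i = true then p else 1 - p) = _
    rw [Finset.prod_ite, Finset.prod_const, Finset.prod_const, Finset.filter_not, ← hJ,
      ← Finset.compl_eq_univ_sdiff, Finset.card_compl, Fintype.card_fin]
  have hcard : (Fintype.card (SampleBits d n Q.coins → Bool) : ℝ)
      = 2 ^ n * 2 ^ (n * d) * 2 ^ Q.coins := by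
    simp [pow_add, mul_assoc]
  have hout : ∀ z : SampleBits d n Q.coins → Bool,
      (fun ij : Fin n × Fin d =>
        plantedRow S (((obsEquiv d n Q.coins).symm (β, z)).1 ij.1) ij.2)
        = plantedSample J S z := by
    intro z; funext ij
    simp [obsEquiv_symm_fst, plantedRow, plantedSample, hJ]
  rw [outputProb, unifProb, hcard, Finset.sum_div, Finset.mul_sum]
  refine Finset.sum_congr rfl fun z _ => ?_
  simp only [hprod, hout]
  change (if Q.output (plantedSample J S z) (fun l => z (.inr (.inr l))) = b then _ else _) = _
  have hpow : ((1 / 2 : ℝ) ^ (d + 1)) ^ n * (1 / 2) ^ Q.coins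
      = 1 / (2 ^ n * 2 ^ (n * d) * 2 ^ Q.coins) := by
    rw [← pow_mul, ← pow_add, one_div, inv_pow, one_div, ← pow_add, ← pow_add]
    congr 2
    ring
  split_ifs
  · rw [mul_assoc, hpow]
  · simp

/-- The vertices of the columns lying in `C`: column `j < M` is the vertex `j`. -/
def colTrace {m : ℕ} (d M : ℕ) (C : Finset (Fin m)) : Finset (Fin d) :=
  Finset.univ.filter fun j => j.val < M ∧ ∃ v ∈ C, v.val = j.val

/-- The observations whose vertices lie in `C`: observation `i` is the vertex `M + i`. -/
def rowTrace {m : ℕ} (n M : ℕ) (C : Finset (Fin m)) : Finset (Fin n) :=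
  Finset.univ.filter fun i => ∃ v ∈ C, v.val = M + i.val

/-- The bits of `SampleBits` inside the randomness of a random graph and of the reduction: an entry
in one of the first `M` columns is an edge, and everything else is a coin. -/
def bitSource {d n c m M r : ℕ} (hm : M + n ≤ m) (E : SampleBits d n c ≃ Fin r) :
    SampleBits d n c → Sym2 (Fin m) ⊕ Fin r
  | .inr (.inl ij) => if h : ij.2.val < M
      then .inl s(⟨M + ij.1, by omega⟩, ⟨ij.2, by omega⟩) else .inr (E (.inr (.inl ij)))
  | x => .inr (E x)

theorem bitSource_injective {d n c m M r : ℕ} (hm : M + n ≤ m) (E : SampleBits d n c ≃ Fin r) :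
    Function.Injective (bitSource hm E) := by
  rintro (i | ij | l) (i' | ij' | l') h <;> simp only [bitSource] at h <;> (try split_ifs at h) <;>
    simp only [Sum.inl.injEq, Sum.inr.injEq, E.apply_eq_iff_eq, reduceCtorEq] at h <;>
    try (first | exact h.elim | exact congrArg _ h | simp [h])
  have hlt := ij.2.2
  rw [Sym2.eq_iff] at h
  simp only [Fin.mk.injEq] at h
  rcases h with h | h
  · have : ij = ij' := Prod.ext (Fin.ext (by omega)) (Fin.ext h.2)
    rw [this]
  · omega

/-- The sample that the reduction builds from a graph: signs of edges in the first `M` columns, coins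
in the others, and each observation multiplied by a random sign. -/
noncomputable def graphSample {d n c m M r : ℕ} (hm : M + n ≤ m) (E : SampleBits d n c ≃ Fin r)
    (x : Fin m × Fin m → ℝ) (ω : Fin r → Bool) (ij : Fin n × Fin d) : ℝ :=
  sgn (ω (E (.inl ij.1))) * (if h : ij.2.val < M
    then 2 * x (⟨M + ij.1, by omega⟩, ⟨ij.2, by omega⟩) - 1
    else sgn (ω (E (.inr (.inl ij)))))

/-- The reduction costs a constant factor: each input read by `Q` is replaced by its expression in
terms of one adjacency or coin and the sign of the observation. -/
theorem exists_reductionProgram {d n m M : ℕ} (hm : M + n ≤ m)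
    (Q : RandProgram (Fin n × Fin d)) :
    ∃ (P : RandProgram (Fin m × Fin m)) (E : SampleBits d n Q.coins ≃ Fin P.coins),
      P.time ≤ Q.time * 12 + 1 ∧ ∀ x ω, P.output x ω
        = Q.output (graphSample hm E x ω) (fun l => ω (E (.inr (.inr l)))) := by
  classical
  let r := Fintype.card (SampleBits d n Q.coins)
  let E : SampleBits d n Q.coins ≃ Fin r := Fintype.equivFin _
  let src : Fin n × Fin d → (Fin m × Fin m) ⊕ Fin r := fun ij =>
    if h : ij.2.val < M then .inl (⟨M + ij.1, by omega⟩, ⟨ij.2, by omega⟩)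
      else .inr (E (.inr (.inl ij)))
  let h : (Fin n × Fin d) ⊕ Fin Q.coins → ((Fin m × Fin m) ⊕ Fin r → ℝ) → ℝ := fun s x =>
    match s with
    | .inl ij => (2 * x (.inr (E (.inl ij.1))) - 1) * (2 * x (src ij) - 1)
    | .inr l => x (.inr (E (.inr (.inr l))))
  have hh : ∀ s, HasCost 11 (h s) := by
    rintro (ij | l)
    · exact (((hasCost_const 2).mul (hasCost_input _)).sub (hasCost_const 1)).mul
        (((hasCost_const 2).mul (hasCost_input _)).sub (hasCost_const 1))
    · exact (hasCost_input _).mono (by norm_num)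
  obtain ⟨p, hp, hrun⟩ := exists_substitution hh Q.code
  refine ⟨⟨r, p⟩, E, by simpa [RandProgram.time] using hp, fun x ω => ?_⟩
  simp only [RandProgram.output, hrun]
  congr 3
  have hsgn : ∀ b : Bool, 2 * (if b = true then (1 : ℝ) else 0) - 1 = sgn b := fun b => by
    cases b <;> norm_num [sgn]
  congr 1
  funext s
  rcases s with ij | l
  · simp only [h, src, graphSample, Sum.elim_inl, Sum.elim_inr, hsgn]
    split_ifs with hlt
    · rfl
    · simp only [Sum.elim_inr, hsgn]
  · rfl

theorem graphSample_planted {d n c m M r : ℕ} (hm : M + n ≤ m) (E : SampleBits d n c ≃ Fin r)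
    (C : Finset (Fin m)) (e : Sym2 (Fin m) → Bool) (ω : Fin r → Bool) :
    graphSample hm E (adjInput (graphOf e ⊔ cliqueOn C)) ω
      = plantedSample (rowTrace n M C) (colTrace d M C) (Sum.elim e ω ∘ bitSource hm E) := by
  classical
  funext ij
  simp only [graphSample, plantedSample, Function.comp_apply]
  congr 1
  by_cases hlt : ij.2.val < M
  · have hrow : ij.1 ∈ rowTrace n M C ↔ (⟨M + ij.1, by omega⟩ : Fin m) ∈ C := by
      simp only [rowTrace, Finset.mem_filter, Finset.mem_univ, true_and]
      constructor
      · rintro ⟨v, hv, h⟩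
        rwa [show (⟨M + ij.1, by omega⟩ : Fin m) = v from Fin.ext h.symm]
      · exact fun h => ⟨_, h, rfl⟩
    have hcol : ij.2 ∈ colTrace d M C ↔ (⟨ij.2, by omega⟩ : Fin m) ∈ C := by
      simp only [colTrace, Finset.mem_filter, Finset.mem_univ, true_and, hlt]
      constructor
      · rintro ⟨v, hv, h⟩
        rwa [show (⟨ij.2, by omega⟩ : Fin m) = v from Fin.ext h.symm]
      · exact fun h => ⟨_, h, rfl⟩
    have hne : (⟨M + ij.1, by omega⟩ : Fin m) ≠ ⟨ij.2, by omega⟩ := by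
      simp only [ne_eq, Fin.mk.injEq]; omega
    have hadj : (graphOf e ⊔ cliqueOn C).Adj ⟨M + ij.1, by omega⟩ ⟨ij.2, by omega⟩ ↔
        e s(⟨M + ij.1, by omega⟩, ⟨ij.2, by omega⟩) = true
          ∨ (ij.1 ∈ rowTrace n M C ∧ ij.2 ∈ colTrace d M C) := by
      rw [hrow, hcol]
      simp only [graphOf, cliqueOn, SimpleGraph.sup_adj, SimpleGraph.fromEdgeSet_adj,
        SimpleGraph.fromRel_adj, Set.mem_ofPred_eq]
      tauto
    simp only [bitSource, dif_pos hlt, Sum.elim_inl, adjInput, hadj]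
    by_cases h1 : ij.1 ∈ rowTrace n M C ∧ ij.2 ∈ colTrace d M C
    · rw [if_pos (Or.inr h1), if_pos h1]; norm_num
    · rw [if_neg h1]
      simp only [h1, or_false, sgn]
      split_ifs <;> norm_num
  · have hcol : ij.2 ∉ colTrace d M C := by simp [colTrace, hlt]
    simp [bitSource, hlt, hcol]

/-- On a graph with planted clique `C` the reduction runs the test on a sample in which the
observations in `C` are planted on the columns in `C`. -/
theorem unifProb_reduction {d n m M : ℕ} (hm : M + n ≤ m) (Q : RandProgram (Fin n × Fin d))
    (P : RandProgram (Fin m × Fin m)) (E : SampleBits d n Q.coins ≃ Fin P.coins)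
    (hP : ∀ x ω, P.output x ω
        = Q.output (graphSample hm E x ω) (fun l => ω (E (.inr (.inr l)))))
    (C : Finset (Fin m)) (b : Bool) :
    unifProb (fun a : (Sym2 (Fin m) → Bool) × (Fin P.coins → Bool) =>
        P.output (adjInput (graphOf a.1 ⊔ cliqueOn C)) a.2 = b)
      = outputProb Q b (rowTrace n M C) (colTrace d M C) := by
  classical
  rw [outputProb, ← unifProb_comp_injective (bitSource_injective hm E),
    ← unifProb_equiv (Equiv.sumArrowEquivProdArrow (Sym2 (Fin m)) (Fin P.coins) Bool).symm]
  congr 1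
  funext a
  rw [hP, graphSample_planted]
  rfl

theorem pcProb_erdosRenyi {d n m M κ : ℕ} (hm : M + n ≤ m) (Q : RandProgram (Fin n × Fin d))
    (ξ : PCTest) (E : SampleBits d n Q.coins ≃ Fin (ξ m κ).coins)
    (hP : ∀ x ω, (ξ m κ).output x ω
        = Q.output (graphSample hm E x ω) (fun l => ω (E (.inr (.inr l))))) (b : Bool) :
    ξ.prob m κ (erdosRenyi m) b = ENNReal.ofReal (outputProb Q b ∅ ∅) := by
  have h := unifProb_reduction hm Q (ξ m κ) E hP ∅ b
  have h0 : cliqueOn (∅ : Finset (Fin m)) = ⊥ := by ext; simp [cliqueOn]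
  have h1 : rowTrace n M (∅ : Finset (Fin m)) = ∅ := by simp [rowTrace]
  have h2 : colTrace d M (∅ : Finset (Fin m)) = ∅ := by simp [colTrace]
  rw [h0, h1, h2] at h
  simp only [sup_bot_eq] at h
  rw [← h, PCTest.prob, erdosRenyi, PMF.bind_map]
  exact bind_map_uniform_apply (fun e ω => (ξ m κ).output (adjInput (graphOf e)) ω) b

theorem pcProb_plantedClique {d n m M κ : ℕ} (hm : M + n ≤ m) (hκ : κ ≤ m)
    (Q : RandProgram (Fin n × Fin d)) (ξ : PCTest)
    (E : SampleBits d n Q.coins ≃ Fin (ξ m κ).coins)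
    (hP : ∀ x ω, (ξ m κ).output x ω
        = Q.output (graphSample hm E x ω) (fun l => ω (E (.inr (.inr l))))) (b : Bool) :
    ξ.prob m κ (plantedClique m κ hκ) b
      = ENNReal.ofReal ((∑ C ∈ Finset.powersetCard κ (Finset.univ : Finset (Fin m)),
          outputProb Q b (rowTrace n M C) (colTrace d M C)) / m.choose κ) := by
  classical
  have hpos : (0 : ℝ) < m.choose κ := by exact_mod_cast Nat.choose_pos hκ
  have hC : ∀ C : Finset (Fin m),
      (((erdosRenyi m).map fun G => G ⊔ cliqueOn C).bind fun G =>
        (fairBits (ξ m κ).coins).map fun ω => (ξ m κ).output (adjInput G) ω) b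
      = ENNReal.ofReal (outputProb Q b (rowTrace n M C) (colTrace d M C)) := by
    intro C
    rw [← unifProb_reduction hm Q (ξ m κ) E hP C b, erdosRenyi, PMF.map_comp, PMF.bind_map]
    exact bind_map_uniform_apply
      (fun e ω => (ξ m κ).output (adjInput (graphOf e ⊔ cliqueOn C)) ω) b
  rw [PCTest.prob, plantedClique, PMF.bind_bind, PMF.bind_apply, tsum_fintype]
  simp only [hC, PMF.uniformOfFinset_apply, Finset.card_powersetCard, Finset.card_univ,
    Fintype.card_fin, ite_mul, zero_mul]
  rw [← Finset.sum_filter, Finset.filter_mem_eq_inter, Finset.univ_inter,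
    div_eq_inv_mul, ENNReal.ofReal_mul (by positivity), ENNReal.ofReal_inv_of_pos hpos,
    ENNReal.ofReal_sum_of_nonneg fun C _ => outputProb_nonneg _ _ _ _, Finset.mul_sum]
  simp

/-! ### Errors of tests on the planted laws -/

theorem le_maxError (ψ : SPCTest) {d n k : ℕ} {θ : ℝ} {P₀ P₁ : Measure (Fin d → ℝ)}
    (h₀ : P₀ ∈ nullLaws d n) (h₁ : P₁ ∈ altLaws d n k θ) :
    max (ψ.prob d n k P₀ true) (ψ.prob d n k P₁ false) ≤ ψ.maxError d n k θ :=
  le_iSup₂_of_le P₀ h₀ (le_iSup₂_of_le P₁ h₁ le_rfl)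

theorem prob_plantedLaw_empty (ψ : SPCTest) (d n k : ℕ) (b : Bool) :
    ψ.prob d n k (plantedLaw (∅ : Finset (Fin d)) 0) b
      = ENNReal.ofReal (outputProb (ψ d n k) b ∅ ∅) := by
  rw [prob_plantedLaw ψ d n k ∅ le_rfl zero_le_one,
    Finset.sum_eq_single (∅ : Finset (Fin n)) (fun J _ hJ => ?_) (by simp)]
  · simp
  · rw [zero_pow (Finset.card_ne_zero.2 (Finset.nonempty_iff_ne_empty.2 hJ))]
    simp

/-- A test with error at most `e` rejects uniform sign vectors with probability at most `e`, and
accepts samples whose observations are planted independently with probability `p` with probability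
at most `e`. -/
theorem outputProb_le_of_maxError_le (φ : SPCTest) {d n k : ℕ} {θ e : ℝ} (he : 0 ≤ e)
    (hn : 0 < n) (hk : 0 < k) (herr : φ.maxError d n k θ ≤ ENNReal.ofReal e) (hθ0 : 0 < θ)
    {S : Finset (Fin d)} (hS : k ≤ S.card) {p : ℝ} (hp0 : 0 ≤ p) (hp1 : p ≤ 1)
    (hθ : θ ≤ p * (k - 1)) :
    outputProb (φ d n k) true ∅ ∅ ≤ e ∧ ∑ J : Finset (Fin n),
      p ^ J.card * (1 - p) ^ (n - J.card) * outputProb (φ d n k) false J S ≤ e := by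
  have h := (le_maxError φ (plantedLaw_mem_nullLaws (d := d) hn)
    (plantedLaw_mem_altLaws hn hk hS hp0 hp1 hθ0 hθ)).trans herr
  rw [prob_plantedLaw_empty, prob_plantedLaw φ d n k S hp0 hp1, max_le_iff,
    ENNReal.ofReal_le_ofReal_iff he, ENNReal.ofReal_le_ofReal_iff he] at h
  exact h

theorem card_colTrace {d m M : ℕ} (hM : M ≤ d) {S : Finset (Fin m)} (hS : ∀ v ∈ S, v.val < M) :
    (colTrace d M S).card = S.card := by
  refine Finset.card_bij' (fun j hj => ⟨j.val, by
      obtain ⟨-, -, v, -, h⟩ := Finset.mem_filter.1 hj; omega⟩)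
    (fun v hv => ⟨v.val, (hS v hv).trans_le hM⟩) (fun j hj => ?_) (fun v hv => ?_)
    (fun _ _ => rfl) (fun _ _ => rfl)
  · obtain ⟨-, -, v, hv, h⟩ := Finset.mem_filter.1 hj
    rwa [show (⟨j.val, _⟩ : Fin m) = v from Fin.ext h.symm]
  · exact Finset.mem_filter.2 ⟨Finset.mem_univ _, hS v hv, v, hv, rfl⟩

/-- The vertex of an observation. -/
def rowVertex {m n M : ℕ} (hm : M + n ≤ m) : Fin n ↪ Fin m :=
  ⟨fun i => ⟨M + i.val, by omega⟩, fun i j h => by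
    have := congrArg Fin.val h
    exact Fin.ext (by simpa using this)⟩

theorem rowVertex_val {m n M : ℕ} (hm : M + n ≤ m) (i : Fin n) :
    (rowVertex hm i).val = M + i.val := rfl

/-- Subsets of the row vertices correspond to subsets of the observations. -/
theorem sum_powerset_rows {m n M : ℕ} (hm : M + n ≤ m) (F : ℕ → Finset (Fin n) → ℝ) :
    ∑ J ∈ (Finset.univ.filter fun v : Fin m => M ≤ v.val ∧ v.val < M + n).powerset,
      F J.card (rowTrace n M J) = ∑ J : Finset (Fin n), F J.card J := by
  classical
  set r : Fin n ↪ Fin m := rowVertex hm with hrdef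
  have hrv : ∀ i, (r i).val = M + i.val := rowVertex_val hm
  have hr : ∀ J : Finset (Fin n), rowTrace n M (J.map r) = J := by
    intro J; ext i
    simp only [rowTrace, Finset.mem_filter, Finset.mem_univ, true_and, Finset.mem_map]
    constructor
    · rintro ⟨v, ⟨i', hi', rfl⟩, h⟩
      rw [hrv] at h
      rwa [show i = i' from Fin.ext (by omega)]
    · exact fun hi => ⟨r i, ⟨i, hi, rfl⟩, hrv i⟩
  symm
  refine Finset.sum_nbij' (fun J => J.map r) (fun J => rowTrace n M J) ?_ (by simp)
    (fun J _ => hr J) ?_ ?_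
  · intro J _
    refine Finset.mem_powerset.2 fun v hv => ?_
    obtain ⟨i, -, rfl⟩ := Finset.mem_map.1 hv
    have := i.2
    simp only [Finset.mem_filter, Finset.mem_univ, true_and, hrv]
    omega
  · intro J hJ
    have hJ := Finset.mem_powerset.1 hJ
    ext v
    simp only [Finset.mem_map, rowTrace, Finset.mem_filter, Finset.mem_univ, true_and]
    constructor
    · rintro ⟨i, ⟨w, hw, h⟩, rfl⟩
      rwa [show r i = w from Fin.ext ((hrv i).trans h.symm)]
    · intro hv
      have h := (Finset.mem_filter.1 (hJ hv)).2
      exact ⟨⟨v.val - M, by omega⟩, ⟨v, hv, by simp; omega⟩, Fin.ext (by rw [hrv]; simp; omega)⟩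
  · intro J _
    simp only [hr, Finset.card_map]

/-- A sparse principal component test of error at most `e` yields a planted clique test of error
little more than `e`. -/
theorem pcError_le (φ : SPCTest) {d n k m M κ : ℕ} {θ e η : ℝ} (he : 0 ≤ e) (hn : 0 < n)
    (hk : 0 < k) (hMd : M ≤ d) (hm : M + n ≤ m) (hκ2 : 2 ≤ κ) (hκm : κ ≤ m) (hη0 : 0 < η)
    (hη1 : η < 1) (hnη : (n : ℝ) ≤ η * (m - M - κ)) (hl : 2 * (k : ℝ) ≤ κ * M / m)
    (hθ0 : 0 < θ) (hθ : θ ≤ κ / (2 * m) * (k - 1))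
    (herr : φ.maxError d n k θ ≤ ENNReal.ofReal e) (ξ : PCTest)
    (E : SampleBits d n (φ d n k).coins ≃ Fin (ξ m κ).coins)
    (hP : ∀ x ω, (ξ m κ).output x ω
        = (φ d n k).output (graphSample hm E x ω) (fun l => ω (E (.inr (.inr l))))) :
    max (ξ.prob m κ (erdosRenyi m) true) (ξ.prob m κ (plantedClique m κ hκm) false)
      ≤ ENNReal.ofReal
          (e / (1 - η) + 2 * M / m + 2 * n / (η * m) + 4 / (κ * M / m)) := by
  classical
  have hn' : (0 : ℝ) < n := by exact_mod_cast hn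
  have hm' : (0 : ℝ) < m := by exact_mod_cast (by omega : 0 < m)
  have hk1 : (1 : ℝ) ≤ k := by exact_mod_cast hk
  have hκ' : (0 : ℝ) < κ := by exact_mod_cast (by omega : 0 < κ)
  have hκm' : (κ : ℝ) ≤ m := by exact_mod_cast hκm
  have hgap : (0 : ℝ) < m - M - κ := by
    by_contra hcon
    have := mul_nonpos_of_nonneg_of_nonpos hη0.le (not_lt.1 hcon)
    linarith
  have hM0 : (0 : ℝ) ≤ M := Nat.cast_nonneg M
  have hkM : k ≤ M := by
    have h1 : (κ : ℝ) * M / m ≤ M := by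
      rw [div_le_iff₀ hm', mul_comm]; gcongr
    have : (k : ℝ) ≤ M := by linarith
    exact_mod_cast this
  have hrate : ∀ q : ℝ, (κ : ℝ) / (2 * m) ≤ q → θ ≤ q * (k - 1) := fun q hq =>
    hθ.trans (mul_le_mul_of_nonneg_right hq (by linarith))
  set A : Finset (Fin m) := Finset.univ.filter fun v => v.val < M with hA
  set B : Finset (Fin m) := Finset.univ.filter fun v => M ≤ v.val ∧ v.val < M + n with hB
  have hAS : ∀ S ⊆ A, ∀ v ∈ S, v.val < M := fun S hS v hv => (Finset.mem_filter.1 (hS hv)).2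
  have hAc : A.card = M := by
    rw [hA, Fin.card_filter_val_lt]; omega
  have hBc : B.card = n := by
    have : B = (Finset.univ : Finset (Fin n)).map (rowVertex hm) := by
      ext v
      simp only [hB, Finset.mem_filter, Finset.mem_univ, true_and, Finset.mem_map]
      constructor
      · rintro ⟨h1, h2⟩
        exact ⟨⟨v.val - M, by omega⟩, Fin.ext (by rw [rowVertex_val]; simp; omega)⟩
      · rintro ⟨i, rfl⟩
        rw [rowVertex_val]
        omega
    rw [this, Finset.card_map, Finset.card_univ, Fintype.card_fin]
  have hAB : Disjoint A B := Finset.disjoint_filter.2 fun v _ h1 h2 => by omega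
  have hnull : outputProb (φ d n k) true ∅ ∅ ≤ e := by
    have hS : k ≤ (colTrace d M A).card := by
      rw [card_colTrace hMd (hAS A (Finset.Subset.refl _)), hAc]; exact hkM
    refine (outputProb_le_of_maxError_le φ he hn hk herr hθ0 hS (p := κ / (2 * m)) (by positivity)
      ?_ (hrate _ le_rfl)).1
    rw [div_le_one (by positivity)]; linarith
  have hsum := sum_clique_le hAB hκ2 hk (by rwa [hAc, Fintype.card_fin]) hη0 hη1 he
    (by rw [hBc]; exact hn) (by rwa [hAc, hBc, Fintype.card_fin])
    (fun S J => outputProb (φ d n k) false (rowTrace n M J) (colTrace d M S))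
    (fun _ _ => outputProb_nonneg _ _ _ _) (fun _ _ => outputProb_le_one _ _ _ _) (by
      intro S hS hkS hSκ
      rw [hAc, hBc, Fintype.card_fin]
      have hSκ' : 2 * (S.card : ℝ) ≤ κ := by exact_mod_cast hSκ
      have hS0 : (0 : ℝ) ≤ S.card := Nat.cast_nonneg _
      set p : ℝ := (κ - S.card) / (m - M) with hp
      have hden : (0 : ℝ) < m - M := by linarith
      have h := sum_powerset_rows hm fun t J => p ^ t * (1 - p) ^ (n - t)
        * outputProb (φ d n k) false J (colTrace d M S)
      rw [← hB] at h
      rw [h]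
      refine (outputProb_le_of_maxError_le φ he hn hk herr hθ0
        (hkS.trans (card_colTrace hMd (hAS S hS)).ge) (div_nonneg (by linarith) hden.le) ?_
        (hrate _ ?_)).2
      · rw [div_le_one hden]; linarith
      · rw [div_le_div_iff₀ (by positivity) hden]
        nlinarith)
  have htr : ∀ C : Finset (Fin m), rowTrace n M (C ∩ B) = rowTrace n M C ∧
      colTrace d M (C ∩ A) = colTrace d M C := by
    intro C
    constructor
    · refine Finset.filter_congr fun i _ => ⟨?_, ?_⟩
      · rintro ⟨v, hv, h⟩; exact ⟨v, (Finset.mem_inter.1 hv).1, h⟩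
      · rintro ⟨v, hv, h⟩
        exact ⟨v, Finset.mem_inter.2 ⟨hv, by simp [hB]; omega⟩, h⟩
    · refine Finset.filter_congr fun j _ => and_congr_right fun hj => ⟨?_, ?_⟩
      · rintro ⟨v, hv, h⟩; exact ⟨v, (Finset.mem_inter.1 hv).1, h⟩
      · rintro ⟨v, hv, h⟩
        exact ⟨v, Finset.mem_inter.2 ⟨hv, by simp [hA]; omega⟩, h⟩
  simp only [(htr _).1, (htr _).2, hAc, hBc, Fintype.card_fin] at hsum
  have hη' : 0 < 1 - η := by linarith
  refine max_le ?_ ?_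
  · rw [pcProb_erdosRenyi hm (φ d n k) ξ E hP]
    refine ENNReal.ofReal_le_ofReal (hnull.trans ?_)
    have h1 : e ≤ e / (1 - η) := by
      rw [le_div_iff₀ hη']; nlinarith
    have h2 : (0 : ℝ) ≤ 2 * M / m + 2 * n / (η * m) + 4 / (κ * M / m) := by positivity
    linarith
  · rw [pcProb_plantedClique hm hκm (φ d n k) ξ E hP]
    refine ENNReal.ofReal_le_ofReal ?_
    rwa [div_le_iff₀ (by exact_mod_cast Nat.choose_pos hκm)]

/-- For very small `θ` no test has error below `1 / 3`: all `n` observations of the planted law are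
unplanted with probability close to `1`. -/
theorem not_maxError_le_of_small (φ : SPCTest) {d n k : ℕ} {θ e : ℝ} (he : 0 ≤ e) (he' : e ≤ 9 / 20)
    (hn : 0 < n) (hk : 2 ≤ k) (hkd : k ≤ d) (hθ0 : 0 < θ) (hθ : n * θ ≤ 1 / 10) :
    ¬ φ.maxError d n k θ ≤ ENNReal.ofReal e := by
  intro herr
  have hn1 : (1 : ℝ) ≤ n := by exact_mod_cast hn
  have hk2 : (2 : ℝ) ≤ k := by exact_mod_cast hk
  have hθ1 : θ ≤ 1 / 10 := by nlinarith
  obtain ⟨h1, h2⟩ := outputProb_le_of_maxError_le φ he hn (by omega) herr hθ0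
    (S := (Finset.univ : Finset (Fin d))) (by simpa using hkd) hθ0.le (by linarith) (by nlinarith)
  have h3 : (1 - θ) ^ n * outputProb (φ d n k) false ∅ ∅ ≤ e := by
    refine le_trans (le_of_eq ?_) ((Finset.single_le_sum (f := fun J : Finset (Fin n) =>
      θ ^ J.card * (1 - θ) ^ (n - J.card) * outputProb (φ d n k) false J Finset.univ)
      (fun J _ => mul_nonneg (mul_nonneg (pow_nonneg hθ0.le _) (pow_nonneg (by linarith) _))
        (outputProb_nonneg _ _ _ _)) (Finset.mem_univ ∅)).trans h2)
    have : outputProb (φ d n k) false ∅ ∅ = outputProb (φ d n k) false ∅ Finset.univ := by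
      unfold outputProb plantedSample
      simp
    simp [this]
  have h4 : 9 / 10 ≤ (1 - θ) ^ n := by
    have := one_add_mul_le_pow (a := -θ) (by linarith) n
    rw [← sub_eq_add_neg] at this
    linarith
  have h5 := outputProb_true_add_false (φ d n k) ∅ ∅
  have h6 : 9 / 10 * outputProb (φ d n k) false ∅ ∅ ≤ e :=
    (mul_le_mul_of_nonneg_right h4 (outputProb_nonneg _ _ _ _)).trans h3
  linarith

/-! ### Choice of the parameters of the planted clique problem -/

/-- The number of vertices used as columns. It is at least `n`, so that the rows are a small part of a
large multiple of it, and exceeds `k ^ 2` enough for a clique of slightly less than the square root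
of it to contain `2 k` columns. -/
noncomputable def colCount (γ : ℝ) (n k : ℕ) : ℕ := max n ⌈(k : ℝ) ^ (2 + γ)⌉₊

/-- The size of the planted clique in a graph on a constant multiple of `M` vertices: slightly below
the square root. -/
noncomputable def cliqueSize (τ : ℝ) (M : ℕ) : ℕ := ⌈(M : ℝ) ^ (1 / 2 - τ)⌉₊

theorem two_le_of_mem_regime {δ μ : ℝ} (hδ0 : 0 < δ) (hδ1 : δ < 1 / 3) (hμ : 0 < μ) {d n k : ℕ}
    (h : (d, n, k) ∈ regime δ μ) : 2 ≤ k ∧ k ≤ n := by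
  obtain ⟨⟨hd, hn, hk, hreg, -⟩, hnk, -⟩ := h
  have hd1 : (1 : ℝ) ≤ d := by exact_mod_cast hd
  have hn' : (0 : ℝ) < n := by exact_mod_cast hn
  have hk0 : (0 : ℝ) < k := by exact_mod_cast hk
  have hlog : 1 ≤ Real.log (6 * Real.exp 1 * d / δ) := by
    rw [Real.le_log_iff_exp_le (by positivity), le_div_iff₀ hδ0]
    have he := Real.exp_pos 1
    calc Real.exp 1 * δ ≤ Real.exp 1 * 1 := by gcongr; linarith
      _ ≤ 6 * Real.exp 1 * d := by nlinarith
  have h1 : √(k * Real.log (6 * Real.exp 1 * d / δ) / n) ≤ 1 / 15 := by linarith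
  rw [Real.sqrt_le_left (by norm_num), div_le_iff₀ hn'] at h1
  have h2 : (k : ℝ) ≤ (1 / 15) ^ 2 * n := (le_mul_of_one_le_right hk0.le hlog).trans h1
  have hkn : k ≤ n := by
    have : (k : ℝ) ≤ n := by linarith
    exact_mod_cast this
  refine ⟨?_, hkn⟩
  have hk1 : (1 : ℝ) ≤ k := by exact_mod_cast hk
  have hn1 : (1 : ℝ) < n := by linarith
  have h3 : (1 : ℝ) < k := (Real.one_lt_rpow hn1 hμ).trans_le hnk
  exact_mod_cast h3

theorem thetaAlpha_eq {α : ℝ} (d n k : ℕ) :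
    thetaAlpha α d n k = (k : ℝ) ^ (α / 2) / (n : ℝ) ^ (1 / 2 : ℝ) := by
  rw [thetaAlpha, Real.sqrt_div (by positivity), Real.sqrt_eq_rpow, Real.sqrt_eq_rpow,
    ← Real.rpow_mul (by positivity)]
  congr 2
  ring

theorem colCount_le {δ μ γ : ℝ} (hγ : γ ≤ 1 / 50) (hγ0 : 0 < γ) {d n k : ℕ}
    (h : (d, n, k) ∈ regime δ μ) : colCount γ n k ≤ d := by
  obtain ⟨⟨hd, hn, hk, -, hkd⟩, -, hnd⟩ := h
  have hd1 : (1 : ℝ) ≤ d := by exact_mod_cast hd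
  refine max_le hnd.le (Nat.ceil_le.2 ?_)
  calc (k : ℝ) ^ (2 + γ) ≤ ((d : ℝ) ^ (0.49 : ℝ)) ^ (2 + γ) := by gcongr
    _ = (d : ℝ) ^ ((0.49 : ℝ) * (2 + γ)) := by rw [← Real.rpow_mul (by positivity)]
    _ ≤ (d : ℝ) ^ (1 : ℝ) := Real.rpow_le_rpow_of_exponent_le hd1 (by norm_num; linarith)
    _ = d := Real.rpow_one _

/-- The number of columns is small enough that the signal of the planted clique exceeds
`√(k ^ α / n)`. -/
theorem colCount_rpow_le {α μ ε γ τ : ℝ} (hα2 : α < 2) (hτ0 : 0 < τ)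
    (hτ1 : τ ≤ μ * (1 - α / 2)) (hτ2 : τ ≤ 1 / 2) (hγ0 : 0 < γ)
    (hσ : γ / 2 + 2 * τ + γ * τ ≤ ε) {d n k : ℕ} (hn : 0 < n) (hk : 0 < k) (hkn : k ≤ n)
    (hnk : (n : ℝ) ^ μ ≤ k) (hε : thetaAlpha α d n k ≤ (n : ℝ) ^ (-ε)) :
    (colCount γ n k : ℝ) ^ (1 / 2 + τ) ≤ 2 * ((k : ℝ) ^ (1 - α / 2) * (n : ℝ) ^ (1 / 2 : ℝ)) := by
  have hn1 : (1 : ℝ) ≤ n := by exact_mod_cast hn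
  have hk1 : (1 : ℝ) ≤ k := by exact_mod_cast hk
  have hn0 : (0 : ℝ) < n := by linarith
  have hk0 : (0 : ℝ) < k := by linarith
  have hkn' : (k : ℝ) ≤ n := by exact_mod_cast hkn
  have hpos : (0 : ℝ) ≤ (k : ℝ) ^ (1 - α / 2) * (n : ℝ) ^ (1 / 2 : ℝ) := by positivity
  rcases le_total n ⌈(k : ℝ) ^ (2 + γ)⌉₊ with h | h
  · rw [colCount, max_eq_right h]
    have hX : (1 : ℝ) ≤ (k : ℝ) ^ (2 + γ) := Real.one_le_rpow hk1 (by linarith)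
    have hceil : (⌈(k : ℝ) ^ (2 + γ)⌉₊ : ℝ) ≤ 2 * (k : ℝ) ^ (2 + γ) := by
      have := Nat.ceil_lt_add_one (zero_le_one.trans hX)
      linarith
    have h2 : (2 : ℝ) ^ (1 / 2 + τ) ≤ 2 := by
      calc (2 : ℝ) ^ (1 / 2 + τ) ≤ (2 : ℝ) ^ (1 : ℝ) :=
            Real.rpow_le_rpow_of_exponent_le one_le_two (by linarith)
        _ = 2 := Real.rpow_one 2
    have hkα : (k : ℝ) ^ (α / 2) ≤ (n : ℝ) ^ (1 / 2 - ε) := by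
      rw [thetaAlpha_eq, div_le_iff₀ (by positivity), ← Real.rpow_add hn0] at hε
      rwa [show (1 / 2 - ε : ℝ) = -ε + 1 / 2 by ring]
    have hkσ : (k : ℝ) ^ (γ / 2 + 2 * τ + γ * τ) ≤ (n : ℝ) ^ ε :=
      (Real.rpow_le_rpow hk0.le hkn' (by positivity)).trans
        (Real.rpow_le_rpow_of_exponent_le hn1 hσ)
    calc (⌈(k : ℝ) ^ (2 + γ)⌉₊ : ℝ) ^ (1 / 2 + τ)
        ≤ (2 * (k : ℝ) ^ (2 + γ)) ^ (1 / 2 + τ) := by gcongr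
      _ = (2 : ℝ) ^ (1 / 2 + τ) * (k : ℝ) ^ ((2 + γ) * (1 / 2 + τ)) := by
          rw [Real.mul_rpow (by norm_num) (by positivity), ← Real.rpow_mul hk0.le]
      _ = (2 : ℝ) ^ (1 / 2 + τ) * ((k : ℝ) ^ (1 - α / 2) * ((k : ℝ) ^ (α / 2)
            * (k : ℝ) ^ (γ / 2 + 2 * τ + γ * τ))) := by
          rw [← Real.rpow_add hk0, ← Real.rpow_add hk0]
          congr 2
          ring
      _ ≤ 2 * ((k : ℝ) ^ (1 - α / 2) * ((n : ℝ) ^ (1 / 2 - ε) * (n : ℝ) ^ ε)) := by gcongr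
      _ = _ := by
          rw [← Real.rpow_add hn0]
          congr 3
          ring
  · rw [colCount, max_eq_left h]
    have h1 : (n : ℝ) ^ τ ≤ (k : ℝ) ^ (1 - α / 2) := by
      calc (n : ℝ) ^ τ ≤ (n : ℝ) ^ (μ * (1 - α / 2)) :=
            Real.rpow_le_rpow_of_exponent_le hn1 hτ1
        _ = ((n : ℝ) ^ μ) ^ (1 - α / 2) := Real.rpow_mul hn0.le _ _
        _ ≤ (k : ℝ) ^ (1 - α / 2) := by
            have : 0 ≤ 1 - α / 2 := by linarith
            gcongr
    calc (n : ℝ) ^ (1 / 2 + τ) = (n : ℝ) ^ τ * (n : ℝ) ^ (1 / 2 : ℝ) := by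
          rw [← Real.rpow_add hn0, add_comm]
      _ ≤ (k : ℝ) ^ (1 - α / 2) * (n : ℝ) ^ (1 / 2 : ℝ) := by gcongr
      _ ≤ _ := by linarith

theorem eventually_mul_rpow_lt (c : ℝ) {s t : ℝ} (hst : s < t) :
    ∀ᶠ M : ℕ in Filter.atTop, c * (M : ℝ) ^ s < (M : ℝ) ^ t := by
  have h := (tendsto_rpow_atTop (sub_pos.2 hst)).comp (tendsto_natCast_atTop_atTop (R := ℝ))
  filter_upwards [h.eventually_gt_atTop c, Filter.eventually_gt_atTop 0] with M hM hM0
  have hM0' : (0 : ℝ) < M := by exact_mod_cast hM0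
  have : (M : ℝ) ^ t = (M : ℝ) ^ (t - s) * (M : ℝ) ^ s := by
    rw [← Real.rpow_add hM0']; congr 1; ring
  rw [this]
  exact mul_lt_mul_of_pos_right hM (by positivity)

theorem polynomial_eval_mono (p : Polynomial ℕ) {a b : ℕ} (h : a ≤ b) : p.eval a ≤ p.eval b := by
  rw [Polynomial.eval_eq_sum_range, Polynomial.eval_eq_sum_range]
  gcongr

/-- The choice of a reduction for every size of the planted clique problem. Different sparse principal
component problems may lead to the same `m` and `κ`; the reduction is then run for one of those with
a property `B` of interest, if there is any. -/
theorem exists_reductionTest {φ : SPCTest} (hφ : φ.PolyTime) (A : ℝ) (M : ℕ → ℕ → ℕ → ℕ)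
    (B : ℕ → ℕ → ℕ → ℕ → ℕ → Prop)
    (hB : ∀ m κ d n k, B m κ d n k → 0 < n ∧ (d : ℝ) ≤ (n : ℝ) ^ A ∧ k ≤ n ∧ n ≤ m ∧
      M d n k + n ≤ m) :
    ∃ ξ : PCTest, ξ.PolyTime ∧ ∀ m κ, (∃ d n k, B m κ d n k) → ∃ d n k, B m κ d n k ∧
      ∃ (hm : M d n k + n ≤ m) (E : SampleBits d n (φ d n k).coins ≃ Fin (ξ m κ).coins),
        ∀ x ω, (ξ m κ).output x ω
          = (φ d n k).output (graphSample hm E x ω) (fun l => ω (E (.inr (.inr l)))) := by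
  obtain ⟨p, hp⟩ := hφ
  set N := ⌈A⌉₊ + 1 with hN
  have key : ∀ m κ, ∃ P : RandProgram (Fin m × Fin m),
      P.time ≤ (p.comp (3 * Polynomial.X ^ N) * 12 + 1).eval m ∧
      ((∃ d n k, B m κ d n k) → ∃ d n k, B m κ d n k ∧
      ∃ (hm : M d n k + n ≤ m) (E : SampleBits d n (φ d n k).coins ≃ Fin P.coins),
        ∀ x ω, P.output x ω
          = (φ d n k).output (graphSample hm E x ω) (fun l => ω (E (.inr (.inr l))))) := by
    intro m κ
    by_cases h : ∃ d n k, B m κ d n k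
    · obtain ⟨d, n, k, hb⟩ := h
      obtain ⟨hn, hdA, hkn, hnm, hm⟩ := hB m κ d n k hb
      obtain ⟨P, E, hP, hPo⟩ := exists_reductionProgram hm (φ d n k)
      refine ⟨P, hP.trans ?_, fun _ => ⟨d, n, k, hb, hm, E, hPo⟩⟩
      simp only [Polynomial.eval_add, Polynomial.eval_mul, Polynomial.eval_comp,
        Polynomial.eval_pow, Polynomial.eval_X, Polynomial.eval_ofNat, Polynomial.eval_one]
      have hn1 : (1 : ℝ) ≤ n := by exact_mod_cast hn
      have hd : d ≤ m ^ N := by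
        have h1 : (d : ℝ) ≤ (n : ℝ) ^ N := by
          refine hdA.trans ?_
          rw [← Real.rpow_natCast]
          refine Real.rpow_le_rpow_of_exponent_le hn1 ((Nat.le_ceil A).trans ?_)
          exact_mod_cast Nat.le_succ _
        have h2 : d ≤ n ^ N := by exact_mod_cast h1
        exact h2.trans (Nat.pow_le_pow_left hnm N)
      have hmN : m ≤ m ^ N := Nat.le_self_pow (by omega) m
      have hle : d + n + k ≤ 3 * m ^ N := by omega
      have := (hp d n k).trans (polynomial_eval_mono p hle)
      omega
    · exact ⟨⟨0, []⟩, Nat.zero_le _, fun h' => absurd h' h⟩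
  choose ξ hξt hξ using key
  exact ⟨ξ, ⟨_, hξt⟩, hξ⟩

/-- The rate `√(k ^ α / n)` is at most a multiple of the signal that a planted clique on `κ` of the
`C M` vertices produces. -/
theorem thetaAlpha_le_of_colCount_rpow_le {α τ C M κ : ℝ} {d n k : ℕ} (hC0 : 0 < C) (hM0 : 0 < M)
    (hn : (0 : ℝ) < n) (hk : (2 : ℝ) ≤ k) (hκ : M ^ (1 / 2 - τ) ≤ κ)
    (hM : M ^ (1 / 2 + τ) ≤ 2 * ((k : ℝ) ^ (1 - α / 2) * (n : ℝ) ^ (1 / 2 : ℝ))) :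
    1 / (8 * C) * thetaAlpha α d n k ≤ κ / (2 * (C * M)) * (k - 1) := by
  have hk0 : (0 : ℝ) < k := by linarith
  set X := M ^ (1 / 2 - τ) with hX
  have hX0 : 0 < X := by positivity
  have hκ0 : 0 < κ := by linarith
  rw [thetaAlpha_eq]
  have hXM : X * M ^ (1 / 2 + τ) = M := by
    rw [hX, ← Real.rpow_add hM0, show (1 / 2 - τ + (1 / 2 + τ) : ℝ) = 1 by ring, Real.rpow_one]
  have hkk : (k : ℝ) ^ (1 - α / 2) * (k : ℝ) ^ (α / 2) = k := by
    rw [← Real.rpow_add hk0, sub_add_cancel, Real.rpow_one]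
  set Y := M ^ (1 / 2 + τ) with hY
  set s := (n : ℝ) ^ (1 / 2 : ℝ) with hs
  have hs0 : 0 < s := by positivity
  have hMk : (k : ℝ) ^ (α / 2) * M ≤ 2 * (X * (k * s)) := by
    calc (k : ℝ) ^ (α / 2) * M = (k : ℝ) ^ (α / 2) * X * Y := by rw [← hXM]; ring
      _ ≤ (k : ℝ) ^ (α / 2) * X * (2 * ((k : ℝ) ^ (1 - α / 2) * s)) := by gcongr
      _ = 2 * (X * (((k : ℝ) ^ (1 - α / 2) * (k : ℝ) ^ (α / 2)) * s)) := by ring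
      _ = _ := by rw [hkk]
  have h1 : κ / (2 * (C * M)) * ((k : ℝ) / 2) ≤ κ / (2 * (C * M)) * (k - 1) := by
    gcongr; linarith
  refine le_trans ?_ h1
  rw [div_mul_div_comm, div_mul_div_comm, div_le_div_iff₀ (by positivity) (by positivity)]
  have h2 : X * (k * s) ≤ κ * (k * s) := by gcongr
  calc 1 * (k : ℝ) ^ (α / 2) * (2 * (C * M) * 2) = 4 * C * ((k : ℝ) ^ (α / 2) * M) := by ring
    _ ≤ 4 * C * (2 * (κ * (k * s))) :=
          mul_le_mul_of_nonneg_left (by linarith) (by positivity)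
    _ = κ * k * (8 * C * s) := by ring

/-- The loss in the reduction does not use up the factor between `1.05` and `1.2`. -/
theorem error_sum_lt {δ C M κ n : ℝ} (hδ0 : 0 < δ) (hC0 : 0 < C) (hM0 : 0 < M) (hκ0 : 0 < κ)
    (hnM : n ≤ M) (hCδ : 1240 ≤ C * δ) (hκ : 80 * C < κ * δ) :
    1.05 * δ / (1 - 1 / 30) + 2 * M / (C * M) + 2 * n / (1 / 30 * (C * M)) + 4 / (κ / C)
      < 1.2 * δ := by
  have h1 : 1.05 * δ / (1 - 1 / 30) ≤ 1.087 * δ := by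
    rw [div_le_iff₀ (by norm_num)]; linarith
  have h3 : 2 * n / (1 / 30 * (C * M)) ≤ 2 * M / (1 / 30 * (C * M)) := by gcongr
  have h4 : 2 * M / (C * M) + 2 * M / (1 / 30 * (C * M)) = 62 / C := by
    field_simp; norm_num
  have h5 : 62 / C ≤ 0.05 * δ := by
    rw [div_le_iff₀ hC0]; linarith
  have h6 : 4 / (κ / C) ≤ 0.05 * δ := by
    rw [div_div_eq_mul_div, div_le_iff₀ hκ0]
    linarith
  linarith

/-- Below a small multiple of `√(k ^ α / n)` the error of a polynomial-time test exceeds `δ` by a fixed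
factor, if planted clique is hard. -/
theorem not_maxError_le {δ α μ : ℝ} (hδ0 : 0 < δ) (hδ1 : δ < 1 / 3) (hα2 : α < 2)
    (hμ : 0 < μ) (hPC : PlantedCliqueHard δ) {φ : SPCTest} (hφ : φ.PolyTime) {A ε : ℝ}
    (hε : 0 < ε) :
    ∃ c : ℝ, 0 < c ∧ ∀ d n k, (d, n, k) ∈ regime δ μ ∩ polyParams α A ε → ∀ θ : ℝ, 0 < θ →
      θ ≤ c * thetaAlpha α d n k → ¬ φ.maxError d n k θ ≤ ENNReal.ofReal (1.05 * δ) := by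
  set γ := min (1 / 50) (ε / 2) with hγdef
  have hγ0 : 0 < γ := by positivity
  have hγ1 : γ ≤ 1 / 50 := min_le_left _ _
  have hγ2 : γ ≤ ε / 2 := min_le_right _ _
  have hα' : 0 < 1 - α / 2 := by linarith
  set τ := min (γ / 16) (μ * (1 - α / 2)) with hτdef
  have hτ0 : 0 < τ := by positivity
  have hτ1 : τ ≤ γ / 16 := min_le_left _ _
  have hτ2 : τ ≤ μ * (1 - α / 2) := min_le_right _ _
  have hγτ : γ * τ ≤ 1 / 50 * τ := by gcongr
  have hσ : γ / 2 + 2 * τ + γ * τ ≤ ε := by linarith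
  have hexp : (2 + γ)⁻¹ < 1 / 2 - τ := by
    rw [inv_lt_iff_one_lt_mul₀ (by linarith)]
    nlinarith
  -- `m = C M` vertices: the constant makes the atypical traces improbable
  obtain ⟨C, hC⟩ := exists_nat_ge (1240 / δ)
  have hCδ : 1240 ≤ C * δ := (div_le_iff₀ hδ0).1 hC
  have hC1240 : (1240 : ℝ) < C := by nlinarith
  have hC0 : 0 < C := by
    have : (0 : ℝ) < C := by linarith
    exact_mod_cast this
  have hC32 : 32 ≤ C := by
    have : (32 : ℝ) ≤ C := by linarith
    exact_mod_cast this
  set c₀ : ℝ := 1 / (8 * C) with hc₀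
  have hc₀pos : 0 < c₀ := by positivity
  let B : ℕ → ℕ → ℕ → ℕ → ℕ → Prop := fun m κ d n k =>
    (d, n, k) ∈ regime δ μ ∩ polyParams α A ε ∧ m = C * colCount γ n k ∧
      κ = cliqueSize τ (colCount γ n k) ∧ ∃ θ : ℝ, 0 < θ ∧ θ ≤ c₀ * thetaAlpha α d n k ∧
        φ.maxError d n k θ ≤ ENNReal.ofReal (1.05 * δ)
  obtain ⟨ξ, hξt, hξ⟩ := exists_reductionTest hφ A (fun _ n k => colCount γ n k) B (by
    rintro m κ d n k ⟨⟨hR, hP⟩, rfl, -, -⟩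
    have hnM : n ≤ colCount γ n k := le_max_left _ _
    have hCM : 2 * colCount γ n k ≤ C * colCount γ n k := Nat.mul_le_mul_right _ (by omega)
    exact ⟨hR.1.2.1, hP.1, (two_le_of_mem_regime hδ0 hδ1 hμ hR).2, by omega, by omega⟩)
  obtain ⟨Γ, hΓ0, hΓ⟩ := hPC (1 - 4 * τ) (1 - τ) (by linarith) (by linarith) (by linarith) ξ hξt
  have hC0' : (0 : ℝ) < C := by exact_mod_cast hC0
  have hlarge : ∀ᶠ M : ℕ in Filter.atTop, ∀ m κ, m = C * M → κ = cliqueSize τ M →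
      ¬ ∃ d n k, colCount γ n k = M ∧ B m κ d n k := by
    filter_upwards [eventually_mul_rpow_lt ((C : ℝ) ^ ((1 - 4 * τ) / 2) / Γ)
        (by linarith : (1 - 4 * τ) / 2 < 1 / 2 - τ),
      eventually_mul_rpow_lt (2 * Γ / (C : ℝ) ^ ((1 - τ) / 2))
        (by linarith : 1 / 2 - τ < (1 - τ) / 2),
      eventually_mul_rpow_lt 2 (by linarith : (0 : ℝ) < 1 / 2 - τ),
      eventually_mul_rpow_lt 2 (by linarith : 1 / 2 - τ < 1),
      eventually_mul_rpow_lt (2 * C) hexp,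
      eventually_mul_rpow_lt (80 * C / δ) (by linarith : (0 : ℝ) < 1 / 2 - τ),
      Filter.eventually_gt_atTop 0] with M e1 e2 e3 e4 e5 e6 hM0
    rintro m κ hmM hκM ⟨d₀, n₀, k₀, hM₀, hB₀⟩
    obtain ⟨d, n, k, ⟨⟨hR, hP⟩, hm', hκ', θ, hθ0, hθ, herr⟩, hm, E, hout⟩ :=
      hξ m κ ⟨d₀, n₀, k₀, hB₀⟩
    have hMeq : colCount γ n k = M := by
      rw [hmM] at hm'
      exact (Nat.eq_of_mul_eq_mul_left hC0 hm').symm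
    obtain ⟨hk2, hkn⟩ := two_le_of_mem_regime hδ0 hδ1 hμ hR
    have hMd := colCount_le hγ1 hγ0 hR
    have hn0 : 0 < n := hR.1.2.1
    have hrpow := colCount_rpow_le (γ := γ) hα2 hτ0 hτ2 (by linarith) hγ0 hσ hn0 (by omega) hkn
      hR.2.1 hP.2
    have hnM : n ≤ colCount γ n k := le_max_left _ _
    have hkM : (k : ℝ) ^ (2 + γ) ≤ colCount γ n k :=
      (Nat.le_ceil _).trans (by exact_mod_cast le_max_right n _)
    rw [hMeq] at hrpow hnM hkM hMd
    have hM0' : (0 : ℝ) < M := by exact_mod_cast hM0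
    have hn' : (0 : ℝ) < n := by exact_mod_cast hn0
    have hk' : (2 : ℝ) ≤ k := by exact_mod_cast hk2
    have hk0 : (0 : ℝ) < k := by linarith
    have hnM' : (n : ℝ) ≤ M := by exact_mod_cast hnM
    set X := (M : ℝ) ^ (1 / 2 - τ) with hX
    have hX0 : 0 < X := by positivity
    rw [Real.rpow_zero, mul_one] at e3 e6
    rw [Real.rpow_one] at e4
    have hκX : X ≤ κ := by rw [hκM]; exact Nat.le_ceil _
    have hκX2 : (κ : ℝ) ≤ 2 * X := by
      have h := Nat.ceil_lt_add_one hX0.le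
      have h' : (κ : ℝ) = (⌈X⌉₊ : ℝ) := by rw [hκM]; rfl
      linarith
    have hκpos : (0 : ℝ) < κ := by linarith
    have hmR : (m : ℝ) = C * M := by rw [hmM]; push_cast; ring
    have hκ2 : 2 < κ := by
      have : (2 : ℝ) < κ := by linarith
      exact_mod_cast this
    have hκMle : (κ : ℝ) ≤ M := by linarith
    have hκm : κ ≤ m := by
      have : (κ : ℝ) ≤ m := by rw [hmR]; exact hκMle.trans (le_mul_of_one_le_left hM0'.le (by linarith))
      exact_mod_cast this
    have hκM_div : (κ : ℝ) * M / m = κ / C := by rw [hmR]; field_simp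
    -- the window of planted clique sizes
    have hlow : (m : ℝ) ^ ((1 - 4 * τ) / 2) < Γ * κ := by
      rw [hmR, Real.mul_rpow hC0'.le hM0'.le]
      rw [div_mul_eq_mul_div, div_lt_iff₀ hΓ0] at e1
      calc _ < X * Γ := e1
        _ ≤ Γ * κ := by rw [mul_comm]; gcongr
    have hhigh : Γ * κ < (m : ℝ) ^ ((1 - τ) / 2) := by
      rw [hmR, Real.mul_rpow hC0'.le hM0'.le]
      rw [div_mul_eq_mul_div, div_lt_iff₀ (by positivity)] at e2
      calc Γ * κ ≤ Γ * (2 * X) := by gcongr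
        _ = 2 * Γ * X := by ring
        _ < (M : ℝ) ^ ((1 - τ) / 2) * (C : ℝ) ^ ((1 - τ) / 2) := e2
        _ = _ := mul_comm _ _
    -- the clique has at least `2 k` columns on average
    have hl : 2 * (k : ℝ) ≤ κ * M / m := by
      have h1 : (k : ℝ) ≤ (M : ℝ) ^ (2 + γ)⁻¹ := by
        rw [Real.le_rpow_inv_iff_of_pos hk0.le hM0'.le (by linarith)]
        exact hkM
      rw [hκM_div, le_div_iff₀ hC0']
      calc 2 * (k : ℝ) * C ≤ 2 * C * (M : ℝ) ^ (2 + γ)⁻¹ := by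
            rw [mul_right_comm]; gcongr
        _ ≤ κ := by linarith
    -- strength of the planted signal
    have hθ' : θ ≤ κ / (2 * m) * (k - 1) := by
      rw [hmR]
      exact hθ.trans (thetaAlpha_le_of_colCount_rpow_le hC0' hM0' hn' hk' hκX hrpow)
    have hgap : (n : ℝ) ≤ 1 / 30 * (m - M - κ) := by
      have := mul_le_mul_of_nonneg_right hC1240.le hM0'.le
      rw [hmR]
      linarith
    have hbound := pcError_le φ (by positivity) hn0 (by omega) (by rwa [hMeq]) hm (by omega) hκm
      (η := 1 / 30) (by norm_num) (by norm_num)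
      (by rwa [hMeq]) (by rwa [hMeq]) hθ0 hθ' herr ξ E hout
    have hcon := (hΓ m κ hκm hκ2 hlow hhigh).trans hbound
    rw [hMeq, hκM_div, hmR] at hcon
    have h4 : 80 * C / δ < κ := e6.trans_le hκX
    rw [div_lt_iff₀ hδ0] at h4
    have hsum := error_sum_lt hδ0 hC0' hM0' hκpos hnM' hCδ h4
    exact absurd hcon (not_le.2 ((ENNReal.ofReal_lt_ofReal_iff (by positivity)).2 hsum))
  -- for bounded `M` the sample size is bounded and no test succeeds
  obtain ⟨M₀, hM₀⟩ := Filter.eventually_atTop.1 hlarge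
  refine ⟨min c₀ (1 / (10 * (M₀ + 1))), by positivity, fun d n k ht θ hθ0 hθ herr => ?_⟩
  have hθα : 0 ≤ thetaAlpha α d n k := Real.sqrt_nonneg _
  rcases le_or_gt M₀ (colCount γ n k) with h | h
  · exact hM₀ _ h _ _ rfl rfl ⟨d, n, k, rfl, ht, rfl, rfl, θ, hθ0,
      hθ.trans (mul_le_mul_of_nonneg_right (min_le_left _ _) hθα), herr⟩
  · obtain ⟨hk2, hkn⟩ := two_le_of_mem_regime hδ0 hδ1 hμ ht.1
    have hn0 : 0 < n := ht.1.1.2.1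
    have hnd : n < d := ht.1.2.2
    have hn1 : (1 : ℝ) ≤ n := by exact_mod_cast hn0
    have hnM : (n : ℝ) ≤ M₀ + 1 := by
      have : n ≤ M₀ := (le_max_left n _).trans h.le
      have : (n : ℝ) ≤ M₀ := by exact_mod_cast this
      linarith
    have hθα1 : thetaAlpha α d n k ≤ 1 :=
      ht.2.2.trans (Real.rpow_le_one_of_one_le_of_nonpos hn1 (by linarith))
    have hM₀1 : (0 : ℝ) < M₀ + 1 := by positivity
    refine not_maxError_le_of_small φ (by positivity) (by linarith) hn0 hk2 (by omega) hθ0 ?_ herr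
    have h1 : θ ≤ 1 / (10 * (M₀ + 1)) := by
      refine hθ.trans ((mul_le_mul (min_le_right _ _) hθα1 hθα (by positivity)).trans ?_)
      rw [mul_one]
    calc n * θ ≤ (M₀ + 1) * (1 / (10 * (M₀ + 1))) := by gcongr
      _ = 1 / 10 := by field_simp

end SparsePC

theorem mainTheorem2 (δ : ℝ) (hδ₀ : 0 < δ) (hδ₁ : δ < 1 / 3)
    (α : ℝ) (hα₁ : 1 ≤ α) (hα₂ : α < 2) (μ : ℝ) (hμ₀ : 0 < μ) (hμ₁ : μ < 1 / (4 - α))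
    (hPC : SparsePC.PlantedCliqueHard δ) :
    (∃ ψ : SparsePC.SPCTest, ψ.PolyTime ∧
      SparsePC.Discriminates δ (SparsePC.regime δ μ) ψ SparsePC.thetaPoly) ∧
    (∀ φ : SparsePC.SPCTest, φ.PolyTime → ∀ A ε : ℝ, 0 < A → 0 < ε →
      SparsePC.FailsBelow δ (SparsePC.regime δ μ ∩ SparsePC.polyParams α A ε) φ
        (SparsePC.thetaAlpha α)) ∧
    (∀ R : Set (ℕ × ℕ × ℕ), R ⊆ SparsePC.regime δ μ → ∀ ρ : ℕ → ℕ → ℕ → ℝ,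
      SparsePC.IsOptimalRate δ R {ψ | ψ.PolyTime} ρ →
      (∃ C : ℝ, 0 < C ∧ ∀ d n k, (d, n, k) ∈ R → ρ d n k ≤ C * SparsePC.thetaPoly d n k) ∧
      (∀ A ε : ℝ, 0 < A → 0 < ε → ∃ c : ℝ, 0 < c ∧
        ∀ d n k, (d, n, k) ∈ R ∩ SparsePC.polyParams α A ε →
          c * SparsePC.thetaAlpha α d n k ≤ ρ d n k)) := by
  obtain ⟨ψ, hψ, c₁, hc₁, hψerr⟩ := SparsePC.exists_polyTime_test hδ₀ hδ₁
  refine ⟨⟨ψ, hψ, c₁, hc₁, fun d n k hR θ hθ0 hθ => ?_⟩, fun φ hφ A ε _ hε => ?_,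
    fun R hRsub ρ ⟨⟨χ, hχ, c₂, hc₂, hχerr⟩, hfail⟩ => ⟨?_, fun A ε _ hε => ?_⟩⟩
  · exact (hψerr d n k hR.1 hR.2.2 θ hθ0 hθ).trans (ENNReal.ofReal_le_ofReal (by linarith))
  · obtain ⟨c, hc, h⟩ := SparsePC.not_maxError_le hδ₀ hδ₁ hα₂ hμ₀ hPC hφ (A := A) hε
    refine ⟨c, hc, fun d n k hR θ hθ0 hθ => ?_⟩
    exact (ENNReal.ofReal_le_ofReal (by linarith)).trans (not_le.1 (h d n k hR θ hθ0 hθ)).le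
  · -- The test `ψ` has error `δ / 2` where it succeeds, and at least `δ` below the optimal rate.
    obtain ⟨c, hc, h⟩ := hfail ψ hψ
    refine ⟨c₁ / c, by positivity, fun d n k hR => ?_⟩
    obtain ⟨hsp, -, hnd⟩ := hRsub hR
    obtain ⟨-, hn, hk, -, -⟩ := hsp
    have hpos : 0 < SparsePC.thetaPoly d n k := by
      have hn' : (0 : ℝ) < n := by exact_mod_cast hn
      have hk' : (0 : ℝ) < k := by exact_mod_cast hk
      have hlog : 0 < Real.log d := Real.log_pos (by exact_mod_cast (by omega : 1 < d))
      exact Real.sqrt_pos.2 (by positivity)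
    by_contra hlt
    rw [not_le, div_mul_eq_mul_div, div_lt_iff₀' hc] at hlt
    have h1 := (h d n k hR _ (by positivity) hlt.le).trans
      (hψerr d n k (hRsub hR).1 hnd _ (by positivity) le_rfl)
    rw [ENNReal.ofReal_le_ofReal_iff (by positivity)] at h1
    linarith
  · -- Above the optimal rate `χ` has error `δ`, but it has error more than `1.05 δ` below
    -- `√(k ^ α / n)`.
    obtain ⟨c, hc, h⟩ := SparsePC.not_maxError_le hδ₀ hδ₁ hα₂ hμ₀ hPC hχ (A := A) hε
    refine ⟨c / c₂, by positivity, fun d n k hR => ?_⟩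
    obtain ⟨-, hn, hk, -, -⟩ := (hRsub hR.1).1
    have hpos : 0 < SparsePC.thetaAlpha α d n k := by
      have hn' : (0 : ℝ) < n := by exact_mod_cast hn
      have hk' : (0 : ℝ) < k := by exact_mod_cast hk
      exact Real.sqrt_pos.2 (by positivity)
    by_contra hlt
    rw [not_le, div_mul_eq_mul_div, lt_div_iff₀' hc₂] at hlt
    exact h d n k ⟨hRsub hR.1, hR.2⟩ _ (by positivity) le_rfl
      ((hχerr d n k hR.1 _ (by positivity) hlt.le).trans (ENNReal.ofReal_le_ofReal (by linarith)))
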